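/- Let $p$ be a prime number, let $G$ be a finite group and let $H\le G$ be a subgroup whose index $[G:H]$ is prime to $p$. Let $\Bbbk$ be a commutative local ring which is an algebra over $\mathbb Z_{(p)}$ (the localization of $\mathbb Z$ at $(p)$). For every group $K$ among the subgroups of $G$, let $\mathcal C(K)$ denote one of the following categories (the same choice for all $K$): 1. the category $\Bbbk K\text{-}\mathrm{Mod}$ of all left $\Bbbk K$-modules; 2. the (unbounded) derived category $\mathrm D(\Bbbk K)$ of $\Bbbk K\text{-}\mathrm{Mod}$; 3. if $\Bbbk$ is a field, the stable category $\Bbbk K\text{-}\mathrm{Stab}$, i.e. the quotient of $\Bbbk K\text{-}\mathrm{Mod}$ in which two morphisms are identified when their difference factors through a projective module. Notation. For $g,x\in G$ write ${}^g x=gxg^{-1}$, and put $H^g=g^{-1}Hg$, $H[g]=H^g\cap H$ and $H[g_2,g_1]=H^{g_2g_1}\cap H^{g_1}\cap H$. If $K,L\le G$ and ${}^gK\le L$, the $g$-twisted restriction ${}^g\mathrm{Res}^L_K:\mathcal C(L)\to\mathcal C(K)$ is restriction along the homomorphism $K\to L$, $x\mapsto {}^gx$; for $g=1$ it is the usual restriction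 $\mathrm{Res}^L_K$. If $K\le L$ and $l\in L$, then $w\mapsto l\,w$ defines a natural isomorphism $\tau_l:\mathrm{Res}^L_K\to{}^l\mathrm{Res}^L_K$. (In cases 2 and 3 these are induced from $\Bbbk K$-modules, degreewise on complexes in case 2.) Composites of twisted restrictions are identified via ${}^{g_1}\mathrm{Res}\circ{}^{g_2}\mathrm{Res}={}^{g_2g_1}\mathrm{Res}$. (A) Let $V',V''\in\mathcal C(G)$. Then $f_0\mapsto\mathrm{Res}^G_H(f_0)$ is a bijection from the set of morphisms $f_0:V'\to V''$ in $\mathcal C(G)$ onto the set of those morphisms $f:\mathrm{Res}^G_HV'\to\mathrm{Res}^G_HV''$ in $\mathcal C(H)$ such that $${}^g\mathrm{Res}^H_{H[g]}(f)\circ\tau_g=\tau_g\circ\mathrm{Res}^H_{H[g]}(f)\quad\text{in }\mathcal C(H[g])\text{ for all }g\in G.$$ (B) Let $W\in\mathcal C(H)$ and, for every $g\in G$, let $\sigma_g:\mathrm{Res}^H_{H[g]}W\to{}^g\mathrm{Res}^H_{H[g]}W$ be an isomorphism in $\mathcal C(H[g])$. Suppose that (I) $\sigma_h=\tau_h$ in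 $\mathcal C(H)$ for every $h\in H$ (note that $H[h]=H$); (II) for all $g_1,g_2\in G$, $${}^{g_1}\mathrm{Res}^{H[g_2]}_{H[g_2,g_1]}(\sigma_{g_2})\circ\mathrm{Res}^{H[g_1]}_{H[g_2,g_1]}(\sigma_{g_1})=\mathrm{Res}^{H[g_2g_1]}_{H[g_2,g_1]}(\sigma_{g_2g_1})$$ in $\mathcal C(H[g_2,g_1])$, as morphisms $\mathrm{Res}^H_{H[g_2,g_1]}W\to{}^{g_2g_1}\mathrm{Res}^H_{H[g_2,g_1]}W$. Then there are an object $V\in\mathcal C(G)$ and an isomorphism $f:\mathrm{Res}^G_HV\to W$ in $\mathcal C(H)$ such that $${}^g\mathrm{Res}^H_{H[g]}(f)\circ\tau_g=\sigma_g\circ\mathrm{Res}^H_{H[g]}(f)\quad\text{in }\mathcal C(H[g])\text{ for every }g\in G.$$ Moreover the pair $(V,f)$ is unique up to unique isomorphism: if $(V_1,f_1)$ and $(V_2,f_2)$ are two such pairs, there is exactly one isomorphism $e:V_1\to V_2$ in $\mathcal C(G)$ with $f_2\circ\mathrm{Res}^G_H(e)=f_1$. -/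

import Mathlib

open CategoryTheory Limits

universe u a b

noncomputable section

/-! ### Coefficients -/

instance isPrime_span_natCast (p : ℕ) [hp : Fact p.Prime] :
    (Ideal.span {(p : ℤ)}).IsPrime :=
  (Ideal.span_singleton_prime (by exact_mod_cast hp.out.ne_zero)).2
    (Nat.prime_iff_prime_int.1 hp.out)

/-- The ring `ℤ_(p)`, the localization of `ℤ` at the prime ideal `(p)`. -/
abbrev ZLocAt (p : ℕ) [Fact p.Prime] : Type := Localization.AtPrime (Ideal.span {(p : ℤ)})

/-! ### Systems of categories with restriction functors

The three families `C(-)` (plain, derived, stable) come with the same kind of data: a category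
`C(K)` for each group `K`, restriction along injective homomorphisms, the canonical identification
of a composite of restrictions with the restriction along the composite, and the canonical
isomorphisms `τ_l` between restrictions along conjugate homomorphisms. This structure only bundles
these data, so that the statement can be written once; it is used only for the three concrete
systems `plainSystem`, `derivedSystem` and `stableSystem` built below. -/
structure ResSystem where
  /-- the category `C(K)` -/
  Cat (K : Type u) [Group K] : Type a
  [cat (K : Type u) [Group K] : Category.{b} (Cat K)]
  /-- restriction along an injective homomorphism -/
  res {K L : Type u} [Group K] [Group L] (φ : K →* L) (hφ : Function.Injective φ) : Cat L ⥤ Cat K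
  /-- the identification of `Res_ψ ∘ Res_φ` with `Res_χ`, where `χ = φ ∘ ψ` -/
  resComp {J K L : Type u} [Group J] [Group K] [Group L]
    (ψ : J →* K) (hψ : Function.Injective ψ) (φ : K →* L) (hφ : Function.Injective φ)
    (χ : J →* L) (hχ : Function.Injective χ) (h : ∀ x, χ x = φ (ψ x)) :
    res φ hφ ⋙ res ψ hψ ≅ res χ hχ
  /-- the isomorphism `τ_l : Res_φ ≅ Res_ψ` given by the action of `l`, where `ψ = l φ l⁻¹` -/
  twist {K L : Type u} [Group K] [Group L] (φ : K →* L) (hφ : Function.Injective φ)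
    (ψ : K →* L) (hψ : Function.Injective ψ) (l : L) (h : ∀ x, ψ x = l * φ x * l⁻¹) :
    res φ hφ ≅ res ψ hψ

attribute [instance] ResSystem.cat

/-! ### Plain representations -/

namespace PlainRep

variable {k : Type u} [CommRing k] {J K L : Type u} [Group J] [Group K] [Group L]

/-- `Res_ψ ∘ Res_φ = Res_χ` when `χ = φ ∘ ψ`: the identity map of the underlying modules. -/
def resCompIso (ψ : J →* K) (φ : K →* L) (χ : J →* L) (h : ∀ x, χ x = φ (ψ x)) :
    Rep.resFunctor.{u} (k := k) φ ⋙ Rep.resFunctor.{u} (k := k) ψ ≅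
      Rep.resFunctor.{u} (k := k) χ :=
  NatIso.ofComponents
    (fun W ↦
      { hom := Rep.ofHom ⟨LinearMap.id, fun x ↦ by ext; simp [h]⟩
        inv := Rep.ofHom ⟨LinearMap.id, fun x ↦ by ext; simp [h]⟩
        hom_inv_id := by ext x; rfl
        inv_hom_id := by ext x; rfl })
    (fun {V W} f ↦ by ext x; rfl)

/-- If `ψ x = l (φ x) l⁻¹` for all `x`, then the action of `l` is a natural isomorphism
`τ_l : Res_φ W ≅ Res_ψ W`, `w ↦ l w`. -/
def twistIso (φ ψ : K →* L) (l : L) (h : ∀ x, ψ x = l * φ x * l⁻¹) :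
    Rep.resFunctor.{u} (k := k) φ ≅ Rep.resFunctor.{u} (k := k) ψ :=
  NatIso.ofComponents
    (fun W ↦
      { hom := Rep.ofHom ⟨W.ρ l, fun x ↦ by
          simp only [MonoidHom.comp_apply, h, ← Module.End.mul_eq_comp, ← map_mul]; simp⟩
        inv := Rep.ofHom ⟨W.ρ l⁻¹, fun x ↦ by
          simp only [MonoidHom.comp_apply, h, ← Module.End.mul_eq_comp, ← map_mul]
          simp [mul_assoc]⟩
        hom_inv_id := by ext x; simp
        inv_hom_id := by ext x; simp })
    (fun {V W} f ↦ by ext x; simp [Rep.hom_comm_apply])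

/-- Restriction along an injective homomorphism preserves projective representations. -/
theorem res_projective (φ : K →* L) (hφ : Function.Injective φ) (P : Rep.{u} k L)
    [Projective P] : Projective ((Rep.resFunctor.{u} (k := k) φ).obj P) := by
  let e : K ≃* φ.range := MonoidHom.ofInjective hφ
  let F := Rep.resFunctor.{u} (k := k) e.toMonoidHom
  have : F.Full := Rep.full_res _ e.surjective
  have : F.EssSurj := ⟨fun M ↦ ⟨(Rep.resFunctor.{u} (k := k) e.symm.toMonoidHom).obj M,
    ⟨(resCompIso e.toMonoidHom e.symm.toMonoidHom (MonoidHom.id K)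
      (fun x ↦ by simp)).app M⟩⟩⟩
  have : F.IsEquivalence := {}
  have h1 : Projective ((Rep.resFunctor.{u} (k := k) φ.range.subtype).obj P) :=
    Functor.projective_obj_of_projective _ ‹_›
  have h2 : Projective (F.obj ((Rep.resFunctor.{u} (k := k) φ.range.subtype).obj P)) :=
    (F.asEquivalence.map_projective_iff _).2 h1
  exact Projective.of_iso
    ((resCompIso e.toMonoidHom φ.range.subtype φ (fun x ↦ rfl)).app P) h2

end PlainRep

/-- Plain representations: `C(K)` is the category of `kK`-modules. -/
def plainSystem (k : Type u) [CommRing k] : ResSystem.{u, u + 1, u} where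
  Cat K _ := Rep.{u} k K
  res φ _ := Rep.resFunctor φ
  resComp ψ _ φ _ χ _ h := PlainRep.resCompIso ψ φ χ h
  twist φ _ ψ _ l h := PlainRep.twistIso φ ψ l h

/-! ### Derived categories -/

section Derived

attribute [local instance] HasDerivedCategory.standard

variable {A B C : Type (u + 1)} [Category.{u} A] [Category.{u} B] [Category.{u} C]
  [Abelian A] [Abelian B] [Abelian C]

/-- An isomorphism of exact functors induces, degreewise on complexes, an isomorphism of the
functors induced on derived categories. -/
def derivedMapIso {F F' : A ⥤ B}
    [F.Additive] [PreservesFiniteLimits F] [PreservesFiniteColimits F]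
    [F'.Additive] [PreservesFiniteLimits F'] [PreservesFiniteColimits F'] (e : F ≅ F') :
    F.mapDerivedCategory ≅ F'.mapDerivedCategory :=
  Localization.liftNatIso DerivedCategory.Q
    (HomologicalComplex.quasiIso A (ComplexShape.up ℤ))
    (F.mapHomologicalComplex (ComplexShape.up ℤ) ⋙ DerivedCategory.Q)
    (F'.mapHomologicalComplex (ComplexShape.up ℤ) ⋙ DerivedCategory.Q)
    F.mapDerivedCategory F'.mapDerivedCategory
    (Functor.isoWhiskerRight (NatIso.mapHomologicalComplex e _) DerivedCategory.Q)

/-- The functors induced on derived categories by two exact functors `F` and `F'` compose to the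
functor induced by their composite. -/
def derivedCompIso (F : A ⥤ B) (F' : B ⥤ C)
    [F.Additive] [PreservesFiniteLimits F] [PreservesFiniteColimits F]
    [F'.Additive] [PreservesFiniteLimits F'] [PreservesFiniteColimits F'] :
    F.mapDerivedCategory ⋙ F'.mapDerivedCategory ≅ (F ⋙ F').mapDerivedCategory :=
  letI : Localization.Lifting DerivedCategory.Q
      (HomologicalComplex.quasiIso A (ComplexShape.up ℤ))
      ((F ⋙ F').mapHomologicalComplex (ComplexShape.up ℤ) ⋙ DerivedCategory.Q)
      (F.mapDerivedCategory ⋙ F'.mapDerivedCategory) :=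
    ⟨(Functor.associator _ _ _).symm ≪≫
      Functor.isoWhiskerRight F.mapDerivedCategoryFactors F'.mapDerivedCategory ≪≫
      Functor.associator _ _ _ ≪≫
      Functor.isoWhiskerLeft _ F'.mapDerivedCategoryFactors ≪≫
      (Functor.associator _ _ _).symm ≪≫
      Functor.isoWhiskerRight
        (Functor.mapHomologicalComplexCompIso (Iso.refl (F ⋙ F')) _) DerivedCategory.Q⟩
  Localization.liftNatIso DerivedCategory.Q
    (HomologicalComplex.quasiIso A (ComplexShape.up ℤ))
    ((F ⋙ F').mapHomologicalComplex (ComplexShape.up ℤ) ⋙ DerivedCategory.Q)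
    ((F ⋙ F').mapHomologicalComplex (ComplexShape.up ℤ) ⋙ DerivedCategory.Q)
    (F.mapDerivedCategory ⋙ F'.mapDerivedCategory) (F ⋙ F').mapDerivedCategory (Iso.refl _)

/-- Derived categories: `C(K) = D(kK)` is the (unbounded) derived category of the category of
`kK`-modules, and restriction is induced by the (exact) plain restriction functor. -/
def derivedSystem (k : Type u) [CommRing k] : ResSystem.{u, u + 1, u + 1} where
  Cat K _ := DerivedCategory (Rep.{u} k K)
  res φ _ := (Rep.resFunctor.{u} (k := k) φ).mapDerivedCategory
  resComp ψ _ φ _ χ _ h :=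
    derivedCompIso (Rep.resFunctor.{u} (k := k) φ) (Rep.resFunctor.{u} (k := k) ψ) ≪≫
      derivedMapIso (PlainRep.resCompIso ψ φ χ h)
  twist φ _ ψ _ l h := derivedMapIso (PlainRep.twistIso φ ψ l h)

end Derived

/-! ### Stable categories -/

/-- Two morphisms of representations are stably equal if their difference factors through a
projective representation. -/
def stableRel (k : Type u) [CommRing k] (K : Type u) [Group K] : HomRel (Rep.{u} k K) :=
  fun X Y f g ↦ ∃ (P : Rep.{u} k K) (i : X ⟶ P) (q : P ⟶ Y), Projective P ∧ f - g = i ≫ q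

open scoped ZeroObject in
instance stableRel_congruence (k : Type u) [CommRing k] (K : Type u) [Group K] :
    Congruence (stableRel k K) where
  equivalence :=
    { refl := fun f ↦ ⟨0, 0, 0, inferInstance, by simp⟩
      symm := by
        rintro f g ⟨P, i, q, hP, h⟩
        exact ⟨P, -i, q, hP, by rw [Preadditive.neg_comp, ← h, neg_sub]⟩
      trans := by
        rintro f g l ⟨P, i, q, hP, h⟩ ⟨P', i', q', hP', h'⟩
        refine ⟨P ⊞ P', biprod.lift i i', biprod.desc q q', inferInstance, ?_⟩
        rw [biprod.lift_desc, ← h, ← h', sub_add_sub_cancel] }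
  comp_left := by
    rintro X Y Z f g g' ⟨P, i, q, hP, h⟩
    exact ⟨P, f ≫ i, q, hP, by rw [← Preadditive.comp_sub, h, Category.assoc]⟩
  comp_right := by
    rintro X Y Z f f' g ⟨P, i, q, hP, h⟩
    exact ⟨P, i, q ≫ g, hP, by rw [← Preadditive.sub_comp, h, Category.assoc]⟩

/-- The stable category of `kK`-modules: the additive quotient of the category of `kK`-modules
by the projective modules. -/
abbrev StableRep (k : Type u) [CommRing k] (K : Type u) [Group K] : Type (u + 1) :=
  CategoryTheory.Quotient (stableRel k K)

namespace StableRep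

variable {k : Type u} [CommRing k] {K L : Type u} [Group K] [Group L]

/-- Restriction on stable categories. -/
def res (φ : K →* L) (hφ : Function.Injective φ) : StableRep k L ⥤ StableRep k K :=
  CategoryTheory.Quotient.lift _
    (Rep.resFunctor.{u} (k := k) φ ⋙ CategoryTheory.Quotient.functor (stableRel k K)) (by
    rintro X Y f g ⟨P, i, q, hP, h⟩
    refine CategoryTheory.Quotient.sound _ ⟨(Rep.resFunctor φ).obj P, (Rep.resFunctor φ).map i,
      (Rep.resFunctor φ).map q, PlainRep.res_projective φ hφ P, ?_⟩
    rw [← Functor.map_sub, h, Functor.map_comp])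

end StableRep

/-- Stable categories: `C(K)` is the stable category of `kK`-modules. All the structure is
induced by the plain one. -/
def stableSystem (k : Type u) [Field k] : ResSystem.{u, u + 1, u} where
  Cat K _ := StableRep k K
  res φ hφ := StableRep.res φ hφ
  resComp ψ hψ φ hφ χ hχ h := CategoryTheory.Quotient.natIsoLift _
    (Functor.isoWhiskerRight (PlainRep.resCompIso ψ φ χ h)
        (CategoryTheory.Quotient.functor (stableRel k _)) :
      CategoryTheory.Quotient.functor (stableRel k _) ⋙ StableRep.res φ hφ ⋙ StableRep.res ψ hψ ≅
        CategoryTheory.Quotient.functor (stableRel k _) ⋙ StableRep.res χ hχ)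
  twist φ hφ ψ hψ l h := CategoryTheory.Quotient.natIsoLift _
    (Functor.isoWhiskerRight (PlainRep.twistIso φ ψ l h)
        (CategoryTheory.Quotient.functor (stableRel k _)) :
      CategoryTheory.Quotient.functor (stableRel k _) ⋙ StableRep.res φ hφ ≅
        CategoryTheory.Quotient.functor (stableRel k _) ⋙ StableRep.res ψ hψ)

/-! ### Subgroups, conjugation and twisted restriction -/

section Subgroups

variable {G : Type u} [Group G]

/-- `H^g = g⁻¹ H g`. -/
def conjBy (H : Subgroup G) (g : G) : Subgroup G := H.map (MulAut.conj g⁻¹).toMonoidHom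

theorem mem_conjBy {H : Subgroup G} {g x : G} : x ∈ conjBy H g ↔ g * x * g⁻¹ ∈ H := by
  constructor
  · rintro ⟨y, hy, rfl⟩
    simpa [mul_assoc] using hy
  · intro h
    exact ⟨_, h, by simp [mul_assoc]⟩

/-- `H[g] = H^g ∩ H`. -/
def inter1 (H : Subgroup G) (g : G) : Subgroup G := conjBy H g ⊓ H

/-- `H[g₂, g₁] = H^{g₂ g₁} ∩ H^{g₁} ∩ H`. -/
def inter2 (H : Subgroup G) (g₂ g₁ : G) : Subgroup G := conjBy H (g₂ * g₁) ⊓ conjBy H g₁ ⊓ H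

/-- For `K, L ≤ G` with `g K g⁻¹ ≤ L`, the homomorphism `K → L`, `x ↦ g x g⁻¹`. -/
def conjHom (g : G) (K L : Subgroup G) (h : ∀ x ∈ K, g * x * g⁻¹ ∈ L) : K →* L :=
  ((MulAut.conj g).toMonoidHom.comp K.subtype).codRestrict L fun x ↦ h x x.2

theorem conjHom_injective (g : G) (K L : Subgroup G) (h : ∀ x ∈ K, g * x * g⁻¹ ∈ L) :
    Function.Injective (conjHom g K L h) := fun _ _ hxy ↦
  Subtype.ext ((MulAut.conj g).injective (congrArg Subtype.val hxy))

/-- The homomorphism `K → G`, `x ↦ g x g⁻¹`. -/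
def conjHomTop (g : G) (K : Subgroup G) : K →* G := (MulAut.conj g).toMonoidHom.comp K.subtype

theorem conjHomTop_injective (g : G) (K : Subgroup G) : Function.Injective (conjHomTop g K) :=
  (MulAut.conj g).injective.comp K.subtype_injective

theorem inter1_conj (H : Subgroup G) (g : G) : ∀ x ∈ inter1 H g, g * x * g⁻¹ ∈ H :=
  fun _ hx ↦ mem_conjBy.1 hx.1

theorem inter2_conj (H : Subgroup G) (g₂ g₁ : G) : ∀ x ∈ inter2 H g₂ g₁, g₁ * x * g₁⁻¹ ∈ H :=
  fun _ hx ↦ mem_conjBy.1 hx.1.2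

theorem inter2_conj_mul (H : Subgroup G) (g₂ g₁ : G) :
    ∀ x ∈ inter2 H g₂ g₁, (g₂ * g₁) * x * (g₂ * g₁)⁻¹ ∈ H :=
  fun _ hx ↦ mem_conjBy.1 hx.1.1

theorem inter2_le (H : Subgroup G) (g₂ g₁ : G) : inter2 H g₂ g₁ ≤ inter1 H g₁ :=
  fun _ hx ↦ ⟨hx.1.2, hx.2⟩

theorem inter2_le_mul (H : Subgroup G) (g₂ g₁ : G) : inter2 H g₂ g₁ ≤ inter1 H (g₂ * g₁) :=
  fun _ hx ↦ ⟨hx.1.1, hx.2⟩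

theorem inter2_conj_mem (H : Subgroup G) (g₂ g₁ : G) :
    ∀ x ∈ inter2 H g₂ g₁, g₁ * x * g₁⁻¹ ∈ inter1 H g₂ :=
  fun _ hx ↦ ⟨mem_conjBy.2 (by simpa [mul_assoc] using mem_conjBy.1 hx.1.1),
    mem_conjBy.1 hx.1.2⟩

end Subgroups

namespace ResSystem

variable (S : ResSystem.{u, a, b}) {G : Type u} [Group G]

/-- `Res^G_K` for `K ≤ G`. -/
def resTop (K : Subgroup G) : S.Cat G ⥤ S.Cat K := S.res K.subtype K.subtype_injective

/-- The `g`-twisted restriction `ᵍRes^G_K` for `K ≤ G`. -/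
def gResTop (g : G) (K : Subgroup G) : S.Cat G ⥤ S.Cat K :=
  S.res (conjHomTop g K) (conjHomTop_injective g K)

/-- `Res^L_K` for `K ≤ L ≤ G`. -/
def resSub {K L : Subgroup G} (h : K ≤ L) : S.Cat L ⥤ S.Cat K :=
  S.res (Subgroup.inclusion h) (Subgroup.inclusion_injective h)

/-- The `g`-twisted restriction `ᵍRes^L_K` for `K, L ≤ G` with `g K g⁻¹ ≤ L`. -/
def gRes (g : G) {K L : Subgroup G} (h : ∀ x ∈ K, g * x * g⁻¹ ∈ L) : S.Cat L ⥤ S.Cat K :=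
  S.res (conjHom g K L h) (conjHom_injective g K L h)

/-- `τ_g : Res^G_K ≅ ᵍRes^G_K`, the action of `g ∈ G`. -/
def tauTop (g : G) (K : Subgroup G) : S.resTop K ≅ S.gResTop g K :=
  S.twist _ _ _ _ g fun _ ↦ rfl

/-- `τ_h : Res^L_K ≅ ʰRes^L_K`, the action of `h ∈ L`, for `K ≤ L ≤ G`. -/
def tauSub {K L : Subgroup G} (hKL : K ≤ L) (h : L)
    (hc : ∀ x ∈ K, (h : G) * x * (h : G)⁻¹ ∈ L) : S.resSub hKL ≅ S.gRes (h : G) hc :=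
  S.twist _ _ _ _ h fun _ ↦ rfl

/-- `Res^L_K Res^G_L = Res^G_K`. -/
def resTopComp {K L : Subgroup G} (h : K ≤ L) : S.resTop L ⋙ S.resSub h ≅ S.resTop K :=
  S.resComp _ _ _ _ _ _ fun _ ↦ rfl

/-- `ᵍRes^L_K Res^G_L = ᵍRes^G_K`. -/
def gResTopComp (g : G) {K L : Subgroup G} (h : ∀ x ∈ K, g * x * g⁻¹ ∈ L) :
    S.resTop L ⋙ S.gRes g h ≅ S.gResTop g K :=
  S.resComp _ _ _ _ _ _ fun _ ↦ rfl

/-- `Res^L_K Res^M_L = Res^M_K`. -/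
def resSubComp {K L M : Subgroup G} (h : K ≤ L) (h' : L ≤ M) :
    S.resSub h' ⋙ S.resSub h ≅ S.resSub (h.trans h') :=
  S.resComp _ _ _ _ _ _ fun _ ↦ rfl

/-- `Res^L_K ᵍRes^M_L = ᵍRes^M_K`. -/
def gResCompRes (g : G) {K L M : Subgroup G} (h : K ≤ L) (h' : ∀ x ∈ L, g * x * g⁻¹ ∈ M)
    (h'' : ∀ x ∈ K, g * x * g⁻¹ ∈ M) : S.gRes g h' ⋙ S.resSub h ≅ S.gRes g h'' :=
  S.resComp _ _ _ _ _ _ fun _ ↦ rfl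

/-- `ᵍRes^L_K Res^M_L = ᵍRes^M_K`. -/
def resCompGRes (g : G) {K L M : Subgroup G} (h : ∀ x ∈ K, g * x * g⁻¹ ∈ L) (h' : L ≤ M)
    (h'' : ∀ x ∈ K, g * x * g⁻¹ ∈ M) : S.resSub h' ⋙ S.gRes g h ≅ S.gRes g h'' :=
  S.resComp _ _ _ _ _ _ fun _ ↦ rfl

/-- `^{g₁}Res^L_K ^{g₂}Res^M_L = ^{g₂g₁}Res^M_K`. -/
def gResComp (g₂ g₁ : G) {K L M : Subgroup G} (h : ∀ x ∈ K, g₁ * x * g₁⁻¹ ∈ L)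
    (h' : ∀ x ∈ L, g₂ * x * g₂⁻¹ ∈ M)
    (h'' : ∀ x ∈ K, (g₂ * g₁) * x * (g₂ * g₁)⁻¹ ∈ M) :
    S.gRes g₂ h' ⋙ S.gRes g₁ h ≅ S.gRes (g₂ * g₁) h'' :=
  S.resComp _ _ _ _ _ _ fun x ↦ Subtype.ext (by simp [conjHom, mul_assoc])

/-- A morphism `f : Res^G_H V' ⟶ Res^G_H V''` is `G`-invariant if
`ᵍRes^H_{H[g]}(f) ∘ τ_g = τ_g ∘ Res^H_{H[g]}(f)` in `C(H[g])` for all `g ∈ G`. -/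
def IsInvariant (H : Subgroup G) {V' V'' : S.Cat G}
    (f : (S.resTop H).obj V' ⟶ (S.resTop H).obj V'') : Prop :=
  ∀ g : G,
    (S.tauTop g (inter1 H g)).hom.app V' ≫
      ((S.gResTopComp g (inter1_conj H g)).inv.app V' ≫
        (S.gRes g (inter1_conj H g)).map f ≫
          (S.gResTopComp g (inter1_conj H g)).hom.app V'') =
    ((S.resTopComp (inf_le_right : inter1 H g ≤ H)).inv.app V' ≫
        (S.resSub (inf_le_right : inter1 H g ≤ H)).map f ≫
          (S.resTopComp (inf_le_right : inter1 H g ≤ H)).hom.app V'') ≫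
      (S.tauTop g (inter1 H g)).hom.app V''

/-- A family of isomorphisms `σ_g : Res^H_{H[g]} W ≅ ᵍRes^H_{H[g]} W` in `C(H[g])`, `g ∈ G`. -/
abbrev GluingFamily (H : Subgroup G) (W : S.Cat H) :=
  ∀ g : G, (S.resSub (inf_le_right : inter1 H g ≤ H)).obj W ≅
    (S.gRes g (inter1_conj H g)).obj W

/-- Condition (I): `σ_h = τ_h` for all `h ∈ H` (where `H[h] = H`). -/
def ExtendsTau {H : Subgroup G} {W : S.Cat H} (σ : S.GluingFamily H W) : Prop :=
  ∀ h : H, (σ h).hom =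
    (S.tauSub (inf_le_right : inter1 H (h : G) ≤ H) h (inter1_conj H h)).hom.app W

/-- Condition (II), the cocycle condition: in `C(H[g₂, g₁])`,
`^{g₁}Res(σ_{g₂}) ∘ Res(σ_{g₁}) = Res(σ_{g₂g₁})` as morphisms
`Res^H_{H[g₂,g₁]} W ⟶ ^{g₂g₁}Res^H_{H[g₂,g₁]} W`. -/
def IsCocycle {H : Subgroup G} {W : S.Cat H} (σ : S.GluingFamily H W) : Prop :=
  ∀ g₁ g₂ : G,
    ((S.resSubComp (inter2_le H g₂ g₁) inf_le_right).inv.app W ≫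
        (S.resSub (inter2_le H g₂ g₁)).map (σ g₁).hom ≫
          (S.gResCompRes g₁ (inter2_le H g₂ g₁) (inter1_conj H g₁)
            (inter2_conj H g₂ g₁)).hom.app W) ≫
      ((S.resCompGRes g₁ (inter2_conj_mem H g₂ g₁) inf_le_right
            (inter2_conj H g₂ g₁)).inv.app W ≫
        (S.gRes g₁ (inter2_conj_mem H g₂ g₁)).map (σ g₂).hom ≫
          (S.gResComp g₂ g₁ (inter2_conj_mem H g₂ g₁) (inter1_conj H g₂)
            (inter2_conj_mul H g₂ g₁)).hom.app W) =
    (S.resSubComp (inter2_le_mul H g₂ g₁) inf_le_right).inv.app W ≫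
      (S.resSub (inter2_le_mul H g₂ g₁)).map (σ (g₂ * g₁)).hom ≫
        (S.gResCompRes (g₂ * g₁) (inter2_le_mul H g₂ g₁) (inter1_conj H (g₂ * g₁))
          (inter2_conj_mul H g₂ g₁)).hom.app W

/-- The isomorphism `f : Res^G_H V ≅ W` is compatible with the family `σ`: for every `g ∈ G`,
`ᵍRes^H_{H[g]}(f) ∘ τ_g = σ_g ∘ Res^H_{H[g]}(f)` as morphisms
`Res^G_{H[g]} V ⟶ ᵍRes^H_{H[g]} W` in `C(H[g])`. -/
def IsExtension {H : Subgroup G} {W : S.Cat H} (σ : S.GluingFamily H W) (V : S.Cat G)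
    (f : (S.resTop H).obj V ≅ W) : Prop :=
  ∀ g : G,
    (S.tauTop g (inter1 H g)).hom.app V ≫
      ((S.gResTopComp g (inter1_conj H g)).inv.app V ≫
        (S.gRes g (inter1_conj H g)).map f.hom) =
    ((S.resTopComp (inf_le_right : inter1 H g ≤ H)).inv.app V ≫
        (S.resSub (inf_le_right : inter1 H g ≤ H)).map f.hom) ≫
      (σ g).hom

/-- Part (A): restriction `f₀ ↦ Res^G_H(f₀)` is a bijection from the morphisms `V' ⟶ V''` in
`C(G)` onto the `G`-invariant morphisms `Res^G_H V' ⟶ Res^G_H V''` in `C(H)`. -/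
def MorphismsDescend (H : Subgroup G) : Prop :=
  ∀ V' V'' : S.Cat G,
    Set.BijOn (fun f₀ : V' ⟶ V'' ↦ (S.resTop H).map f₀) Set.univ {f | S.IsInvariant H f}

/-- Part (B): every object `W` of `C(H)` with a family `σ` that satisfies (I) and (II) extends to
an object of `C(G)` compatibly with `σ`, and the extension `(V, f)` is unique up to unique
isomorphism of such pairs. -/
def ObjectsDescend (H : Subgroup G) : Prop :=
  ∀ (W : S.Cat H) (σ : S.GluingFamily H W), S.ExtendsTau σ → S.IsCocycle σ →
    (∃ (V : S.Cat G) (f : (S.resTop H).obj V ≅ W), S.IsExtension σ V f) ∧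
    ∀ (V₁ V₂ : S.Cat G) (f₁ : (S.resTop H).obj V₁ ≅ W) (f₂ : (S.resTop H).obj V₂ ≅ W),
      S.IsExtension σ V₁ f₁ → S.IsExtension σ V₂ f₂ →
        ∃! e : V₁ ≅ V₂, (S.resTop H).map e.hom ≫ f₂.hom = f₁.hom

end ResSystem

end

/-! The index of `H` is prime to `p`, hence invertible in `k`, with inverse `c`. Restriction to `H`
has coinduction as right adjoint, and the unit `v ↦ (x ↦ x v)` has the natural retraction `φ ↦ c ∑ x
φ(x⁻¹)`, summed over `G/H`. Such a retraction makes comonadic descent formal: restriction is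
faithful, a morphism that commutes with the canonical coactions is a restriction
(`exists_res_map_eq`), and a coalgebra `s : W ⟶ Res Coind W` comes from `C(G)` once a certain
idempotent of `Coind W` splits (`exists_descent`).

Mackey's decomposition translates this into conjugations. A morphism into `Res Coind W` is
determined by its parts, obtained by evaluating coinduced functions at the elements `g`, and the
parts at representatives of the double cosets can be prescribed (`eq_of_part_eq`, `exists_part_eq`).
The canonical coaction on `Res V` has parts `τ_g`, so invariance means commuting with coactions. A
family `σ` with (I) and (II) is the family of parts of a coalgebra structure (`exists_coaction`):
the counit law says `σ_1 = 1`, and coassociativity is the cocycle condition.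

The three kinds of categories are treated together as a `RepSystem`. All structural morphisms are
induced by natural transformations between exact functors on representations, so every identity
among them is checked on modules. Idempotents split in all three cases by `exists_splitting`: the
image of `e` is the telescope of `e`, a complement of a split monomorphism on a countable direct
sum. -/

noncomputable section

/-! ### Systems of categories functorial in exact functors -/

/-- An additive exact functor between categories of representations that preserves projective
objects. -/
structure RepFunctor (k : Type u) [CommRing k] (K L : Type u) [Group K] [Group L] where
  /-- the underlying functor -/
  fn : Rep.{u} k K ⥤ Rep.{u} k L
  [additive : fn.Additive]
  [preservesFiniteLimits : PreservesFiniteLimits fn]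
  [preservesFiniteColimits : PreservesFiniteColimits fn]
  [preservesProjectiveObjects : fn.PreservesProjectiveObjects]

namespace RepFunctor

attribute [instance] additive preservesFiniteLimits preservesFiniteColimits
  preservesProjectiveObjects

variable {k : Type u} [CommRing k] {J K L : Type u} [Group J] [Group K] [Group L]

variable (k K) in
/-- The identity functor. -/
abbrev id : RepFunctor k K K :=
  { fn := 𝟭 _
    preservesProjectiveObjects := ⟨fun h ↦ h⟩ }

/-- The composite of two functors. -/
abbrev comp (A : RepFunctor k J K) (B : RepFunctor k K L) : RepFunctor k J L where
  fn := A.fn ⋙ B.fn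

variable (k) in
/-- Restriction along an injective homomorphism. -/
abbrev res (φ : K →* L) (hφ : Function.Injective φ) : RepFunctor k L K :=
  { fn := Rep.resFunctor.{u} (k := k) φ
    preservesProjectiveObjects := ⟨fun h ↦ by
      have := h
      exact PlainRep.res_projective φ hφ _⟩ }

variable (k) in
/-- Coinduction from a subgroup of a finite group. -/
abbrev coind [Finite L] (K : Subgroup L) : RepFunctor k K L :=
  { fn := Rep.coindFunctor.{u} k K.subtype
    additive := ⟨fun {_ _} _ _ ↦ rfl⟩
    -- Coinduction is right adjoint to restriction and, the group being finite, also left adjoint to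
    -- it. Hence it is exact, and it preserves projectives because restriction preserves
    -- epimorphisms.
    preservesFiniteLimits :=
      have : PreservesLimitsOfSize.{0, 0} (Rep.coindFunctor.{u} k K.subtype) :=
        (Rep.resCoindAdjunction.{u} k K.subtype).rightAdjoint_preservesLimits
      PreservesLimitsOfSize.preservesFiniteLimits _
    preservesFiniteColimits := by
      classical
      have : PreservesColimitsOfSize.{0, 0} (Rep.coindFunctor.{u} k K.subtype) :=
        (Rep.coindResAdjunction.{u} k K).leftAdjoint_preservesColimits
      exact PreservesColimitsOfSize.preservesFiniteColimits _
    preservesProjectiveObjects := by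
      classical
      exact Functor.preservesProjectiveObjects_of_adjunction_of_preservesEpimorphisms
        (Rep.coindResAdjunction.{u} k K) }

end RepFunctor

/-- A system of preadditive categories `C(K)` in which every additive exact functor that preserves
projective objects, and every natural transformation between such functors, induces a functor
resp. a natural transformation, compatibly with compositions. -/
structure RepSystem (k : Type u) [CommRing k] where
  /-- the category `C(K)` -/
  Cat (K : Type u) [Group K] : Type a
  [cat (K : Type u) [Group K] : Category.{b} (Cat K)]
  [preadditive (K : Type u) [Group K] : Preadditive (Cat K)]
  /-- the functor induced by an exact functor -/
  map {K L : Type u} [Group K] [Group L] (A : RepFunctor k K L) : Cat K ⥤ Cat L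
  [map_additive {K L : Type u} [Group K] [Group L] (A : RepFunctor k K L) : (map A).Additive]
  /-- the natural transformation induced by a natural transformation -/
  map₂ {K L : Type u} [Group K] [Group L] {A B : RepFunctor k K L} (γ : A.fn ⟶ B.fn) :
    map A ⟶ map B
  /-- compatibility with composition -/
  comp {J K L : Type u} [Group J] [Group K] [Group L] (A : RepFunctor k J K)
    (B : RepFunctor k K L) : map A ⋙ map B ≅ map (A.comp B)
  /-- compatibility with identities -/
  unit (K : Type u) [Group K] : 𝟭 (Cat K) ≅ map (RepFunctor.id k K)
  map₂_id {K L : Type u} [Group K] [Group L] (A : RepFunctor k K L) : map₂ (𝟙 A.fn) = 𝟙 (map A)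
  map₂_comp {K L : Type u} [Group K] [Group L] {A B C : RepFunctor k K L} (γ : A.fn ⟶ B.fn)
    (δ : B.fn ⟶ C.fn) : map₂ (A := A) (B := C) (γ ≫ δ) = map₂ γ ≫ map₂ δ
  map₂_add {K L : Type u} [Group K] [Group L] {A B : RepFunctor k K L} (γ δ : A.fn ⟶ B.fn)
    (V : Cat K) : (map₂ (γ + δ)).app V = (map₂ γ).app V + (map₂ δ).app V
  comp_whiskerRight {J K L : Type u} [Group J] [Group K] [Group L] {A B : RepFunctor k J K}
    (γ : A.fn ⟶ B.fn) (C : RepFunctor k K L) (V : Cat J) :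
    (map C).map ((map₂ γ).app V) ≫ (comp B C).hom.app V =
      (comp A C).hom.app V ≫
        (map₂ (A := A.comp C) (B := B.comp C) (Functor.whiskerRight γ C.fn)).app V
  comp_whiskerLeft {J K L : Type u} [Group J] [Group K] [Group L] (A : RepFunctor k J K)
    {B C : RepFunctor k K L} (γ : B.fn ⟶ C.fn) (V : Cat J) :
    (map₂ γ).app ((map A).obj V) ≫ (comp A C).hom.app V =
      (comp A B).hom.app V ≫
        (map₂ (A := A.comp B) (B := A.comp C) (Functor.whiskerLeft A.fn γ)).app V
  comp_assoc {I J K L : Type u} [Group I] [Group J] [Group K] [Group L] (A : RepFunctor k I J)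
    (B : RepFunctor k J K) (C : RepFunctor k K L) (V : Cat I) :
    (map C).map ((comp A B).hom.app V) ≫ (comp (A.comp B) C).hom.app V ≫
      (map₂ (A := (A.comp B).comp C) (B := A.comp (B.comp C))
        (Functor.associator A.fn B.fn C.fn).hom).app V =
      (comp B C).hom.app ((map A).obj V) ≫ (comp A (B.comp C)).hom.app V
  comp_unit {K L : Type u} [Group K] [Group L] (A : RepFunctor k K L) (V : Cat K) :
    (unit L).hom.app ((map A).obj V) ≫ (comp A (.id k L)).hom.app V ≫
      (map₂ (A := A.comp (RepFunctor.id k L)) (B := A) A.fn.rightUnitor.hom).app V = 𝟙 _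
  /-- split monomorphisms have a complement -/
  exists_complement {K : Type u} [Group K] {X Y : Cat K} (f : X ⟶ Y) (r : Y ⟶ X)
    (h : f ≫ r = 𝟙 X) : ∃ (Z : Cat K) (i : Z ⟶ Y) (q : Y ⟶ Z), i ≫ q = 𝟙 Z ∧ q ≫ i = 𝟙 Y - r ≫ f

attribute [instance] RepSystem.cat RepSystem.preadditive RepSystem.map_additive

namespace RepSystem

variable {k : Type u} [CommRing k] (T : RepSystem.{u, a, b} k)
variable {J K L : Type u} [Group J] [Group K] [Group L]

/-- The isomorphism induced by an isomorphism of functors. -/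
@[simps]
def mapIso {A B : RepFunctor k K L} (e : A.fn ≅ B.fn) : T.map A ≅ T.map B where
  hom := T.map₂ e.hom
  inv := T.map₂ e.inv
  hom_inv_id := by rw [← T.map₂_comp, e.hom_inv_id, T.map₂_id]
  inv_hom_id := by rw [← T.map₂_comp, e.inv_hom_id, T.map₂_id]

/-- The underlying system of categories and restriction functors. -/
def toResSystem : ResSystem.{u, a, b} where
  Cat K _ := T.Cat K
  res φ hφ := T.map (RepFunctor.res k φ hφ)
  resComp ψ hψ φ hφ χ hχ h :=
    T.comp (RepFunctor.res k φ hφ) (RepFunctor.res k ψ hψ) ≪≫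
      T.mapIso (A := (RepFunctor.res k φ hφ).comp (RepFunctor.res k ψ hψ))
        (B := RepFunctor.res k χ hχ) (PlainRep.resCompIso ψ φ χ h)
  twist φ hφ ψ hψ l h :=
    T.mapIso (A := RepFunctor.res k φ hφ) (B := RepFunctor.res k ψ hψ)
      (PlainRep.twistIso φ ψ l h)

end RepSystem

/-- Plain representations. -/
def plainRepSystem (k : Type u) [CommRing k] : RepSystem.{u, u + 1, u} k where
  Cat K _ := Rep.{u} k K
  map A := A.fn
  map₂ γ := γ
  comp _ _ := Iso.refl _
  unit _ := Iso.refl _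
  map₂_id _ := rfl
  map₂_comp _ _ := rfl
  map₂_add _ _ _ := rfl
  comp_whiskerRight _ _ _ := by simp
  comp_whiskerLeft _ _ _ _ := by simp
  comp_assoc _ _ _ _ := by simp
  comp_unit _ _ := by simp
  exists_complement {K _ X Y} f r h := by
    obtain ⟨Z, i, q, h₁, h₂⟩ := IsIdempotentComplete.idempotents_split Y (𝟙 Y - r ≫ f) (by
      simp [reassoc_of% h])
    exact ⟨Z, i, q, h₁, h₂⟩

/-- The equality is definitional, here and for the two other systems, so results about an abstract
`RepSystem` apply to the concrete categories without any transport. -/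
theorem plainRepSystem_toResSystem (k : Type u) [CommRing k] :
    (plainRepSystem k).toResSystem = plainSystem k := rfl

/-! ### The stable system. -/

section Stable

variable (k : Type u) [CommRing k]

theorem stableRel_add (K : Type u) [Group K] ⦃X Y : Rep.{u} k K⦄
    (f₁ f₂ g₁ g₂ : X ⟶ Y) (hf : stableRel k K f₁ f₂)
    (hg : stableRel k K g₁ g₂) : stableRel k K (f₁ + g₁) (f₂ + g₂) := by
  obtain ⟨P, i, q, hP, h⟩ := hf
  obtain ⟨P', i', q', hP', h'⟩ := hg
  refine ⟨P ⊞ P', biprod.lift i i', biprod.desc q q', inferInstance, ?_⟩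
  rw [biprod.lift_desc, ← h, ← h', add_sub_add_comm]

instance (K : Type u) [Group K] : Preadditive (StableRep k K) :=
  CategoryTheory.Quotient.preadditive _ (stableRel_add k K)

instance (K : Type u) [Group K] : (CategoryTheory.Quotient.functor (stableRel k K)).Additive :=
  CategoryTheory.Quotient.functor_additive _ (stableRel_add k K)

variable {k} {K L : Type u} [Group K] [Group L]

/-- The functor induced on stable categories. -/
def StableRep.map (A : RepFunctor k K L) : StableRep k K ⥤ StableRep k L :=
  CategoryTheory.Quotient.lift _ (A.fn ⋙ CategoryTheory.Quotient.functor (stableRel k L)) (by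
    rintro X Y f g ⟨P, i, q, hP, h⟩
    refine CategoryTheory.Quotient.sound _ ⟨A.fn.obj P, A.fn.map i, A.fn.map q, inferInstance, ?_⟩
    rw [← Functor.map_sub, h, Functor.map_comp])

/-- The natural transformation induced on stable categories. -/
def StableRep.map₂ {A B : RepFunctor k K L} (γ : A.fn ⟶ B.fn) :
    StableRep.map A ⟶ StableRep.map B :=
  CategoryTheory.Quotient.natTransLift _
    (Functor.whiskerRight γ (CategoryTheory.Quotient.functor (stableRel k L)) :
      CategoryTheory.Quotient.functor (stableRel k K) ⋙ StableRep.map A ⟶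
        CategoryTheory.Quotient.functor (stableRel k K) ⋙ StableRep.map B)

/-- For representatives, `f ≫ r` is the identity only up to a map `i ≫ q` through a projective `P`.
Enlarging `Y` by `P` absorbs the error: `(f, -i)` is an honest split monomorphism into `Y ⊞ P`,
which has a complement among modules. -/
theorem StableRep.exists_complement {X Y : StableRep k K} (f : X ⟶ Y) (r : Y ⟶ X)
    (h : f ≫ r = 𝟙 X) :
    ∃ (Z : StableRep k K) (i : Z ⟶ Y) (q : Y ⟶ Z), i ≫ q = 𝟙 Z ∧ q ≫ i = 𝟙 Y - r ≫ f := by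
  obtain ⟨X⟩ := X
  obtain ⟨Y⟩ := Y
  let Q := CategoryTheory.Quotient.functor (stableRel k K)
  obtain ⟨f, rfl⟩ := Q.map_surjective (X := X) (Y := Y) f
  obtain ⟨r, rfl⟩ := Q.map_surjective (X := Y) (Y := X) r
  replace h : Q.map (f ≫ r) = Q.map (𝟙 X) := (Q.map_comp f r).trans (h.trans (Q.map_id X).symm)
  obtain ⟨P, i, q, hP, h⟩ := (CategoryTheory.Quotient.functor_map_eq_iff _ _ _).1 h
  have hP0 : Q.map (𝟙 P) = 0 := by
    rw [← Q.map_zero]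
    exact CategoryTheory.Quotient.sound _ ⟨P, 𝟙 P, 𝟙 P, hP, by simp⟩
  let f' : X ⟶ Y ⊞ P := biprod.lift f (-i)
  let r' : Y ⊞ P ⟶ X := biprod.desc r q
  have h' : f' ≫ r' = 𝟙 X := by
    simp only [f', r', biprod.lift_desc, Preadditive.neg_comp, ← h]; abel
  obtain ⟨Z, j, p, h₁, h₂⟩ := IsIdempotentComplete.idempotents_split (Y ⊞ P) (𝟙 _ - r' ≫ f') (by
      simp [reassoc_of% h'])
  -- As `P` is stably zero, `Y ⊞ P` is stably isomorphic to `Y`.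
  have e1 : Q.map (biprod.fst : Y ⊞ P ⟶ Y) ≫ Q.map biprod.inl = 𝟙 _ := by
    have := congrArg Q.map (biprod.total (X := Y) (Y := P))
    have e2 : Q.map (biprod.snd : Y ⊞ P ⟶ P) = 0 := by
      rw [← Category.comp_id (biprod.snd : Y ⊞ P ⟶ P), Functor.map_comp, hP0, comp_zero]
    rw [Functor.map_add, Functor.map_comp, Functor.map_comp, e2, zero_comp, add_zero] at this
    rw [this, Q.map_id]
  refine ⟨Q.obj Z, Q.map (j ≫ biprod.fst), Q.map (biprod.inl ≫ p), ?_, ?_⟩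
  · rw [Functor.map_comp, Functor.map_comp, Category.assoc, reassoc_of% e1, ← Functor.map_comp, h₁,
      Q.map_id]
  · rw [← Functor.map_comp]
    have : (biprod.inl ≫ p) ≫ j ≫ biprod.fst = 𝟙 Y - r ≫ f := by
      rw [Category.assoc, reassoc_of% h₂]
      simp [f', r']
    rw [this, Functor.map_sub, Q.map_id, Functor.map_comp]
    rfl

variable (k) in
/-- Stable categories. -/
def stableRepSystem : RepSystem.{u, u + 1, u} k where
  Cat K _ := StableRep k K
  map A := StableRep.map A
  map_additive {K L _ _} A := ⟨by
    rintro ⟨X⟩ ⟨Y⟩ ⟨f⟩ ⟨g⟩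
    exact congrArg (CategoryTheory.Quotient.functor (stableRel k L)).map
      (A.fn.map_add (f := f) (g := g))⟩
  map₂ γ := StableRep.map₂ γ
  comp A B := CategoryTheory.Quotient.natIsoLift _ (Iso.refl _)
  unit _ := CategoryTheory.Quotient.natIsoLift _ (Iso.refl _)
  map₂_id A := by
    apply CategoryTheory.Quotient.natTrans_ext
    ext X
    exact (CategoryTheory.Quotient.functor _).map_id _
  map₂_comp γ δ := by
    apply CategoryTheory.Quotient.natTrans_ext
    ext X
    exact (CategoryTheory.Quotient.functor _).map_comp _ _
  map₂_add γ δ V := rfl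
  comp_whiskerRight {_ _ _ _ _ _ A B} γ C V := by
    obtain ⟨V⟩ := V
    exact congrArg (CategoryTheory.Quotient.functor (stableRel k _)).map
      (by simp : C.fn.map (γ.app V) ≫ 𝟙 _ = 𝟙 _ ≫ C.fn.map (γ.app V))
  comp_whiskerLeft {_ _ _ _ _ _} A {B C} γ V := by
    obtain ⟨V⟩ := V
    exact congrArg (CategoryTheory.Quotient.functor (stableRel k _)).map
      (by simp : γ.app (A.fn.obj V) ≫ 𝟙 _ = 𝟙 _ ≫ γ.app (A.fn.obj V))
  comp_assoc A B C V := by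
    obtain ⟨V⟩ := V
    exact congrArg (CategoryTheory.Quotient.functor (stableRel k _)).map
      (by simp : C.fn.map (𝟙 (B.fn.obj (A.fn.obj V))) ≫ 𝟙 _ ≫ 𝟙 _ = 𝟙 _ ≫ 𝟙 _)
  comp_unit A V := by
    obtain ⟨V⟩ := V
    exact congrArg (CategoryTheory.Quotient.functor (stableRel k _)).map
      (by simp : 𝟙 (A.fn.obj V) ≫ 𝟙 _ ≫ 𝟙 _ = 𝟙 _)
  exists_complement := StableRep.exists_complement

theorem stableRepSystem_toResSystem (k : Type u) [Field k] :
    (stableRepSystem k).toResSystem = stableSystem k := rfl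

end Stable

/-! ### The derived system. -/

section Derived

attribute [local instance] HasDerivedCategory.standard

/-- The complement is the cone of `f`. Since `f` is a split monomorphism, the connecting morphism
vanishes and `q` is an epimorphism; `𝟙 Y - r ≫ f` is killed by `f`, so it factors through `q`, which
yields the section `i`. -/
theorem Pretriangulated.exists_complement {C : Type*} [Category C] [HasZeroObject C] [HasShift C ℤ]
    [Preadditive C] [∀ n : ℤ, (shiftFunctor C n).Additive] [Pretriangulated C]
    {X Y : C} (f : X ⟶ Y) (r : Y ⟶ X) (h : f ≫ r = 𝟙 X) :
    ∃ (Z : C) (i : Z ⟶ Y) (q : Y ⟶ Z), i ≫ q = 𝟙 Z ∧ q ≫ i = 𝟙 Y - r ≫ f := by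
  obtain ⟨Z, q, d, hT⟩ := Pretriangulated.distinguished_cocone_triangle f
  have hfq : f ≫ q = 0 := Pretriangulated.comp_distTriang_mor_zero₁₂ _ hT
  obtain ⟨i, hi⟩ := Pretriangulated.Triangle.yoneda_exact₂ _ hT (𝟙 Y - r ≫ f) (by
    change f ≫ (𝟙 Y - r ≫ f) = 0
    simp [reassoc_of% h])
  change 𝟙 Y - r ≫ f = q ≫ i at hi
  have : IsSplitMono f := ⟨⟨⟨r, h⟩⟩⟩
  have hd : d = 0 := (Pretriangulated.Triangle.mor₃_eq_zero_iff_mono₁ _ hT).2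
    (inferInstanceAs (Mono f))
  have : Epi q := (Pretriangulated.Triangle.mor₃_eq_zero_iff_epi₂ _ hT).1 hd
  refine ⟨Z, i, q, ?_, hi.symm⟩
  change Z ⟶ Y at i
  rw [← cancel_epi q, ← Category.assoc, ← hi]
  simp [hfq]

variable {A B C : Type (u + 1)} [Category.{u} A] [Category.{u} B] [Category.{u} C]
  [Abelian A] [Abelian B] [Abelian C]

/-- The functor induced on derived categories is computed degreewise. -/
def derivedFac (F : A ⥤ B) [F.Additive] [PreservesFiniteLimits F] [PreservesFiniteColimits F]
    (X : CochainComplex A ℤ) : F.mapDerivedCategory.obj (DerivedCategory.Q.obj X) ≅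
      DerivedCategory.Q.obj ((F.mapHomologicalComplex (ComplexShape.up ℤ)).obj X) :=
  F.mapDerivedCategoryFactors.app X

/-- The functor induced by a composite is computed degreewise. -/
def derivedFacComp (F : A ⥤ B) (F' : B ⥤ C)
    [F.Additive] [PreservesFiniteLimits F] [PreservesFiniteColimits F]
    [F'.Additive] [PreservesFiniteLimits F'] [PreservesFiniteColimits F']
    (X : CochainComplex A ℤ) : (F ⋙ F').mapDerivedCategory.obj (DerivedCategory.Q.obj X) ≅
      DerivedCategory.Q.obj ((F'.mapHomologicalComplex (ComplexShape.up ℤ)).obj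
        ((F.mapHomologicalComplex (ComplexShape.up ℤ)).obj X)) :=
  derivedFac (F ⋙ F') X

theorem derivedFac_naturality (F : A ⥤ B) [F.Additive] [PreservesFiniteLimits F]
    [PreservesFiniteColimits F] {X Y : CochainComplex A ℤ} (f : X ⟶ Y) :
    F.mapDerivedCategory.map (DerivedCategory.Q.map f) ≫ (derivedFac F Y).hom =
      (derivedFac F X).hom ≫
        DerivedCategory.Q.map ((F.mapHomologicalComplex (ComplexShape.up ℤ)).map f) :=
  F.mapDerivedCategoryFactors_hom_naturality f

/-- A natural transformation of exact functors induces a natural transformation of the functors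
induced on derived categories. -/
def derivedMap₂ {F F' : A ⥤ B}
    [F.Additive] [PreservesFiniteLimits F] [PreservesFiniteColimits F]
    [F'.Additive] [PreservesFiniteLimits F'] [PreservesFiniteColimits F'] (γ : F ⟶ F') :
    F.mapDerivedCategory ⟶ F'.mapDerivedCategory :=
  Localization.liftNatTrans DerivedCategory.Q
    (HomologicalComplex.quasiIso A (ComplexShape.up ℤ))
    (F.mapHomologicalComplex (ComplexShape.up ℤ) ⋙ DerivedCategory.Q)
    (F'.mapHomologicalComplex (ComplexShape.up ℤ) ⋙ DerivedCategory.Q)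
    F.mapDerivedCategory F'.mapDerivedCategory
    (Functor.whiskerRight (NatTrans.mapHomologicalComplex γ _) DerivedCategory.Q)

theorem derivedMap₂_app {F F' : A ⥤ B}
    [F.Additive] [PreservesFiniteLimits F] [PreservesFiniteColimits F]
    [F'.Additive] [PreservesFiniteLimits F'] [PreservesFiniteColimits F'] (γ : F ⟶ F')
    (X : CochainComplex A ℤ) : (derivedMap₂ γ).app (DerivedCategory.Q.obj X) =
      (derivedFac F X).hom ≫
        DerivedCategory.Q.map ((NatTrans.mapHomologicalComplex γ _).app X) ≫
          (derivedFac F' X).inv :=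
  Localization.liftNatTrans_app ..

/-- Together with `derivedCategory_hom_ext` this reduces each coherence law on derived categories to
the cancellation of degreewise comparison isomorphisms. -/
theorem derivedCompIso_hom_app (F : A ⥤ B) (F' : B ⥤ C)
    [F.Additive] [PreservesFiniteLimits F] [PreservesFiniteColimits F]
    [F'.Additive] [PreservesFiniteLimits F'] [PreservesFiniteColimits F']
    (X : CochainComplex A ℤ) : (derivedCompIso F F').hom.app (DerivedCategory.Q.obj X) =
      F'.mapDerivedCategory.map (derivedFac F X).hom ≫ (derivedFac F' _).hom ≫
        (derivedFacComp F F' X).inv := by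
  -- This repeats the lifting chosen inside `derivedCompIso`, so that the general formula for lifted
  -- transformations unfolds to the wanted composite.
  let _ : Localization.Lifting DerivedCategory.Q
      (HomologicalComplex.quasiIso A (ComplexShape.up ℤ))
      ((F ⋙ F').mapHomologicalComplex (ComplexShape.up ℤ) ⋙ DerivedCategory.Q)
      (F.mapDerivedCategory ⋙ F'.mapDerivedCategory) :=
    ⟨(Functor.associator _ _ _).symm ≪≫
      Functor.isoWhiskerRight F.mapDerivedCategoryFactors F'.mapDerivedCategory ≪≫
      Functor.associator _ _ _ ≪≫
      Functor.isoWhiskerLeft _ F'.mapDerivedCategoryFactors ≪≫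
      (Functor.associator _ _ _).symm ≪≫
      Functor.isoWhiskerRight
        (Functor.mapHomologicalComplexCompIso (Iso.refl (F ⋙ F')) _) DerivedCategory.Q⟩
  refine (Localization.liftNatTrans_app DerivedCategory.Q
    (HomologicalComplex.quasiIso A (ComplexShape.up ℤ))
    ((F ⋙ F').mapHomologicalComplex (ComplexShape.up ℤ) ⋙ DerivedCategory.Q)
    ((F ⋙ F').mapHomologicalComplex (ComplexShape.up ℤ) ⋙ DerivedCategory.Q)
    (F.mapDerivedCategory ⋙ F'.mapDerivedCategory) (F ⋙ F').mapDerivedCategory (𝟙 _) X).trans ?_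
  have h : (Functor.mapHomologicalComplexCompIso (Iso.refl (F ⋙ F'))
      (ComplexShape.up ℤ)).hom.app X = 𝟙 _ := by ext; rfl
  have h' : DerivedCategory.Q.map ((Functor.mapHomologicalComplexCompIso (Iso.refl (F ⋙ F'))
      (ComplexShape.up ℤ)).hom.app X) = 𝟙 _ := by rw [h]; exact DerivedCategory.Q.map_id _
  change (𝟙 _ ≫ F'.mapDerivedCategory.map (F.mapDerivedCategoryFactors.hom.app X) ≫ 𝟙 _ ≫
    F'.mapDerivedCategoryFactors.hom.app _ ≫ 𝟙 _ ≫ DerivedCategory.Q.map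
      ((Functor.mapHomologicalComplexCompIso (Iso.refl (F ⋙ F')) _).hom.app X)) ≫ 𝟙 _ ≫
        (F ⋙ F').mapDerivedCategoryFactors.inv.app X = _
  rw [h']
  simp only [Category.id_comp, Category.assoc]
  congr 2
  exact Category.id_comp _

theorem derivedCategory_hom_ext {D : Type*} [Category D] {F F' : DerivedCategory A ⥤ D}
    (α β : F ⟶ F')
    (h : ∀ X, α.app (DerivedCategory.Q.obj X) = β.app (DerivedCategory.Q.obj X))
    (V : DerivedCategory A) : α.app V = β.app V :=
  congr_app (Localization.natTrans_ext DerivedCategory.Q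
    (HomologicalComplex.quasiIso A (ComplexShape.up ℤ)) h) V

variable (A) in
/-- The identity functor induces a functor isomorphic to the identity on derived categories. -/
def derivedUnitIso : 𝟭 (DerivedCategory A) ≅ (𝟭 A).mapDerivedCategory :=
  Localization.liftNatIso DerivedCategory.Q
    (HomologicalComplex.quasiIso A (ComplexShape.up ℤ))
    DerivedCategory.Q ((𝟭 A).mapHomologicalComplex (ComplexShape.up ℤ) ⋙ DerivedCategory.Q)
    (𝟭 (DerivedCategory A)) (𝟭 A).mapDerivedCategory
    (Functor.isoWhiskerRight (Functor.mapHomologicalComplexIdIso A _).symm DerivedCategory.Q)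

theorem derivedUnitIso_hom_app (X : CochainComplex A ℤ) :
    (derivedUnitIso A).hom.app (DerivedCategory.Q.obj X) = (derivedFac (𝟭 A) X).inv := by
  refine (Localization.liftNatTrans_app ..).trans ?_
  have h : (Functor.mapHomologicalComplexIdIso A (ComplexShape.up ℤ)).inv.app X = 𝟙 _ := by
    ext; rfl
  have h' : DerivedCategory.Q.map ((Functor.mapHomologicalComplexIdIso A
      (ComplexShape.up ℤ)).inv.app X) = 𝟙 _ := by rw [h]; exact DerivedCategory.Q.map_id _
  change 𝟙 _ ≫ DerivedCategory.Q.map ((Functor.mapHomologicalComplexIdIso A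
      (ComplexShape.up ℤ)).inv.app X) ≫ (𝟭 A).mapDerivedCategoryFactors.inv.app X = _
  rw [h']
  exact (Category.id_comp _).trans (Category.id_comp _)

section

variable {E : Type (u + 1)} [Category.{u} E] [Abelian E]
  (F F' : A ⥤ B) (G G' : B ⥤ C) (H : C ⥤ E)
  [F.Additive] [PreservesFiniteLimits F] [PreservesFiniteColimits F]
  [F'.Additive] [PreservesFiniteLimits F'] [PreservesFiniteColimits F']
  [G.Additive] [PreservesFiniteLimits G] [PreservesFiniteColimits G]
  [G'.Additive] [PreservesFiniteLimits G'] [PreservesFiniteColimits G']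
  [H.Additive] [PreservesFiniteLimits H] [PreservesFiniteColimits H]

variable {F F'} in
theorem derivedMap₂_whiskerRight_app (γ : F ⟶ F') (X : CochainComplex A ℤ) :
    (derivedMap₂ (Functor.whiskerRight γ G)).app (DerivedCategory.Q.obj X) =
      (derivedFacComp F G X).hom ≫ DerivedCategory.Q.map
        ((G.mapHomologicalComplex _).map ((NatTrans.mapHomologicalComplex γ _).app X)) ≫
          (derivedFacComp F' G X).inv :=
  derivedMap₂_app _ _

variable {G G'} in
theorem derivedMap₂_whiskerLeft_app (γ : G ⟶ G') (X : CochainComplex A ℤ) :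
    (derivedMap₂ (Functor.whiskerLeft F γ)).app (DerivedCategory.Q.obj X) =
      (derivedFacComp F G X).hom ≫ DerivedCategory.Q.map
        ((NatTrans.mapHomologicalComplex γ _).app ((F.mapHomologicalComplex _).obj X)) ≫
          (derivedFacComp F G' X).inv :=
  derivedMap₂_app _ _

variable {F F'} in
theorem derivedCompIso_whiskerRight (γ : F ⟶ F') (V : DerivedCategory A) :
    G.mapDerivedCategory.map ((derivedMap₂ γ).app V) ≫ (derivedCompIso F' G).hom.app V =
      (derivedCompIso F G).hom.app V ≫ (derivedMap₂ (Functor.whiskerRight γ G)).app V := by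
  refine derivedCategory_hom_ext
    (Functor.whiskerRight (derivedMap₂ γ) G.mapDerivedCategory ≫ (derivedCompIso F' G).hom)
    ((derivedCompIso F G).hom ≫ derivedMap₂ (Functor.whiskerRight γ G)) (fun X ↦ ?_) V
  rw [NatTrans.comp_app, NatTrans.comp_app, Functor.whiskerRight_app,
    derivedMap₂_whiskerRight_app, derivedMap₂_app, derivedCompIso_hom_app, derivedCompIso_hom_app]
  dsimp only [Functor.comp_obj]
  simp only [Functor.map_comp, Category.assoc, Iso.inv_hom_id_assoc, Iso.map_inv_hom_id_assoc,
      reassoc_of% derivedFac_naturality]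

variable {G G'} in
theorem derivedCompIso_whiskerLeft (γ : G ⟶ G') (V : DerivedCategory A) :
    (derivedMap₂ γ).app (F.mapDerivedCategory.obj V) ≫ (derivedCompIso F G').hom.app V =
      (derivedCompIso F G).hom.app V ≫ (derivedMap₂ (Functor.whiskerLeft F γ)).app V := by
  refine derivedCategory_hom_ext
    (Functor.whiskerLeft F.mapDerivedCategory (derivedMap₂ γ) ≫ (derivedCompIso F G').hom)
    ((derivedCompIso F G).hom ≫ derivedMap₂ (Functor.whiskerLeft F γ)) (fun X ↦ ?_) V
  rw [NatTrans.comp_app, NatTrans.comp_app, Functor.whiskerLeft_app,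
    derivedMap₂_whiskerLeft_app, derivedCompIso_hom_app, derivedCompIso_hom_app]
  dsimp only [Functor.comp_obj]
  simp only [← NatTrans.naturality_assoc, derivedMap₂_app, Category.assoc, Iso.inv_hom_id_assoc]

theorem derivedCompIso_assoc (V : DerivedCategory A) :
    H.mapDerivedCategory.map ((derivedCompIso F G).hom.app V) ≫
      (derivedCompIso (F ⋙ G) H).hom.app V ≫
        (derivedMap₂ (Functor.associator F G H).hom).app V =
      (derivedCompIso G H).hom.app (F.mapDerivedCategory.obj V) ≫
        (derivedCompIso F (G ⋙ H)).hom.app V := by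
  refine derivedCategory_hom_ext
    (F := (F.mapDerivedCategory ⋙ G.mapDerivedCategory) ⋙ H.mapDerivedCategory)
    (F' := (F ⋙ G ⋙ H).mapDerivedCategory)
    (Functor.whiskerRight (derivedCompIso F G).hom H.mapDerivedCategory ≫
        (derivedCompIso (F ⋙ G) H).hom ≫ derivedMap₂ (Functor.associator F G H).hom)
    ((Functor.associator _ _ _).hom ≫
        Functor.whiskerLeft F.mapDerivedCategory (derivedCompIso G H).hom ≫
        (derivedCompIso F (G ⋙ H)).hom) (fun X ↦ ?_) V |>.trans ?_
  -- Both bracketings give the same complex by definition. Giving the two comparison isomorphisms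
  -- one common target lets them cancel syntactically.
  · let eL : ((F ⋙ G) ⋙ H).mapDerivedCategory.obj (DerivedCategory.Q.obj X) ≅
        DerivedCategory.Q.obj ((H.mapHomologicalComplex (ComplexShape.up ℤ)).obj
          ((G.mapHomologicalComplex (ComplexShape.up ℤ)).obj
            ((F.mapHomologicalComplex (ComplexShape.up ℤ)).obj X))) :=
      derivedFac ((F ⋙ G) ⋙ H) X
    let eR : (F ⋙ G ⋙ H).mapDerivedCategory.obj (DerivedCategory.Q.obj X) ≅
        DerivedCategory.Q.obj ((H.mapHomologicalComplex (ComplexShape.up ℤ)).obj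
          ((G.mapHomologicalComplex (ComplexShape.up ℤ)).obj
            ((F.mapHomologicalComplex (ComplexShape.up ℤ)).obj X))) :=
      derivedFac (F ⋙ G ⋙ H) X
    have h₁ : (derivedMap₂ (F.associator G H).hom).app (DerivedCategory.Q.obj X) =
        eL.hom ≫ eR.inv := by
      refine (derivedMap₂_app _ _).trans ?_
      have h : DerivedCategory.Q.map ((NatTrans.mapHomologicalComplex (F.associator G H).hom
          (ComplexShape.up ℤ)).app X) = 𝟙 _ := DerivedCategory.Q.map_id _
      rw [h]
      exact congrArg (eL.hom ≫ ·) (Category.id_comp eR.inv)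
    have h₂ : (derivedCompIso (F ⋙ G) H).hom.app (DerivedCategory.Q.obj X) =
        H.mapDerivedCategory.map (derivedFacComp F G X).hom ≫ (derivedFac H _).hom ≫ eL.inv :=
      derivedCompIso_hom_app _ _ _
    have h₃ : (derivedCompIso F (G ⋙ H)).hom.app (DerivedCategory.Q.obj X) =
        (G ⋙ H).mapDerivedCategory.map (derivedFac F X).hom ≫ (derivedFacComp G H _).hom ≫
          eR.inv :=
      derivedCompIso_hom_app _ _ _
    rw [NatTrans.comp_app, NatTrans.comp_app, NatTrans.comp_app, NatTrans.comp_app,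
      Functor.whiskerLeft_app, Functor.whiskerRight_app, Functor.associator_hom_app,
      derivedCompIso_hom_app, h₁, h₂, h₃]
    dsimp only [Functor.comp_obj]
    rw [Category.id_comp, ← NatTrans.naturality_assoc, derivedCompIso_hom_app]
    simp
  · rw [NatTrans.comp_app, Functor.associator_hom_app]
    exact Category.id_comp _

theorem derivedCompIso_unit (V : DerivedCategory A) :
    (derivedUnitIso B).hom.app (F.mapDerivedCategory.obj V) ≫
      (derivedCompIso F (𝟭 B)).hom.app V ≫ (derivedMap₂ F.rightUnitor.hom).app V = 𝟙 _ := by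
  refine derivedCategory_hom_ext
    (Functor.whiskerLeft F.mapDerivedCategory (derivedUnitIso _).hom ≫
      (derivedCompIso F (𝟭 _)).hom ≫ derivedMap₂ (Functor.rightUnitor F).hom)
    (𝟙 (F.mapDerivedCategory)) (fun X ↦ ?_) V
  let Y := (F.mapHomologicalComplex (ComplexShape.up ℤ)).obj X
  let e : (F ⋙ 𝟭 B).mapDerivedCategory.obj (DerivedCategory.Q.obj X) ≅
      DerivedCategory.Q.obj Y :=
    derivedFac (F ⋙ 𝟭 B) X
  let e' : (𝟭 B).mapDerivedCategory.obj (DerivedCategory.Q.obj Y) ≅ DerivedCategory.Q.obj Y :=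
    derivedFac (𝟭 B) Y
  have h₁ : (derivedMap₂ F.rightUnitor.hom).app (DerivedCategory.Q.obj X) =
      e.hom ≫ (derivedFac F X).inv := by
    refine (derivedMap₂_app _ _).trans ?_
    have h : DerivedCategory.Q.map ((NatTrans.mapHomologicalComplex F.rightUnitor.hom
        (ComplexShape.up ℤ)).app X) = 𝟙 _ := DerivedCategory.Q.map_id _
    rw [h]
    exact congrArg (e.hom ≫ ·) (Category.id_comp (derivedFac F X).inv)
  have h₂ : (derivedCompIso F (𝟭 B)).hom.app (DerivedCategory.Q.obj X) =
      (𝟭 B).mapDerivedCategory.map (derivedFac F X).hom ≫ e'.hom ≫ e.inv :=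
    derivedCompIso_hom_app _ _ _
  have h₃ : (derivedUnitIso B).hom.app (DerivedCategory.Q.obj Y) = e'.inv :=
    derivedUnitIso_hom_app Y
  rw [NatTrans.comp_app, NatTrans.comp_app, Functor.whiskerLeft_app, h₁, h₂]
  dsimp only [Functor.comp_obj, Functor.id_obj]
  rw [Category.assoc, ← NatTrans.naturality_assoc, h₃]
  simp [Y]

end

/-- Derived categories. -/
def derivedRepSystem (k : Type u) [CommRing k] : RepSystem.{u, u + 1, u + 1} k where
  Cat K _ := DerivedCategory (Rep.{u} k K)
  map A := A.fn.mapDerivedCategory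
  map_additive _ := inferInstance
  map₂ γ := derivedMap₂ γ
  comp A B := derivedCompIso A.fn B.fn
  unit K _ := derivedUnitIso (Rep.{u} k K)
  map₂_id A := by
    refine Localization.natTrans_ext DerivedCategory.Q
      (HomologicalComplex.quasiIso _ (ComplexShape.up ℤ)) fun X ↦ ?_
    rw [derivedMap₂_app]
    simp
  map₂_comp γ δ := by
    refine Localization.natTrans_ext DerivedCategory.Q
      (HomologicalComplex.quasiIso _ (ComplexShape.up ℤ)) fun X ↦ ?_
    rw [NatTrans.comp_app, derivedMap₂_app, derivedMap₂_app, derivedMap₂_app]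
    simp
  map₂_add γ δ V := by
    refine derivedCategory_hom_ext (derivedMap₂ (γ + δ)) (derivedMap₂ γ + derivedMap₂ δ)
      (fun X ↦ ?_) V
    have h : (NatTrans.mapHomologicalComplex (γ + δ) (ComplexShape.up ℤ)).app X =
      (NatTrans.mapHomologicalComplex γ (ComplexShape.up ℤ)).app X +
        (NatTrans.mapHomologicalComplex δ (ComplexShape.up ℤ)).app X := by ext; rfl
    rw [NatTrans.app_add, derivedMap₂_app, derivedMap₂_app, derivedMap₂_app, h, Functor.map_add]
    simp
  comp_whiskerRight γ C V := derivedCompIso_whiskerRight C.fn γ V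
  comp_whiskerLeft A _ _ γ V := derivedCompIso_whiskerLeft A.fn γ V
  comp_assoc A B C V := derivedCompIso_assoc A.fn B.fn C.fn V
  comp_unit A V := derivedCompIso_unit A.fn V
  exists_complement f r h := Pretriangulated.exists_complement f r h

theorem derivedRepSystem_toResSystem (k : Type u) [CommRing k] :
    (derivedRepSystem k).toResSystem = derivedSystem k := rfl

end Derived

namespace RepSystem

variable {k : Type u} [CommRing k] (T : RepSystem.{u, a, b} k)
variable {I J K L M : Type u} [Group I] [Group J] [Group K] [Group L] [Group M]

/-! ### Coherence

Every structural morphism between objects built from a fixed object `V` by applying induced functors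
comes from a natural transformation between functors of representations. This reduces the
coherence of such morphisms to computations with representations. -/

/-- A presentation of `Y` as the value at `V` of an induced functor. -/
class Pres {T : RepSystem.{u, a, b} k} (V : T.Cat K) (Y : T.Cat L) where
  /-- the presenting functor -/
  fn : RepFunctor k K L
  /-- the presentation -/
  iso : Y ≅ (T.map fn).obj V

variable {T}

instance (V : T.Cat K) : Pres V V := ⟨.id k K, (T.unit K).app V⟩

instance (V : T.Cat K) (Y : T.Cat L) [Pres V Y] (A : RepFunctor k L M) :
    Pres V ((T.map A).obj Y) :=
  ⟨(Pres.fn V Y).comp A, (T.map A).mapIso (Pres.iso (V := V)) ≪≫ (T.comp (Pres.fn V Y) A).app V⟩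

/-- The morphism between presented objects induced by a natural transformation. -/
def two (V : T.Cat K) {Y Y' : T.Cat L} [Pres V Y] [Pres V Y']
    (γ : (Pres.fn V Y).fn ⟶ (Pres.fn V Y').fn) : Y ⟶ Y' :=
  (Pres.iso (V := V)).hom ≫ (T.map₂ γ).app V ≫ (Pres.iso (V := V)).inv

section two

variable (V : T.Cat K) {Y Y' Y'' : T.Cat L} [Pres V Y] [Pres V Y'] [Pres V Y'']

theorem two_id : 𝟙 Y = two V (𝟙 (Pres.fn V Y).fn) := by
  simp [two, T.map₂_id]

theorem two_comp (γ : (Pres.fn V Y).fn ⟶ (Pres.fn V Y').fn)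
    (δ : (Pres.fn V Y').fn ⟶ (Pres.fn V Y'').fn) : two V γ ≫ two V δ = two V (γ ≫ δ) := by
  simp [two, T.map₂_comp]

theorem two_add (γ δ : (Pres.fn V Y).fn ⟶ (Pres.fn V Y').fn) :
    two V (γ + δ) = two V γ + two V δ := by
  simp [two, T.map₂_add]

theorem two_zero : (0 : Y ⟶ Y') = two V 0 := by
  have := two_add (T := T) V (0 : (Pres.fn V Y).fn ⟶ (Pres.fn V Y').fn) 0
  rw [add_zero, left_eq_add] at this
  exact this.symm

theorem two_sum {ι : Type*} (s : Finset ι) (γ : ι → ((Pres.fn V Y).fn ⟶ (Pres.fn V Y').fn)) :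
    ∑ i ∈ s, two V (γ i) = two V (∑ i ∈ s, γ i) := by
  classical
  induction s using Finset.induction with
  | empty => simp [two_zero V]
  | insert i s hi h => simp [Finset.sum_insert hi, two_add, h]

/-- Together with the lemmas `..._eq_two`, this normalizes any composite of structural morphisms to
a single `two V γ`. An identity in `C(K)` then follows from an identity of natural transformations
on representations. -/
theorem map_two (A : RepFunctor k L M) (γ : (Pres.fn V Y).fn ⟶ (Pres.fn V Y').fn) :
    (T.map A).map (two V γ) =
      two V (Y := (T.map A).obj Y) (Y' := (T.map A).obj Y') (Functor.whiskerRight γ A.fn) := by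
  have h := T.comp_whiskerRight γ A V
  simp only [two, Functor.map_comp, Pres.iso, Iso.trans_hom, Iso.trans_inv, Functor.mapIso_hom,
    Functor.mapIso_inv, Iso.app_hom, Iso.app_inv, Category.assoc]
  rw [← reassoc_of% h]
  simp

theorem map₂_app_eq_two {A B : RepFunctor k L M} (γ : A.fn ⟶ B.fn) :
    (T.map₂ γ).app Y = two V (Functor.whiskerLeft (Pres.fn V Y).fn γ) := by
  have h := T.comp_whiskerLeft (Pres.fn V Y) γ V
  simp only [two, Pres.iso, Iso.trans_hom, Iso.trans_inv, Functor.mapIso_hom,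
    Functor.mapIso_inv, Iso.app_hom, Iso.app_inv, Category.assoc]
  rw [← reassoc_of% h]
  simp

theorem comp_hom_app_eq_two (A : RepFunctor k L M) (B : RepFunctor k M J) :
    (T.comp A B).hom.app Y = two V (Y := (T.map B).obj ((T.map A).obj Y))
      (Functor.associator (Pres.fn V Y).fn A.fn B.fn).hom := by
  have h := T.comp_assoc (Pres.fn V Y) A B V
  simp only [two, Pres.iso, Iso.trans_hom, Iso.trans_inv, Functor.mapIso_hom,
    Functor.mapIso_inv, Iso.app_hom, Iso.app_inv, Category.assoc, Functor.map_comp, Pres.fn]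
  rw [reassoc_of% h]
  have := (T.comp A B).hom.naturality (Pres.iso (V := V) (Y := Y)).hom
  dsimp only [Functor.comp_map, Functor.comp_obj] at this
  rw [reassoc_of% this]
  simp

theorem comp_inv_app_eq_two (A : RepFunctor k L M) (B : RepFunctor k M J) :
    (T.comp A B).inv.app Y = two V (Y' := (T.map B).obj ((T.map A).obj Y))
      (Functor.associator (Pres.fn V Y).fn A.fn B.fn).inv := by
  rw [← cancel_epi ((T.comp A B).hom.app Y), Iso.hom_inv_id_app, comp_hom_app_eq_two V]
  refine (two_id V (Y := (T.map B).obj ((T.map A).obj Y))).trans (Eq.trans ?_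
    (two_comp V (Y := (T.map B).obj ((T.map A).obj Y))
      (Y'' := (T.map B).obj ((T.map A).obj Y)) _ _).symm)
  rw [Iso.hom_inv_id]

/-- The law `comp_unit` exhibits the unit morphism as inverse to the morphism induced by the right
unitor, and the latter is invertible. -/
theorem unit_hom_app_eq_two :
    (T.unit L).hom.app Y = two V (Y := Y) (Y' := (T.map (.id k L)).obj Y)
      (Functor.rightUnitor (Pres.fn V Y).fn).inv := by
  have h := T.comp_unit (Pres.fn V Y) V
  have h' : (T.map₂ (A := (Pres.fn V Y).comp (.id k L)) (B := Pres.fn V Y)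
    (Functor.rightUnitor (Pres.fn V Y).fn).hom).app V ≫ (T.map₂
    (B := (Pres.fn V Y).comp (.id k L)) (A := Pres.fn V Y)
    (Functor.rightUnitor (Pres.fn V Y).fn).inv).app V = 𝟙 _ := by
    rw [← NatTrans.comp_app, ← T.map₂_comp, Iso.hom_inv_id, T.map₂_id]
    rfl
  have := (T.unit L).hom.naturality (Pres.iso (V := V) (Y := Y)).hom
  dsimp only [Functor.id_map, Functor.id_obj] at this
  rw [two, ← cancel_mono (Pres.iso (V := V) (Y := (T.map (.id k L)).obj Y)).hom]
  rw [Category.assoc, Category.assoc, Iso.inv_hom_id, Category.comp_id]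
  simp only [Pres.iso, Iso.trans_hom, Functor.mapIso_hom, Iso.app_hom]
  rw [← reassoc_of% this]
  congr 1
  have h'' := h =≫ (T.map₂ (A := Pres.fn V Y) (B := (Pres.fn V Y).comp (.id k L))
    (Functor.rightUnitor (Pres.fn V Y).fn).inv).app V
  dsimp only [Functor.id_obj] at h''
  simp only [Category.assoc, h', Category.id_comp, Category.comp_id] at h''
  exact h''

theorem unit_inv_app_eq_two :
    (T.unit L).inv.app Y = two V (Y := (T.map (.id k L)).obj Y) (Y' := Y)
      (Functor.rightUnitor (Pres.fn V Y).fn).hom := by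
  rw [← cancel_epi ((T.unit L).hom.app Y), Iso.hom_inv_id_app, unit_hom_app_eq_two V]
  refine (two_id V (Y := Y)).trans (Eq.trans ?_ (two_comp V (Y := Y) (Y'' := Y) _ _).symm)
  rw [Iso.inv_hom_id]

end two
end RepSystem

/-! ### Natural transformations between restriction and coinduction -/

namespace PlainRep

variable {k : Type u} [CommRing k] {J G : Type u} [Group J] [Group G]

/-- Evaluation at `g` of functions in a coinduced representation. -/
def coindEval (H : Subgroup G) (κ : J →* G) (β : J →* H) (g : G)
    (h : ∀ x, (β x : G) = g * κ x * g⁻¹) :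
    Rep.coindFunctor.{u} k H.subtype ⋙ Rep.resFunctor.{u} (k := k) κ ⟶
      Rep.resFunctor.{u} (k := k) β where
  app W := Rep.ofHom ⟨LinearMap.proj g ∘ₗ (Representation.coindV H.subtype W.ρ).subtype, fun x ↦ by
    ext φ
    have := φ.2 (β x) g
    simp only [Subgroup.subtype_apply, h, inv_mul_cancel_right] at this
    exact this⟩
  naturality _ _ _ := by ext; rfl

/-- The subgroup `{x | g κ(x) g⁻¹ ∈ H}`. -/
def mackeySubgroup (H : Subgroup G) (κ : J →* G) (g : G) : Subgroup J :=
  (H.comap (MulAut.conj g).toMonoidHom).comap κ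

/-- The homomorphism `x ↦ g κ(x) g⁻¹`. -/
def mackeyHom (H : Subgroup G) (κ : J →* G) (g : G) : mackeySubgroup H κ g →* H :=
  (((MulAut.conj g).toMonoidHom.comp κ).comp (mackeySubgroup H κ g).subtype).codRestrict H
    fun x ↦ x.2

theorem coe_mackeyHom (H : Subgroup G) (κ : J →* G) (g : G) (x : mackeySubgroup H κ g) :
    (mackeyHom H κ g x : G) = g * κ x * g⁻¹ := rfl

theorem mackeyHom_injective (H : Subgroup G) (κ : J →* G) (hκ : Function.Injective κ) (g : G) :
    Function.Injective (mackeyHom H κ g) := fun x y h ↦ by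
  have := congrArg Subtype.val h
  rw [coe_mackeyHom, coe_mackeyHom] at this
  exact Subtype.ext (hκ (by simpa using this))

open Classical in
/-- The function `G → W` supported on `H g κ(J)` with value `h ψ(x)` at `h g κ(x)`. -/
def spreadFun (H : Subgroup G) (κ : J →* G) (g : G) (W : Rep.{u} k H) (ψ : J → W) (y : G) : W :=
  if hy : ∃ (h : H) (x : J), y = h * g * κ x then W.ρ hy.choose (ψ hy.choose_spec.choose) else 0

section

variable {H : Subgroup G} {κ : J →* G} {g : G} {W : Rep.{u} k H}

theorem spreadFun_of_not {ψ : J → W} {y : G} (hy : ¬ ∃ (h : H) (x : J), y = h * g * κ x) :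
    spreadFun H κ g W ψ y = 0 := dif_neg hy

/-- This is independence of the chosen presentation: if `h g κ(x) = h' g κ(x')`, then `x' x⁻¹` lies
in the Mackey subgroup with image `h'⁻¹ h` in `H`, and the equivariance of `ψ` compensates for the
change. -/
theorem spreadFun_apply (ψ : Representation.coindV (mackeySubgroup H κ g).subtype
      (W.ρ.comp (mackeyHom H κ g))) (h : H) (x : J) :
    spreadFun H κ g W ψ.1 (h * g * κ x) = W.ρ h (ψ.1 x) := by
  have hy : ∃ (h' : H) (x' : J), h * g * κ x = h' * g * κ x' := ⟨h, x, rfl⟩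
  rw [spreadFun, dif_pos hy]
  set h' := hy.choose
  set x' := hy.choose_spec.choose
  have e : h * g * κ x = h' * g * κ x' := hy.choose_spec.choose_spec
  have e' : g * κ (x' * x⁻¹) * g⁻¹ = ((h'⁻¹ * h : H) : G) := by
    simp only [map_mul, map_inv, Subgroup.coe_mul, Subgroup.coe_inv]
    rw [eq_inv_mul_iff_mul_eq, ← mul_assoc, ← mul_assoc, ← mul_assoc, ← e]
    group
  let z : mackeySubgroup H κ g := ⟨x' * x⁻¹, by
    change g * κ (x' * x⁻¹) * g⁻¹ ∈ H
    rw [e']; exact (h'⁻¹ * h).2⟩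
  have hz : mackeyHom H κ g z = h'⁻¹ * h := Subtype.ext e'
  have := ψ.2 z x
  simp only [Subgroup.subtype_apply, z, inv_mul_cancel_right] at this
  rw [this]
  simp only [MonoidHom.comp_apply]
  rw [hz, ← Module.End.mul_apply, ← map_mul, mul_inv_cancel_left]

attribute [irreducible] spreadFun

theorem spreadFun_mul (ψ : Representation.coindV (mackeySubgroup H κ g).subtype
      (W.ρ.comp (mackeyHom H κ g))) (h : H) (y : G) :
    spreadFun H κ g W ψ.1 (h * y) = W.ρ h (spreadFun H κ g W ψ.1 y) := by
  by_cases hy : ∃ (h : H) (x : J), y = h * g * κ x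
  · obtain ⟨h', x, rfl⟩ := hy
    rw [spreadFun_apply, ← mul_assoc, ← mul_assoc, ← Subgroup.coe_mul, spreadFun_apply, map_mul,
      Module.End.mul_apply]
  · rw [spreadFun_of_not hy, map_zero, spreadFun_of_not]
    rintro ⟨h', x, e⟩
    refine hy ⟨h⁻¹ * h', x, ?_⟩
    rw [Subgroup.coe_mul, Subgroup.coe_inv, mul_assoc, mul_assoc, ← mul_assoc (h' : G), ← e,
      inv_mul_cancel_left]

variable (H κ g W) in
/-- Extension by zero of functions on `H g κ(J)` to `G`. -/
def spreadLinear : Representation.coindV (mackeySubgroup H κ g).subtype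
      (W.ρ.comp (mackeyHom H κ g)) →ₗ[k] Representation.coindV H.subtype W.ρ where
  toFun ψ := ⟨spreadFun H κ g W ψ.1, spreadFun_mul ψ⟩
  map_add' ψ ψ' := by
    refine Subtype.ext (funext fun y ↦ ?_)
    by_cases hy : ∃ (h : H) (x : J), y = h * g * κ x
    · obtain ⟨h', x, rfl⟩ := hy
      exact (spreadFun_apply (ψ + ψ') h' x).trans ((map_add (W.ρ h') _ _).trans
        (congrArg₂ (· + ·) (spreadFun_apply ψ h' x).symm (spreadFun_apply ψ' h' x).symm))
    · exact (spreadFun_of_not hy).trans ((add_zero _).symm.trans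
        (congrArg₂ (· + ·) (spreadFun_of_not hy).symm (spreadFun_of_not hy).symm))
  map_smul' c ψ := by
    refine Subtype.ext (funext fun y ↦ ?_)
    by_cases hy : ∃ (h : H) (x : J), y = h * g * κ x
    · obtain ⟨h', x, rfl⟩ := hy
      exact (spreadFun_apply (c • ψ) h' x).trans ((map_smul (W.ρ h') _ _).trans
        (congrArg (c • ·) (spreadFun_apply ψ h' x).symm))
    · exact (spreadFun_of_not hy).trans ((smul_zero c).symm.trans
        (congrArg (c • ·) (spreadFun_of_not hy).symm))

/-- This gives equivariance under `J`: right translation by `κ(z)` preserves the support `H g κ(J)`.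
-/
theorem spreadFun_mul_right (ψ : Representation.coindV (mackeySubgroup H κ g).subtype
      (W.ρ.comp (mackeyHom H κ g))) (z : J) (y : G) :
    spreadFun H κ g W (fun x ↦ ψ.1 (x * z)) y = spreadFun H κ g W ψ.1 (y * κ z) := by
  by_cases hy : ∃ (h : H) (x : J), y = h * g * κ x
  · obtain ⟨h', x, rfl⟩ := hy
    have := spreadFun_apply ψ h' (x * z)
    rw [map_mul, ← mul_assoc] at this
    rw [this]
    exact spreadFun_apply (Representation.coind _ _ z ψ) h' x
  · rw [spreadFun_of_not hy, spreadFun_of_not]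
    rintro ⟨h', x, e⟩
    exact hy ⟨h', x * z⁻¹, by rw [map_mul, map_inv, ← mul_assoc, ← e, mul_inv_cancel_right]⟩

theorem spreadFun_map {W' : Rep.{u} k H} (f : W ⟶ W')
    (ψ : Representation.coindV (mackeySubgroup H κ g).subtype
      (W.ρ.comp (mackeyHom H κ g))) (y : G) :
    spreadFun H κ g W' (fun x ↦ f.hom (ψ.1 x)) y = f.hom (spreadFun H κ g W ψ.1 y) := by
  by_cases hy : ∃ (h : H) (x : J), y = h * g * κ x
  · obtain ⟨h', x, rfl⟩ := hy
    rw [spreadFun_apply ψ, Rep.hom_comm_apply]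
    exact spreadFun_apply ⟨fun x ↦ f.hom (ψ.1 x), fun z x ↦
      (congrArg f.hom (ψ.2 z x)).trans (Rep.hom_comm_apply f (mackeyHom H κ g z) _)⟩ h' x
  · rw [spreadFun_of_not hy, spreadFun_of_not hy, map_zero]

variable (H κ g W) in
/-- Extension by zero as an intertwining map. -/
def spreadIntertwining : (Representation.coind (mackeySubgroup H κ g).subtype
      (W.ρ.comp (mackeyHom H κ g))).IntertwiningMap
      ((Representation.coind H.subtype W.ρ).comp κ) where
  toLinearMap := spreadLinear H κ g W
  isIntertwining' z := LinearMap.ext fun ψ ↦ Subtype.ext (funext (spreadFun_mul_right ψ z))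

end

variable (k) in
/-- Extension by zero of functions on `H g κ(J)` to `G`. -/
def spread (H : Subgroup G) (κ : J →* G) (g : G) :
    Rep.resFunctor.{u} (k := k) (mackeyHom H κ g) ⋙
      Rep.coindFunctor.{u} k (mackeySubgroup H κ g).subtype ⟶
    Rep.coindFunctor.{u} k H.subtype ⋙ Rep.resFunctor.{u} (k := k) κ where
  app W := Rep.ofHom (spreadIntertwining H κ g W)
  naturality W W' f := by
    refine Rep.hom_ext (Representation.IntertwiningMap.ext (LinearMap.ext fun ψ ↦ ?_))
    exact Subtype.ext (funext (spreadFun_map f ψ))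

end PlainRep

namespace PlainRep

variable {k : Type u} [CommRing k] {G : Type u} [Group G]

/-! ### Averaging over cosets. -/

section Average

variable (H : Subgroup G) (V : Rep.{u} k G)

/-- The function `x ↦ x φ(x⁻¹)` on `G/H`. -/
def translate (φ : Representation.coindV H.subtype (V.ρ.comp H.subtype)) (q : G ⧸ H) : V :=
  Quotient.liftOn' q (fun x ↦ V.ρ x (φ.1 x⁻¹)) fun x y h ↦ by
    have h' : x⁻¹ * y ∈ H := QuotientGroup.leftRel_apply.1 h
    have := φ.2 ⟨x⁻¹ * y, h'⟩ y⁻¹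
    simp only [Subgroup.subtype_apply, mul_inv_cancel_right, MonoidHom.comp_apply] at this
    rw [this, ← Module.End.mul_apply, ← map_mul, mul_inv_cancel_left]

/-- The sum `∑ x φ(x⁻¹)` over `G/H`. -/
def sumTranslates [Fintype (G ⧸ H)] :
    Representation.coindV H.subtype (V.ρ.comp H.subtype) →ₗ[k] V where
  toFun φ := ∑ q : G ⧸ H, translate H V φ q
  map_add' φ φ' := by
    rw [← Finset.sum_add_distrib]
    refine Finset.sum_congr rfl fun q _ ↦ ?_
    induction q using QuotientGroup.induction_on with | H x => exact map_add (V.ρ x) _ _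
  map_smul' c φ := by
    rw [RingHom.id_apply, Finset.smul_sum]
    refine Finset.sum_congr rfl fun q _ ↦ ?_
    induction q using QuotientGroup.induction_on with | H x => exact map_smul (V.ρ x) _ _

/-- The sum over `G/H` as an intertwining map. -/
def sumTranslatesIntertwining [Fintype (G ⧸ H)] :
    (Representation.coind H.subtype (V.ρ.comp H.subtype)).IntertwiningMap V.ρ where
  toLinearMap := sumTranslates H V
  isIntertwining' g := LinearMap.ext fun φ ↦ by
    change ∑ q, translate H V (Representation.coind H.subtype (V.ρ.comp H.subtype) g φ) q =
      V.ρ g (∑ q, translate H V φ q)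
    rw [map_sum, ← Equiv.sum_comp (MulAction.toPerm g)]
    refine Finset.sum_congr rfl fun q _ ↦ ?_
    induction q using QuotientGroup.induction_on with | H x => ?_
    change V.ρ (g * x) (φ.1 ((g * x)⁻¹ * g)) = V.ρ g (V.ρ x (φ.1 x⁻¹))
    rw [map_mul, Module.End.mul_apply, mul_inv_rev, inv_mul_cancel_right]

end Average

/-- If `c` is the inverse of the index of `H` in `k`, this is the natural retraction
`φ ↦ c ∑ x φ(x⁻¹)` of the unit of the adjunction between restriction and coinduction. -/
def average (H : Subgroup G) [Finite G] (c : k) :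
    Rep.resFunctor.{u} (k := k) H.subtype ⋙ Rep.coindFunctor.{u} k H.subtype ⟶ 𝟭 _ :=
  letI := Fintype.ofFinite (G ⧸ H)
  { app V := Rep.ofHom (c • sumTranslatesIntertwining H V)
    naturality V V' f := by
      refine Rep.hom_ext (Representation.IntertwiningMap.ext (LinearMap.ext fun φ ↦ ?_))
      change c • ∑ q, translate H V' _ q = f.hom (c • ∑ q, translate H V φ q)
      rw [map_smul, map_sum]
      congr 1
      refine Finset.sum_congr rfl fun q _ ↦ ?_
      induction q using QuotientGroup.induction_on with | H x => ?_
      exact (Rep.hom_comm_apply f x _).symm }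

/-- Every coset contributes `x (x⁻¹ v) = v`, so the sum is the index times `v`. -/
theorem unit_average (H : Subgroup G) [Finite G] (c : k) (hc : c * H.index = 1) :
    (Rep.resCoindAdjunction.{u} k H.subtype).unit ≫ average H c = 𝟙 _ := by
  let _ := Fintype.ofFinite (G ⧸ H)
  ext V v
  change c • ∑ q, translate H V (((Rep.resCoindAdjunction.{u} k H.subtype).unit.app V).hom v) q = v
  have : ∀ q, translate H V (((Rep.resCoindAdjunction.{u} k H.subtype).unit.app V).hom v) q =
      v := by
    intro q
    induction q using QuotientGroup.induction_on with | H x => ?_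
    change V.ρ x (V.ρ x⁻¹ v) = v
    simp
  rw [Finset.sum_congr rfl fun q _ ↦ this q, Finset.sum_const, Finset.card_univ,
    ← Nat.card_eq_fintype_card, ← Subgroup.index, ← Nat.cast_smul_eq_nsmul k, smul_smul, hc,
    one_smul]

/-! ### Countable direct sums and their shift. -/

section Swindle

variable (k G) in
/-- The functor `V ↦ V^(ℕ)`. -/
def copower : Rep.{u} k G ⥤ Rep.{u} k G where
  obj V := Rep.of (V.ρ.finsupp ℕ)
  map {V W} f := Rep.ofHom ⟨Finsupp.mapRange.linearMap f.hom.toLinearMap, fun g ↦ by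
    ext n v : 2
    simp [Rep.hom_comm_apply]⟩
  map_id V := by ext n v : 4; simp
  map_comp f g := by ext n v : 4; simp

theorem copower_map_single {V W : Rep.{u} k G} (f : V ⟶ W) (n : ℕ) (v : V) :
    ((copower k G).map f).hom (Finsupp.single n v : ℕ →₀ V) =
      (Finsupp.single n (f.hom v) : ℕ →₀ W) :=
  Finsupp.mapRange_single (hf := map_zero f.hom)

/-- The morphism out of `V^(ℕ)` given by a sequence of morphisms. -/
def copowerDesc {V W : Rep.{u} k G} (f : ℕ → (V ⟶ W)) : (copower k G).obj V ⟶ W :=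
  Rep.ofHom ⟨Finsupp.lsum k fun n ↦ (f n).hom.toLinearMap, fun g ↦ by
    ext n v : 2
    simp [Rep.hom_comm_apply]⟩

/-- The inclusion of the `n`-th summand. -/
def copowerInc (n : ℕ) (V : Rep.{u} k G) : V ⟶ (copower k G).obj V :=
  Rep.ofHom ⟨Finsupp.lsingle n, fun g ↦ by
    ext v : 1
    simp⟩

theorem copower_hom_ext {V W : Rep.{u} k G} {f g : (copower k G).obj V ⟶ W}
    (h : ∀ n, copowerInc n V ≫ f = copowerInc n V ≫ g) : f = g := by
  refine Rep.hom_ext (Representation.IntertwiningMap.ext (Finsupp.lhom_ext fun n v ↦ ?_))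
  exact congrArg (fun e ↦ e.hom v) (h n)

theorem copowerInc_desc {V W : Rep.{u} k G} (f : ℕ → (V ⟶ W)) (n : ℕ) :
    copowerInc n V ≫ copowerDesc f = f n := by
  ext v
  exact Finsupp.lsum_single k (fun n ↦ (f n).hom.toLinearMap) n v

theorem copowerInc_desc_assoc {V W Z : Rep.{u} k G} (f : ℕ → (V ⟶ W)) (n : ℕ) (g : W ⟶ Z) :
    copowerInc n V ≫ copowerDesc f ≫ g = f n ≫ g := by
  rw [← Category.assoc, copowerInc_desc]

theorem copowerInc_map {V W : Rep.{u} k G} (f : V ⟶ W) (n : ℕ) :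
    copowerInc n V ≫ (copower k G).map f = f ≫ copowerInc n W := by
  ext v
  exact copower_map_single f n v

theorem copowerInc_map_assoc {V W Z : Rep.{u} k G} (f : V ⟶ W) (n : ℕ)
    (g : (copower k G).obj W ⟶ Z) :
    copowerInc n V ≫ (copower k G).map f ≫ g = f ≫ copowerInc n W ≫ g := by
  rw [← Category.assoc, copowerInc_map, Category.assoc]

instance : (copower k G).Additive where
  map_add {V W f g} := copower_hom_ext fun n ↦ by
    simp only [Preadditive.comp_add, copowerInc_map, Preadditive.add_comp]

instance : (copower k G).PreservesProjectiveObjects where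
  projective_obj {P} hP := ⟨fun {E X} f e he ↦
    ⟨copowerDesc fun n ↦ Projective.factorThru (copowerInc n P ≫ f) e,
      copower_hom_ext fun n ↦ by
        rw [copowerInc_desc_assoc, Projective.factorThru_comp]⟩⟩

theorem copower_map_exact (S : ShortComplex (Rep.{u} k G)) (hS : S.Exact) :
    (S.map (copower k G)).Exact := by
  rw [← ShortComplex.exact_map_iff_of_faithful _ (forget₂ (Rep.{u} k G) (ModuleCat k)),
    ShortComplex.ShortExact.moduleCat_exact_iff_function_exact] at hS ⊢
  classical
  intro (y : ℕ →₀ S.X₂)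
  have hS' : ∀ v : S.X₂, S.g.hom v = 0 ↔ ∃ w : S.X₁, S.f.hom w = v := hS
  constructor
  · intro hy
    have hy' : ∀ n, S.g.hom (y n) = 0 := fun n ↦ DFunLike.congr_fun (F := ℕ →₀ S.X₃) hy n
    choose! s hs using fun v ↦ (hS' v).1
    -- The chosen preimage of `0` need not be `0`; it is reset to `0` so that lifting coordinate by
    -- coordinate preserves finite support.
    let s' : S.X₂ → S.X₁ := fun v ↦ if v = 0 then 0 else s v
    refine ⟨(Finsupp.mapRange s' (if_pos rfl) y : ℕ →₀ S.X₁), ?_⟩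
    refine Finsupp.ext (α := ℕ) (M := S.X₂) fun n ↦ ?_
    change S.f.hom (s' (y n)) = y n
    by_cases h : y n = 0
    · simp [s', h]
    · simp only [s', if_neg h]
      exact hs _ (hy' n)
  · rintro ⟨(x : ℕ →₀ S.X₁), rfl⟩
    refine Finsupp.ext (α := ℕ) (M := S.X₃) fun n ↦ ?_
    exact (hS' _).2 ⟨x n, rfl⟩

theorem copower_exact :
    PreservesFiniteLimits (copower k G) ∧ PreservesFiniteColimits (copower k G) :=
  ((copower k G).exact_tfae.out 1 3).1 copower_map_exact

variable (k G) in
/-- The inclusion of the first summand. -/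
def copowerZero : 𝟭 _ ⟶ copower k G where
  app V := copowerInc 0 V
  naturality _ _ f := (copowerInc_map f 0).symm

variable (k G) in
/-- The shift of the summands. -/
def copowerShift : copower k G ⟶ copower k G where
  app V := copowerDesc fun n ↦ copowerInc (n + 1) V
  naturality V W f := copower_hom_ext fun n ↦ by
    rw [copowerInc_map_assoc, copowerInc_desc, copowerInc_desc_assoc, copowerInc_map]

variable (k G) in
/-- The sum map. -/
def copowerSum : copower k G ⟶ 𝟭 _ where
  app V := copowerDesc fun _ ↦ 𝟙 V
  naturality V W f := copower_hom_ext fun n ↦ by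
    dsimp only [Functor.id_obj, Functor.id_map]
    rw [copowerInc_map_assoc, copowerInc_desc, copowerInc_desc_assoc, Category.comp_id,
      Category.id_comp]

variable (k G) in
/-- Division by `1 - t`, where `t` is the shift. -/
def copowerDiv : copower k G ⟶ copower k G where
  app V := copowerDesc fun n ↦ -∑ i ∈ Finset.range n, copowerInc i V
  naturality V W f := copower_hom_ext fun n ↦ by
    rw [copowerInc_map_assoc, copowerInc_desc, copowerInc_desc_assoc]
    simp only [Preadditive.comp_neg, Preadditive.neg_comp, Preadditive.comp_sum,
      Preadditive.sum_comp, copowerInc_map]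

/-- On the `n`-th summand only the last term of `∑_{i ≤ n} - ∑_{i < n}` survives. Thus `1 - t` is a
split monomorphism. -/
theorem one_sub_copowerShift_comp_copowerDiv :
    (𝟙 _ - copowerShift k G) ≫ copowerDiv k G = 𝟙 (copower k G) := by
  ext V : 2
  refine copower_hom_ext fun n ↦ ?_
  simp only [NatTrans.comp_app, NatTrans.app_sub, NatTrans.id_app, Preadditive.sub_comp,
    Preadditive.comp_sub, Category.id_comp, Category.comp_id, copowerShift, copowerDiv,
    copowerInc_desc_assoc, copowerInc_desc, Finset.sum_range_succ]
  abel

/-- On the `n`-th summand the sum telescopes to the difference of the `n`-th and the zeroth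
inclusion. So `V` is the complement of `1 - t` in `V^(ℕ)`, embedded as the zeroth summand, with
projection the sum map. -/
theorem copowerDiv_comp_one_sub_copowerShift :
    copowerDiv k G ≫ (𝟙 _ - copowerShift k G) = 𝟙 _ - copowerSum k G ≫ copowerZero k G := by
  ext V : 2
  refine copower_hom_ext fun n ↦ ?_
  simp only [NatTrans.comp_app, NatTrans.app_sub, NatTrans.id_app,
    Preadditive.comp_sub, Category.comp_id, copowerShift, copowerDiv, copowerSum, copowerZero,
    Functor.id_obj, copowerInc_desc_assoc, copowerInc_desc, Preadditive.neg_comp,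
    Preadditive.sum_comp, Category.id_comp]
  have := (Finset.sum_range_succ (fun i ↦ copowerInc i V) n).symm.trans
    (Finset.sum_range_succ' (fun i ↦ copowerInc i V) n)
  rw [sub_neg_eq_add, neg_add_eq_sub, sub_eq_sub_iff_add_eq_add, ← this, add_comm]

theorem copowerZero_comp_copowerSum : copowerZero k G ≫ copowerSum k G = 𝟙 _ := by
  ext V : 2
  exact copowerInc_desc _ _

end Swindle
end PlainRep

/-- The functor `V ↦ V^(ℕ)`. -/
abbrev RepFunctor.copower (k : Type u) [CommRing k] (G : Type u) [Group G] : RepFunctor k G G :=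
  { fn := PlainRep.copower k G
    preservesFiniteLimits := PlainRep.copower_exact.1
    preservesFiniteColimits := PlainRep.copower_exact.2 }

/-! ### Splitting of idempotents. -/

namespace RepSystem

variable {k : Type u} [CommRing k] (T : RepSystem.{u, a, b} k) {G : Type u} [Group G]

/-- Idempotents split, by an Eilenberg swindle. -/
theorem exists_splitting {X : T.Cat G} (e : X ⟶ X) (he : e ≫ e = e) :
    ∃ (Z : T.Cat G) (i : Z ⟶ X) (q : X ⟶ Z), i ≫ q = 𝟙 Z ∧ q ≫ i = e := by
  let N := RepFunctor.copower k G
  let s : (T.map N).obj X ⟶ (T.map N).obj X :=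
    (T.map₂ (A := N) (B := N) (PlainRep.copowerShift k G)).app X
  let d : (T.map N).obj X ⟶ (T.map N).obj X :=
    (T.map₂ (A := N) (B := N) (PlainRep.copowerDiv k G)).app X
  let z₀ : (T.map (.id k G)).obj X ⟶ (T.map N).obj X :=
    (T.map₂ (A := .id k G) (B := N) (PlainRep.copowerZero k G)).app X
  let p₀ : (T.map N).obj X ⟶ (T.map (.id k G)).obj X :=
    (T.map₂ (A := N) (B := .id k G) (PlainRep.copowerSum k G)).app X
  let z : X ⟶ (T.map N).obj X := (T.unit G).hom.app X ≫ z₀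
  let p : (T.map N).obj X ⟶ X := p₀ ≫ (T.unit G).inv.app X
  let E : (T.map N).obj X ⟶ (T.map N).obj X := (T.map N).map e
  have hE : E ≫ E = E := by rw [← Functor.map_comp, he]
  have hEs : E ≫ s = s ≫ E := NatTrans.naturality _ _
  have hEd : E ≫ d = d ≫ E := NatTrans.naturality _ _
  have hez : e ≫ z = z ≫ E := by
    have h₁ : e ≫ (T.unit G).hom.app X = (T.unit G).hom.app X ≫ (T.map (.id k G)).map e :=
      (T.unit G).hom.naturality e
    have h₂ : (T.map (.id k G)).map e ≫ z₀ = z₀ ≫ E := NatTrans.naturality _ _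
    simp only [z, reassoc_of% h₁, h₂, Category.assoc]
  have hEp : E ≫ p = p ≫ e := by
    have h₁ : (T.map (.id k G)).map e ≫ (T.unit G).inv.app X = (T.unit G).inv.app X ≫ e :=
      (T.unit G).inv.naturality e
    have h₂ : E ≫ p₀ = p₀ ≫ (T.map (.id k G)).map e := NatTrans.naturality _ _
    simp only [p, reassoc_of% h₂, h₁, Category.assoc]
  have hsd : s ≫ d = d - 𝟙 _ := by
    rw [two_id X]
    simp only [s, d, map₂_app_eq_two X, two_comp]
    rw [eq_sub_iff_add_eq, ← two_add]
    congr 1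
    have := PlainRep.one_sub_copowerShift_comp_copowerDiv (k := k) (G := G)
    rw [Preadditive.sub_comp, Category.id_comp, sub_eq_iff_eq_add] at this
    ext V : 2
    exact (add_comm _ _).trans (congr_app this V).symm
  have hds : d ≫ s = d - 𝟙 _ + p ≫ z := by
    have hpz : p ≫ z = p₀ ≫ z₀ := by
      have : (T.unit G).inv.app X ≫ (T.unit G).hom.app X = 𝟙 _ := Iso.inv_hom_id_app _ _
      simp only [p, z, Category.assoc]
      rw [reassoc_of% this]
    rw [hpz, two_id X]
    simp only [s, d, p₀, z₀, map₂_app_eq_two X, two_comp]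
    rw [sub_add_eq_add_sub, eq_sub_iff_add_eq, ← two_add, ← two_add]
    congr 1
    have := PlainRep.copowerDiv_comp_one_sub_copowerShift (k := k) (G := G)
    rw [Preadditive.comp_sub, Category.comp_id, sub_eq_sub_iff_add_eq_add] at this
    ext V : 2
    exact (add_comm _ _).trans (congr_app this V).symm
  have hzp : z ≫ p = 𝟙 _ := by
    have h₁ : z₀ ≫ p₀ = 𝟙 _ := by
      have := (T.map₂_comp (A := .id k G) (B := N) (C := .id k G) (PlainRep.copowerZero k G)
        (PlainRep.copowerSum k G)).symm
      rw [PlainRep.copowerZero_comp_copowerSum] at this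
      exact congr_app (this.trans (T.map₂_id (.id k G))) X
    simp only [z, p, Category.assoc, reassoc_of% h₁]
    exact Iso.hom_inv_id_app _ _
  -- The morphism `𝟙 - E ≫ s` acts as `1 - s` on the part cut out by `E`, where `d` is a retraction,
  -- and as the identity on the part cut out by `𝟙 - E`. Its cokernel is the telescope of `e`.
  obtain ⟨Z, i, q, h₁, h₂⟩ := T.exists_complement (𝟙 _ - E ≫ s) (𝟙 _ - E + E ≫ d) (by
    simp only [Preadditive.comp_add, Preadditive.comp_sub, Preadditive.sub_comp, Category.comp_id,
      Category.id_comp, Category.assoc]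
    rw [← hEs, reassoc_of% hE, ← reassoc_of% hEs, reassoc_of% hE, hsd,
      Preadditive.comp_sub, Category.comp_id]
    abel)
  -- The complementary idempotent is `e` transported to the zeroth summand by `z` and `p`; hence `Z`
  -- also splits `e`.
  have h₃ : q ≫ i = p ≫ e ≫ z := by
    rw [h₂]
    simp only [Preadditive.add_comp, Preadditive.comp_sub, Preadditive.sub_comp, Category.comp_id,
      Category.id_comp, Category.assoc]
    rw [reassoc_of% hE, ← reassoc_of% hEd, reassoc_of% hE, hds, ← reassoc_of% hEp]
    simp only [Preadditive.comp_add, Preadditive.comp_sub, Category.comp_id]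
    abel
  refine ⟨Z, i ≫ p ≫ e, e ≫ z ≫ q, ?_, ?_⟩
  · simp only [Category.assoc, reassoc_of% he]
    rw [← reassoc_of% h₃, reassoc_of% h₁, h₁]
  · simp only [Category.assoc, reassoc_of% h₃, reassoc_of% hzp, he]

end RepSystem

/-- Injective homomorphisms. -/
abbrev Emb (K L : Type u) [Group K] [Group L] := {φ : K →* L // Function.Injective φ}

namespace Subgroup

/-- The inclusion of a subgroup. -/
abbrev emb {G : Type u} [Group G] (H : Subgroup G) : Emb H G := ⟨H.subtype, H.subtype_injective⟩

end Subgroup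

namespace PlainRep

variable {k : Type u} [CommRing k] {K : Type u} [Group K]

/-- Restriction along the identity. -/
def resIdIso (φ : K →* K) (h : ∀ x, φ x = x) : Rep.resFunctor.{u} (k := k) φ ≅ 𝟭 _ :=
  NatIso.ofComponents
    (fun W ↦
      { hom := Rep.ofHom ⟨LinearMap.id, fun x ↦ by ext; simp [h]⟩
        inv := Rep.ofHom ⟨LinearMap.id, fun x ↦ by ext; simp [h]⟩
        hom_inv_id := by ext x; rfl
        inv_hom_id := by ext x; rfl })
    (fun {V W} f ↦ by ext x; rfl)

end PlainRep

namespace RepSystem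

variable {k : Type u} [CommRing k] (T : RepSystem.{u, a, b} k)
variable {I J K L G : Type u} [Group I] [Group J] [Group K] [Group L] [Group G]

/-! ### Structural natural transformations -/

/-- Restriction along an injective homomorphism. -/
abbrev res (φ : Emb K L) : T.Cat L ⥤ T.Cat K := T.map (.res k φ.1 φ.2)

/-- Coinduction from a subgroup. -/
abbrev coind [Finite G] (H : Subgroup G) : T.Cat H ⥤ T.Cat G := T.map (.coind k H)

/-- The identification of a composite of restrictions with a restriction. -/
def resComp (ψ : Emb J K) (φ : Emb K L) (χ : Emb J L) (h : ∀ x, χ.1 x = φ.1 (ψ.1 x)) :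
    T.res φ ⋙ T.res ψ ≅ T.res χ :=
  T.comp _ _ ≪≫ T.mapIso (A := (RepFunctor.res k φ.1 φ.2).comp (.res k ψ.1 ψ.2))
    (B := .res k χ.1 χ.2) (PlainRep.resCompIso ψ.1 φ.1 χ.1 h)

/-- The action of `l` as an isomorphism between restrictions along conjugate homomorphisms. -/
def twist (φ ψ : Emb K L) (l : L) (h : ∀ x, ψ.1 x = l * φ.1 x * l⁻¹) : T.res φ ≅ T.res ψ :=
  T.mapIso (A := .res k φ.1 φ.2) (B := .res k ψ.1 ψ.2) (PlainRep.twistIso φ.1 ψ.1 l h)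

variable [Finite G] (H : Subgroup G)

/-- Evaluation at `g`. -/
def eval (κ : Emb J G) (β : Emb J H) (g : G) (h : ∀ x, (β.1 x : G) = g * κ.1 x * g⁻¹) :
    T.coind H ⋙ T.res κ ⟶ T.res β :=
  (T.comp _ _).hom ≫ T.map₂ (A := (RepFunctor.coind k H).comp (.res k κ.1 κ.2))
    (B := .res k β.1 β.2) (PlainRep.coindEval H κ.1 β.1 g h)

/-- The unit of the adjunction between restriction and coinduction. -/
def unitCoind : 𝟭 (T.Cat G) ⟶ T.res H.emb ⋙ T.coind H :=
  (T.unit G).hom ≫ T.map₂ (A := .id k G) (B := (RepFunctor.res k H.emb.1 H.emb.2).comp (.coind k H))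
    (Rep.resCoindAdjunction.{u} k H.subtype).unit ≫ (T.comp _ _).inv

/-- The counit of the adjunction between restriction and coinduction. -/
def counitCoind : T.coind H ⋙ T.res H.emb ⟶ 𝟭 (T.Cat H) :=
  (T.comp _ _).hom ≫ T.map₂ (B := .id k H)
    (A := (RepFunctor.coind k H).comp (.res k H.emb.1 H.emb.2))
    (Rep.resCoindAdjunction.{u} k H.subtype).counit ≫ (T.unit H).inv

/-- The retraction of the unit given by averaging. -/
def average (c : k) : T.res H.emb ⋙ T.coind H ⟶ 𝟭 (T.Cat G) :=
  (T.comp _ _).hom ≫ T.map₂ (B := .id k G)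
    (A := (RepFunctor.res k H.emb.1 H.emb.2).comp (.coind k H))
    (PlainRep.average H c) ≫ (T.unit G).inv

/-- The embedding `x ↦ g κ(x) g⁻¹`. -/
abbrev mackeyEmb (κ : Emb J G) (g : G) : Emb (PlainRep.mackeySubgroup H κ.1 g) H :=
  ⟨PlainRep.mackeyHom H κ.1 g, PlainRep.mackeyHom_injective H κ.1 κ.2 g⟩

/-- Extension by zero. -/
def spread [Finite J] (κ : Emb J G) (g : G) :
    T.res (mackeyEmb H κ g) ⋙ T.coind (PlainRep.mackeySubgroup H κ.1 g) ⟶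
      T.coind H ⋙ T.res κ :=
  (T.comp _ _).hom ≫ T.map₂
    (A := (RepFunctor.res k (mackeyEmb H κ g).1 (mackeyEmb H κ g).2).comp
      (.coind k (PlainRep.mackeySubgroup H κ.1 g)))
    (B := (RepFunctor.coind k H).comp (.res k κ.1 κ.2))
    (PlainRep.spread k H κ.1 g) ≫ (T.comp _ _).inv

/-- Restriction along the identity. -/
def resId (φ : Emb K K) (h : ∀ x, φ.1 x = x) : T.res φ ≅ 𝟭 _ :=
  T.mapIso (A := .res k φ.1 φ.2) (B := .id k K) (PlainRep.resIdIso φ.1 h) ≪≫ (T.unit K).symm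

end RepSystem

namespace RepSystem

variable {k : Type u} [CommRing k] {T : RepSystem.{u, a, b} k}
variable {I J K L M G : Type u} [Group I] [Group J] [Group K] [Group L] [Group M] [Group G]

/-! ### Components of the structural transformations -/

section components

/-- The component of `resComp`. -/
def rc (ψ : Emb J K) (φ : Emb K L) (χ : Emb J L) (h : ∀ x, χ.1 x = φ.1 (ψ.1 x)) (Y : T.Cat L) :
    (T.res ψ).obj ((T.res φ).obj Y) ≅ (T.res χ).obj Y := (T.resComp ψ φ χ h).app Y

theorem rc_naturality (ψ : Emb J K) (φ : Emb K L) (χ : Emb J L) (h : ∀ x, χ.1 x = φ.1 (ψ.1 x))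
    {Y Y' : T.Cat L} (f : Y ⟶ Y') :
    (T.res ψ).map ((T.res φ).map f) ≫ (rc ψ φ χ h Y').hom = (rc ψ φ χ h Y).hom ≫ (T.res χ).map f :=
  (T.resComp ψ φ χ h).hom.naturality f

/-- The component of `twist`. -/
def tw (φ ψ : Emb K L) (l : L) (h : ∀ x, ψ.1 x = l * φ.1 x * l⁻¹) (Y : T.Cat L) :
    (T.res φ).obj Y ≅ (T.res ψ).obj Y := (T.twist φ ψ l h).app Y

theorem tw_naturality (φ ψ : Emb K L) (l : L) (h : ∀ x, ψ.1 x = l * φ.1 x * l⁻¹)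
    {Y Y' : T.Cat L} (f : Y ⟶ Y') :
    (T.res φ).map f ≫ (tw φ ψ l h Y').hom = (tw φ ψ l h Y).hom ≫ (T.res ψ).map f :=
  (T.twist φ ψ l h).hom.naturality f

/-- The component of `resId`. -/
def ri (φ : Emb L L) (h : ∀ x, φ.1 x = x) (Y : T.Cat L) : (T.res φ).obj Y ≅ Y :=
  (T.resId φ h).app Y

theorem ri_naturality (φ : Emb L L) (h : ∀ x, φ.1 x = x) {Y Y' : T.Cat L} (f : Y ⟶ Y') :
    (T.res φ).map f ≫ (ri φ h Y').hom = (ri φ h Y).hom ≫ f :=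
  (T.resId φ h).hom.naturality f

variable [Finite G] (H : Subgroup G)

/-- The component of `eval`. -/
def ev (κ : Emb J G) (β : Emb J H) (g : G) (h : ∀ x, (β.1 x : G) = g * κ.1 x * g⁻¹) (Y : T.Cat H) :
    (T.res κ).obj ((T.coind H).obj Y) ⟶ (T.res β).obj Y := (T.eval H κ β g h).app Y

theorem ev_naturality (κ : Emb J G) (β : Emb J H) (g : G) (h : ∀ x, (β.1 x : G) = g * κ.1 x * g⁻¹)
    {Y Y' : T.Cat H} (f : Y ⟶ Y') :
    (T.res κ).map ((T.coind H).map f) ≫ ev H κ β g h Y' = ev H κ β g h Y ≫ (T.res β).map f :=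
  (T.eval H κ β g h).naturality f

/-- The component of `unitCoind`. -/
def cu (Y : T.Cat G) : Y ⟶ (T.coind H).obj ((T.res H.emb).obj Y) := (T.unitCoind H).app Y

theorem cu_naturality {Y Y' : T.Cat G} (f : Y ⟶ Y') :
    f ≫ cu H Y' = cu H Y ≫ (T.coind H).map ((T.res H.emb).map f) :=
  (T.unitCoind H).naturality f

/-- The component of `counitCoind`. -/
def cc (Y : T.Cat H) : (T.res H.emb).obj ((T.coind H).obj Y) ⟶ Y := (T.counitCoind H).app Y

theorem cc_naturality {Y Y' : T.Cat H} (f : Y ⟶ Y') :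
    (T.res H.emb).map ((T.coind H).map f) ≫ cc H Y' = cc H Y ≫ f :=
  (T.counitCoind H).naturality f

/-- The component of `average`. -/
def av (c : k) (Y : T.Cat G) : (T.coind H).obj ((T.res H.emb).obj Y) ⟶ Y := (T.average H c).app Y

theorem av_naturality (c : k) {Y Y' : T.Cat G} (f : Y ⟶ Y') :
    (T.coind H).map ((T.res H.emb).map f) ≫ av H c Y' = av H c Y ≫ f :=
  (T.average H c).naturality f

/-- The component of `spread`. -/
def sp [Finite J] (κ : Emb J G) (g : G) (Y : T.Cat H) :
    (T.coind (PlainRep.mackeySubgroup H κ.1 g)).obj ((T.res (mackeyEmb H κ g)).obj Y) ⟶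
      (T.res κ).obj ((T.coind H).obj Y) :=
  (T.spread H κ g).app Y

end components

section two

variable (V : T.Cat M)

theorem rc_eq_two (Y : T.Cat L) [Pres V Y] (ψ : Emb J K) (φ : Emb K L) (χ : Emb J L)
    (h : ∀ x, χ.1 x = φ.1 (ψ.1 x)) :
    (rc ψ φ χ h Y).hom = two V ((Functor.associator _ _ _).hom ≫
      Functor.whiskerLeft (Pres.fn V Y).fn (PlainRep.resCompIso ψ.1 φ.1 χ.1 h).hom) := by
  simp only [rc, Iso.app_hom, resComp, Iso.trans_hom, NatTrans.comp_app, Functor.comp_obj,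
    mapIso_hom]
  rw [comp_hom_app_eq_two V, map₂_app_eq_two V]
  simp only [two_comp]

theorem tw_eq_two (Y : T.Cat L) [Pres V Y] (φ ψ : Emb K L) (l : L)
    (h : ∀ x, ψ.1 x = l * φ.1 x * l⁻¹) :
    (tw φ ψ l h Y).hom =
      two V (Functor.whiskerLeft (Pres.fn V Y).fn (PlainRep.twistIso φ.1 ψ.1 l h).hom) := by
  simp only [tw, Iso.app_hom, twist, mapIso_hom]
  rw [map₂_app_eq_two V]

theorem ri_eq_two (Y : T.Cat L) [Pres V Y] (φ : Emb L L) (h : ∀ x, φ.1 x = x) :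
    (ri φ h Y).hom = two V (Functor.whiskerLeft (Pres.fn V Y).fn
      (PlainRep.resIdIso φ.1 h).hom ≫ (Functor.rightUnitor _).hom) := by
  simp only [ri, Iso.app_hom, resId, Iso.trans_hom, NatTrans.comp_app, Functor.id_obj, mapIso_hom,
    Iso.symm_hom]
  rw [unit_inv_app_eq_two V, map₂_app_eq_two V]
  simp only [two_comp]

variable [Finite G] (H : Subgroup G)

theorem ev_eq_two (Y : T.Cat H) [Pres V Y] (κ : Emb J G) (β : Emb J H) (g : G)
    (h : ∀ x, (β.1 x : G) = g * κ.1 x * g⁻¹) :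
    ev H κ β g h Y = two V ((Functor.associator _ _ _).hom ≫
      Functor.whiskerLeft (Pres.fn V Y).fn (PlainRep.coindEval H κ.1 β.1 g h)) := by
  simp only [ev, eval, NatTrans.comp_app, Functor.comp_obj]
  rw [comp_hom_app_eq_two V, map₂_app_eq_two V]
  simp only [two_comp]

theorem cu_eq_two (Y : T.Cat G) [Pres V Y] :
    cu H Y = two V ((Functor.rightUnitor _).inv ≫ Functor.whiskerLeft (Pres.fn V Y).fn
        (Rep.resCoindAdjunction.{u} k H.subtype).unit ≫ (Functor.associator _ _ _).inv) := by
  simp only [cu, unitCoind, NatTrans.comp_app, Functor.comp_obj, Functor.id_obj]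
  rw [comp_inv_app_eq_two V, map₂_app_eq_two V, unit_hom_app_eq_two V]
  simp only [two_comp]

theorem cc_eq_two (Y : T.Cat H) [Pres V Y] :
    cc H Y = two V ((Functor.associator _ _ _).hom ≫ Functor.whiskerLeft (Pres.fn V Y).fn
        (Rep.resCoindAdjunction.{u} k H.subtype).counit ≫ (Functor.rightUnitor _).hom) := by
  simp only [cc, counitCoind, NatTrans.comp_app, Functor.comp_obj, Functor.id_obj]
  rw [comp_hom_app_eq_two V, map₂_app_eq_two V, unit_inv_app_eq_two V]
  simp only [two_comp]

theorem av_eq_two (c : k) (Y : T.Cat G) [Pres V Y] :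
    av H c Y = two V ((Functor.associator _ _ _).hom ≫ Functor.whiskerLeft (Pres.fn V Y).fn
        (PlainRep.average H c) ≫ (Functor.rightUnitor _).hom) := by
  simp only [av, average, NatTrans.comp_app, Functor.comp_obj, Functor.id_obj]
  rw [comp_hom_app_eq_two V, map₂_app_eq_two V, unit_inv_app_eq_two V]
  simp only [two_comp]

theorem sp_eq_two [Finite J] (κ : Emb J G) (g : G) (Y : T.Cat H) [Pres V Y] :
    sp H κ g Y = two V ((Functor.associator _ _ _).hom ≫ Functor.whiskerLeft (Pres.fn V Y).fn
        (PlainRep.spread k H κ.1 g) ≫ (Functor.associator _ _ _).inv) := by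
  simp only [sp, spread, NatTrans.comp_app, Functor.comp_obj]
  rw [comp_inv_app_eq_two V, map₂_app_eq_two V, comp_hom_app_eq_two V]
  simp only [two_comp]

end two

end RepSystem

namespace RepSystem

variable {k : Type u} [CommRing k] {T : RepSystem.{u, a, b} k}
variable {I J K L M G : Type u} [Group I] [Group J] [Group K] [Group L] [Group M] [Group G]

/-! ### Coherence of restrictions -/

/-- All these isomorphisms are the identity on underlying modules, so after normalization by `two`
the two sides agree by unfolding. -/
theorem rc_assoc (θ : Emb I J) (ψ : Emb J K) (φ : Emb K L) (θψ : Emb I K) (ψφ : Emb J L)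
    (χ : Emb I L) (h₁ : ∀ x, θψ.1 x = ψ.1 (θ.1 x)) (h₂ : ∀ x, ψφ.1 x = φ.1 (ψ.1 x))
    (h₃ : ∀ x, χ.1 x = ψφ.1 (θ.1 x)) (h₄ : ∀ x, χ.1 x = φ.1 (θψ.1 x)) (Y : T.Cat L) :
    (T.res θ).map (rc ψ φ ψφ h₂ Y).hom ≫ (rc θ ψφ χ h₃ Y).hom =
      (rc θ ψ θψ h₁ _).hom ≫ (rc θψ φ χ h₄ Y).hom := by
  simp only [rc_eq_two Y, map_two, two_comp]
  congr 1

theorem rc_tw (ψ : Emb J K) (φ φ' : Emb K L) (χ χ' : Emb J L) (l : L)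
    (h : ∀ x, χ.1 x = φ.1 (ψ.1 x)) (h' : ∀ x, χ'.1 x = φ'.1 (ψ.1 x))
    (hl : ∀ x, φ'.1 x = l * φ.1 x * l⁻¹) (hl' : ∀ x, χ'.1 x = l * χ.1 x * l⁻¹) (Y : T.Cat L) :
    (T.res ψ).map (tw φ φ' l hl Y).hom ≫ (rc ψ φ' χ' h' Y).hom =
      (rc ψ φ χ h Y).hom ≫ (tw χ χ' l hl' Y).hom := by
  simp only [rc_eq_two Y, tw_eq_two Y, map_two, two_comp]
  congr 1

theorem tw_one (φ : Emb K L) (h : ∀ x, φ.1 x = 1 * φ.1 x * 1⁻¹) (Y : T.Cat L) :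
    (tw φ φ 1 h Y).hom = 𝟙 _ := by
  rw [two_id Y, tw_eq_two Y]
  congr 1
  ext V x
  exact congrArg (fun f ↦ f x) (map_one (Rep.ρ V))

variable [Finite G] (H : Subgroup G)

/-- The unit sends `v` to `x ↦ x v`, whose value at `g` is `g v`. This is how `τ_g` is recovered
from the adjunction. -/
theorem res_cu_ev (κ χ : Emb J G) (β : Emb J H) (g : G) (h : ∀ x, (β.1 x : G) = g * κ.1 x * g⁻¹)
    (h₁ : ∀ x, χ.1 x = H.emb.1 (β.1 x)) (h₂ : ∀ x, χ.1 x = g * κ.1 x * g⁻¹) (Y : T.Cat G) :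
    (T.res κ).map (cu H Y) ≫ ev H κ β g h _ ≫ (rc β H.emb χ h₁ Y).hom =
      (tw κ χ g h₂ Y).hom := by
  simp only [rc_eq_two Y, tw_eq_two Y, ev_eq_two Y, cu_eq_two Y, map_two, two_comp]
  congr 1

theorem cu_cc (Y : T.Cat G) : (T.res H.emb).map (cu H Y) ≫ cc H _ = 𝟙 _ := by
  rw [two_id Y]
  simp only [cc_eq_two Y, cu_eq_two Y, map_two, two_comp]
  congr 1
  ext V x
  exact congrArg (fun f ↦ f.hom x)
    ((Rep.resCoindAdjunction.{u} k H.subtype).left_triangle_components V)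

theorem cu_cc' (X : T.Cat H) : cu H _ ≫ (T.coind H).map (cc H X) = 𝟙 _ := by
  rw [two_id X]
  simp only [cc_eq_two X, cu_eq_two X, map_two, two_comp]
  congr 1
  ext V x
  exact congrArg (fun f ↦ f.hom x)
    ((Rep.resCoindAdjunction.{u} k H.subtype).right_triangle_components V)

theorem cu_av (c : k) (hc : c * H.index = 1) (Y : T.Cat G) : cu H Y ≫ av H c Y = 𝟙 _ := by
  rw [two_id Y]
  simp only [av_eq_two Y, cu_eq_two Y, two_comp]
  congr 1
  ext V x
  exact congrArg (fun f ↦ f.hom x) (congr_app (PlainRep.unit_average H c hc) V)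

theorem tw_rc (ψ ψ' : Emb J K) (φ : Emb K L) (χ χ' : Emb J L) (x : K) (y : L)
    (h : ∀ x, χ.1 x = φ.1 (ψ.1 x)) (h' : ∀ x, χ'.1 x = φ.1 (ψ'.1 x))
    (hx : ∀ z, ψ'.1 z = x * ψ.1 z * x⁻¹) (hy : ∀ z, χ'.1 z = y * χ.1 z * y⁻¹)
    (hxy : y = φ.1 x) (Y : T.Cat L) :
    (tw ψ ψ' x hx ((T.res φ).obj Y)).hom ≫ (rc ψ' φ χ' h' Y).hom =
      (rc ψ φ χ h Y).hom ≫ (tw χ χ' y hy Y).hom := by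
  subst hxy
  simp only [rc_eq_two Y, tw_eq_two Y, two_comp]
  congr 1

theorem rc_eq_ri (ψ : Emb K K) (φ : Emb K L) (h : ∀ x, φ.1 x = φ.1 (ψ.1 x)) (h' : ∀ x, ψ.1 x = x)
    (Y : T.Cat L) : (rc ψ φ φ h Y).hom = (ri ψ h' ((T.res φ).obj Y)).hom := by
  simp only [rc_eq_two Y, ri_eq_two Y]
  congr 1

theorem res_ev (θ : Emb I J) (κ : Emb J G) (β : Emb J H) (κ' : Emb I G) (β' : Emb I H) (g : G)
    (h : ∀ x, (β.1 x : G) = g * κ.1 x * g⁻¹) (h' : ∀ x, (β'.1 x : G) = g * κ'.1 x * g⁻¹)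
    (hκ : ∀ x, κ'.1 x = κ.1 (θ.1 x)) (hβ : ∀ x, β'.1 x = β.1 (θ.1 x)) (X : T.Cat H) :
    (T.res θ).map (ev H κ β g h X) ≫ (rc θ β β' hβ X).hom =
      (rc θ κ κ' hκ _).hom ≫ ev H κ' β' g h' X := by
  simp only [rc_eq_two X, ev_eq_two X, map_two, two_comp]
  congr 1

/-- The group acts on coinduced functions by right translation: `(g₁ φ)(g₂) = φ(g₂ g₁)`. -/
theorem tw_ev (κ κ' : Emb J G) (β : Emb J H) (g₁ g₂ g : G) (hg : g = g₂ * g₁)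
    (h₁ : ∀ x, κ'.1 x = g₁ * κ.1 x * g₁⁻¹) (h₂ : ∀ x, (β.1 x : G) = g₂ * κ'.1 x * g₂⁻¹)
    (h : ∀ x, (β.1 x : G) = g * κ.1 x * g⁻¹) (X : T.Cat H) :
    (tw κ κ' g₁ h₁ _).hom ≫ ev H κ' β g₂ h₂ X = ev H κ β g h X := by
  subst hg
  simp only [tw_eq_two X, ev_eq_two X, two_comp]
  congr 1

/-- Coinduced functions are `H`-equivariant: `x φ(g) = φ(x g)`. -/
theorem ev_tw (κ : Emb J G) (β β' : Emb J H) (g : G) (x : H) (g' : G) (hg : g' = x * g)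
    (h₁ : ∀ x, (β.1 x : G) = g * κ.1 x * g⁻¹) (h₂ : ∀ z, β'.1 z = x * β.1 z * x⁻¹)
    (h : ∀ x, (β'.1 x : G) = g' * κ.1 x * g'⁻¹) (X : T.Cat H) :
    ev H κ β g h₁ X ≫ (tw β β' x h₂ X).hom = ev H κ β' g' h X := by
  subst hg
  simp only [tw_eq_two X, ev_eq_two X, two_comp]
  congr 1
  ext V φ
  exact (φ.2 x g).symm

/-- The counit of the adjunction is evaluation at `1`. -/
theorem ev_one (ψ : Emb H H) (hψ : ∀ x, ψ.1 x = x) (h₁ : ∀ x, H.emb.1 x = H.emb.1 (ψ.1 x))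
    (h₂ : ∀ x, (ψ.1 x : G) = 1 * H.emb.1 x * 1⁻¹) (X : T.Cat H) :
    (rc ψ H.emb H.emb h₁ _).hom ≫ ev H H.emb ψ 1 h₂ X ≫ (ri ψ hψ X).hom =
      (ri ψ hψ _).hom ≫ cc H X := by
  simp only [rc_eq_two X, ev_eq_two X, ri_eq_two X, cc_eq_two X, two_comp]
  congr 1

end RepSystem

/-! ### Mackey decomposition of a restricted coinduced object. -/

namespace PlainRep

variable {k : Type u} [CommRing k] {J G : Type u} [Group J] [Group G] {H : Subgroup G}
  {κ : J →* G} {g : G} {W : Rep.{u} k H}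

theorem spreadFun_self (ψ : Representation.coindV (mackeySubgroup H κ g).subtype
    (W.ρ.comp (mackeyHom H κ g))) : spreadFun H κ g W ψ.1 g = ψ.1 1 := by
  have := spreadFun_apply ψ 1 1
  rwa [map_one, map_one, mul_one, OneMemClass.coe_one, one_mul] at this

/-- The double cosets partition `G`, so only the one containing `y` contributes at `y`, and
equivariance under `H` identifies its term with `φ(y)`. -/
theorem sum_spreadFun [Fintype (DoubleCoset.Quotient (H : Set G) (κ.range : Set G))]
    (φ : Representation.coindV H.subtype W.ρ) (y : G) :
    ∑ q : DoubleCoset.Quotient (H : Set G) (κ.range : Set G),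
      spreadFun H κ q.out W (fun x ↦ φ.1 (q.out * κ x)) y = φ.1 y := by
  classical
  rw [Finset.sum_eq_single (DoubleCoset.mk H κ.range y)]
  · obtain ⟨h, _, hh, ⟨x, rfl⟩, e⟩ := DoubleCoset.mk_out_eq_mul H κ.range y
    set g := Quotient.out (DoubleCoset.mk H κ.range y)
    have e' : y = (⟨h, hh⟩⁻¹ : H) * g * κ x⁻¹ := by
      simp [e, mul_assoc]
    conv_lhs => rw [e']
    have := spreadFun_apply (H := H) (κ := κ) (g := g) (W := W)
      ⟨fun x ↦ φ.1 (g * κ x), fun z x ↦ ?_⟩ ⟨h, hh⟩⁻¹ x⁻¹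
    · rw [this]
      conv_rhs => rw [e', mul_assoc]
      exact (φ.2 _ _).symm
    · have := φ.2 (mackeyHom H κ g z) (g * κ x)
      simp only [Subgroup.subtype_apply, coe_mackeyHom] at this
      simpa [mul_assoc] using this
  · intro q _ hq
    refine spreadFun_of_not ?_
    rintro ⟨h, x, rfl⟩
    refine hq ?_
    rw [← DoubleCoset.out_eq' H κ.range q, DoubleCoset.eq]
    exact ⟨h, h.2, κ x, ⟨x, rfl⟩, by rw [DoubleCoset.out_eq']⟩
  · exact fun h ↦ absurd (Finset.mem_univ _) h

theorem counit_apply (K : Subgroup G) (V : Rep.{u} k K)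
    (φ : Representation.coindV K.subtype V.ρ) :
    ((Rep.resCoindAdjunction.{u} k K.subtype).counit.app V).hom φ = φ.1 1 := rfl

theorem spread_eval (H : Subgroup G) (κ : J →* G) (g : G) (κ' : mackeySubgroup H κ g →* G)
    (h : ∀ x, κ' x = κ ((mackeySubgroup H κ g).subtype x))
    (h' : ∀ x, (mackeyHom H κ g x : G) = g * κ' x * g⁻¹) (V : Rep.{u} k H) :
    (Rep.resFunctor (mackeySubgroup H κ g).subtype).map ((spread k H κ g).app V) ≫
      (resCompIso _ κ κ' h).hom.app _ ≫ (coindEval H κ' (mackeyHom H κ g) g h').app V =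
      (Rep.resCoindAdjunction.{u} k (mackeySubgroup H κ g).subtype).counit.app
        ((Rep.resFunctor (mackeyHom H κ g)).obj V) := by
  refine Rep.hom_ext (Representation.IntertwiningMap.ext (LinearMap.ext fun φ ↦ ?_))
  let φ' : Representation.coindV (mackeySubgroup H κ g).subtype
    (V.ρ.comp (mackeyHom H κ g)) := φ
  trans spreadFun H κ g V φ'.1 g
  · rfl
  · trans φ'.1 1
    · exact spreadFun_self φ'
    · exact (counit_apply _ _ φ).symm

theorem sum_hom_apply {A : Rep.{u} k J} (κ : J →* G) {ι : Type*} (s : Finset ι)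
    (f : ι → (A ⟶ (Rep.resFunctor κ).obj ((Rep.coindFunctor.{u} k H.subtype).obj W))) (v : A)
    (y : G) : (show Representation.coindV H.subtype W.ρ from (∑ i ∈ s, f i).hom v).1 y =
      ∑ i ∈ s, (show Representation.coindV H.subtype W.ρ from (f i).hom v).1 y :=
  map_sum (AddMonoidHom.mk' (fun f : A ⟶ (Rep.resFunctor κ).obj
      ((Rep.coindFunctor k H.subtype).obj W) ↦
    (show Representation.coindV H.subtype W.ρ from f.hom v).1 y) fun _ _ ↦ rfl) f s

end PlainRep

namespace RepSystem

variable {k : Type u} [CommRing k] {T : RepSystem.{u, a, b} k}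
variable {I J K L M G : Type u} [Group I] [Group J] [Group K] [Group L] [Group M] [Group G]

variable [Finite G] (H : Subgroup G)

section mackey

variable [Finite J] (κ : Emb J G) (g g' : G)

/-- With `sp_ev_of_ne` this gives the orthogonality relations between extension by zero from a
double coset and evaluation at a point, while `sum_cu_ev_sp` is the completeness relation. The three
together are Mackey's formula. -/
theorem sp_ev (κ' : Emb (PlainRep.mackeySubgroup H κ.1 g) G)
    (h : ∀ x, κ'.1 x = κ.1 ((PlainRep.mackeySubgroup H κ.1 g).emb.1 x))
    (h' : ∀ x, ((mackeyEmb H κ g).1 x : G) = g * κ'.1 x * g⁻¹) (X : T.Cat H) :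
    (T.res (PlainRep.mackeySubgroup H κ.1 g).emb).map (sp H κ g X) ≫
      (rc _ κ κ' h _).hom ≫ ev H κ' (mackeyEmb H κ g) g h' X = cc _ _ := by
  simp only [rc_eq_two X, ev_eq_two X, sp_eq_two X, cc_eq_two X, map_two, two_comp]
  congr 1
  refine NatTrans.ext (funext fun V ↦ ?_)
  exact PlainRep.spread_eval H κ.1 g κ'.1 h h' _

theorem sp_ev_of_ne (hg : ¬ ∃ (h : H) (x : J), g' = h * g * κ.1 x)
    (κ' : Emb (PlainRep.mackeySubgroup H κ.1 g') G)
    (h : ∀ x, κ'.1 x = κ.1 ((PlainRep.mackeySubgroup H κ.1 g').emb.1 x))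
    (h' : ∀ x, ((mackeyEmb H κ g').1 x : G) = g' * κ'.1 x * g'⁻¹) (X : T.Cat H) :
    (T.res (PlainRep.mackeySubgroup H κ.1 g').emb).map (sp H κ g X) ≫
      (rc _ κ κ' h _).hom ≫ ev H κ' (mackeyEmb H κ g') g' h' X = 0 := by
  rw [two_zero X]
  simp only [rc_eq_two X, ev_eq_two X, sp_eq_two X, map_two, two_comp]
  congr 1
  ext V φ
  exact PlainRep.spreadFun_of_not hg

theorem sum_cu_ev_sp [Fintype (DoubleCoset.Quotient (H : Set G) (κ.1.range : Set G))]
    (κ' : ∀ g, Emb (PlainRep.mackeySubgroup H κ.1 g) G)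
    (h : ∀ g x, (κ' g).1 x = κ.1 ((PlainRep.mackeySubgroup H κ.1 g).emb.1 x))
    (h' : ∀ g x, ((mackeyEmb H κ g).1 x : G) = g * (κ' g).1 x * g⁻¹) (X : T.Cat H) :
    ∑ q : DoubleCoset.Quotient (H : Set G) (κ.1.range : Set G),
      cu (PlainRep.mackeySubgroup H κ.1 q.out) ((T.res κ).obj ((T.coind H).obj X)) ≫
        (T.coind (PlainRep.mackeySubgroup H κ.1 q.out)).map
          ((rc _ κ (κ' q.out) (h _) _).hom ≫ ev H (κ' q.out) (mackeyEmb H κ q.out) q.out (h' _) X) ≫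
        sp H κ q.out X = 𝟙 _ := by
  rw [two_id X]
  simp only [rc_eq_two X, ev_eq_two X, sp_eq_two X, cu_eq_two X, map_two, two_comp, two_sum]
  congr 1
  ext V φ
  refine Subtype.ext (funext fun y ↦ ?_)
  rw [NatTrans.app_sum]
  refine (PlainRep.sum_hom_apply (W := V) κ.1 Finset.univ _ φ y).trans
    (Eq.trans (Finset.sum_congr rfl fun q _ ↦ ?_) (PlainRep.sum_spreadFun (κ := κ.1) φ y))
  rfl

end mackey

end RepSystem

/-- Composition of injective homomorphisms. -/
def Emb.comp {J K L : Type u} [Group J] [Group K] [Group L] (ψ : Emb J K) (φ : Emb K L) : Emb J L :=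
  ⟨φ.1.comp ψ.1, φ.2.comp ψ.2⟩

theorem Emb.comp_apply {J K L : Type u} [Group J] [Group K] [Group L] (ψ : Emb J K) (φ : Emb K L)
    (x : J) : (ψ.comp φ).1 x = φ.1 (ψ.1 x) := rfl

namespace RepSystem

variable {k : Type u} [CommRing k] {T : RepSystem.{u, a, b} k}
variable {I J K L M G : Type u} [Group I] [Group J] [Group K] [Group L] [Group M] [Group G]

theorem coe_mackeyEmb (H : Subgroup G) (κ : Emb J G) (g : G) (x : PlainRep.mackeySubgroup H κ.1 g) :
    ((mackeyEmb H κ g).1 x : G) =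
      g * ((PlainRep.mackeySubgroup H κ.1 g).emb.comp κ).1 x * g⁻¹ := rfl

variable [Finite G] (H : Subgroup G)

/-! ### Morphisms into coinduced objects -/

/-- The part at `g` of a morphism into a restriction of a coinduced object. -/
def part (κ : Emb J G) (θ : Emb I J) (β : Emb I H) (g : G)
    (h : ∀ x, (β.1 x : G) = g * (θ.comp κ).1 x * g⁻¹) {Z : T.Cat J} {X : T.Cat H}
    (m : Z ⟶ (T.res κ).obj ((T.coind H).obj X)) : (T.res θ).obj Z ⟶ (T.res β).obj X :=
  (T.res θ).map m ≫ (rc θ κ (θ.comp κ) (Emb.comp_apply θ κ) _).hom ≫ ev H (θ.comp κ) β g h X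

section part

variable (κ : Emb J G) (θ : Emb I J) (β : Emb I H) (g : G)
  (h : ∀ x, (β.1 x : G) = g * (θ.comp κ).1 x * g⁻¹) {Z : T.Cat J} {X : T.Cat H}

theorem comp_part {Z' : T.Cat J} (f : Z' ⟶ Z) (m : Z ⟶ (T.res κ).obj ((T.coind H).obj X)) :
    part H κ θ β g h (f ≫ m) = (T.res θ).map f ≫ part H κ θ β g h m := by
  simp only [part, Functor.map_comp, Category.assoc]

theorem part_comp {X' : T.Cat H} (m : Z ⟶ (T.res κ).obj ((T.coind H).obj X)) (f : X ⟶ X') :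
    part H κ θ β g h (m ≫ (T.res κ).map ((T.coind H).map f)) =
      part H κ θ β g h m ≫ (T.res β).map f := by
  simp only [part, Functor.map_comp, Category.assoc, ← ev_naturality]
  rw [reassoc_of% (rc_naturality θ κ (θ.comp κ) (Emb.comp_apply θ κ) ((T.coind H).map f))]

theorem part_comp_cu {Y : T.Cat G} (m : Z ⟶ (T.res κ).obj Y) (χ : Emb I G)
    (h₁ : ∀ x, χ.1 x = H.emb.1 (β.1 x)) (h₂ : ∀ x, χ.1 x = g * (θ.comp κ).1 x * g⁻¹) :
    part H κ θ β g h (m ≫ (T.res κ).map (cu H Y)) ≫ (rc β H.emb χ h₁ Y).hom =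
      (T.res θ).map m ≫ (rc θ κ (θ.comp κ) (Emb.comp_apply θ κ) Y).hom ≫
        (tw (θ.comp κ) χ g h₂ Y).hom := by
  simp only [part, Functor.map_comp, Category.assoc]
  rw [reassoc_of% (rc_naturality θ κ (θ.comp κ) (Emb.comp_apply θ κ) (cu H Y)),
    res_cu_ev H (θ.comp κ) χ β g h h₁ h₂]

theorem part_res {I' : Type u} [Group I'] (ϑ : Emb I' I) (θ' : Emb I' J) (β' : Emb I' H)
    (hθ : ∀ x, θ'.1 x = θ.1 (ϑ.1 x)) (hβ : ∀ x, β'.1 x = β.1 (ϑ.1 x))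
    (h' : ∀ x, (β'.1 x : G) = g * (θ'.comp κ).1 x * g⁻¹)
    (m : Z ⟶ (T.res κ).obj ((T.coind H).obj X)) :
    (T.res ϑ).map (part H κ θ β g h m) ≫ (rc ϑ β β' hβ X).hom =
      (rc ϑ θ θ' hθ Z).hom ≫ part H κ θ' β' g h' m := by
  have hχ : ∀ x, (θ'.comp κ).1 x = (θ.comp κ).1 (ϑ.1 x) := fun x ↦ by
    rw [Emb.comp_apply, Emb.comp_apply, hθ]
  simp only [part, Functor.map_comp, Category.assoc]
  rw [res_ev H ϑ (θ.comp κ) β (θ'.comp κ) β' g h h' hχ hβ,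
    reassoc_of% (rc_assoc ϑ θ κ θ' (θ.comp κ) (θ'.comp κ) hθ (Emb.comp_apply θ κ) hχ
      (Emb.comp_apply θ' κ)), reassoc_of% (rc_naturality ϑ θ θ' hθ m)]

/-- Moving `g` within its double coset changes a part only by twists, since `φ(y g' κ(x)) = y ((κ(x)
φ)(g'))`. Parts at representatives therefore determine all the others. -/
theorem tw_part_tw (θ' : Emb I J) (β' : Emb I H) (g' : G) (x : J) (y : H)
    (hx : ∀ z, θ'.1 z = x * θ.1 z * x⁻¹) (hy : ∀ z, β'.1 z = y * β.1 z * y⁻¹)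
    (h' : ∀ x, (β.1 x : G) = g' * (θ'.comp κ).1 x * g'⁻¹)
    (h'' : ∀ x, (β'.1 x : G) = g * (θ.comp κ).1 x * g⁻¹)
    (hg : g = y * g' * κ.1 x) (m : Z ⟶ (T.res κ).obj ((T.coind H).obj X)) :
    (tw θ θ' x hx Z).hom ≫ part H κ θ' β g' h' m ≫ (tw β β' y hy X).hom =
      part H κ θ β' g h'' m := by
  have hχ : ∀ z, (θ'.comp κ).1 z = κ.1 x * (θ.comp κ).1 z * (κ.1 x)⁻¹ := fun z ↦ by
    rw [Emb.comp_apply, Emb.comp_apply, hx, map_mul, map_mul, map_inv]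
  have h₃ : ∀ z, (β.1 z : G) = (g' * κ.1 x) * (θ.comp κ).1 z * (g' * κ.1 x)⁻¹ := fun z ↦ by
    rw [h', hχ]; group
  simp only [part, Category.assoc]
  rw [← reassoc_of% (tw_naturality θ θ' x hx m),
    reassoc_of% (tw_rc θ θ' κ (θ.comp κ) (θ'.comp κ) x (κ.1 x) (Emb.comp_apply θ κ)
      (Emb.comp_apply θ' κ) hx hχ rfl),
    reassoc_of% (tw_ev H (θ.comp κ) (θ'.comp κ) β (κ.1 x) g' (g' * κ.1 x) rfl hχ h' h₃),
    ev_tw H (θ.comp κ) β β' (g' * κ.1 x) y g (by rw [hg, mul_assoc]) h₃ hy h'']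

end part

/-! ### Morphisms into a restricted coinduced object are families of parts. -/

section mackey

variable [Finite J] (κ : Emb J G)

variable {Z : T.Cat J} {X : T.Cat H}

/-- Composing `m` with the resolution of the identity `sum_cu_ev_sp` and moving `m` past the units
expresses it through its parts. -/
theorem eq_of_part_eq (m m' : Z ⟶ (T.res κ).obj ((T.coind H).obj X))
    (h : ∀ g, part H κ (PlainRep.mackeySubgroup H κ.1 g).emb (mackeyEmb H κ g) g
        (coe_mackeyEmb H κ g) m =
      part H κ (PlainRep.mackeySubgroup H κ.1 g).emb (mackeyEmb H κ g) g
        (coe_mackeyEmb H κ g) m') : m = m' := by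
  classical
  have : Finite (DoubleCoset.Quotient (H : Set G) (κ.1.range : Set G)) := Quotient.finite _
  have := Fintype.ofFinite (DoubleCoset.Quotient (H : Set G) (κ.1.range : Set G))
  have key := sum_cu_ev_sp (T := T) H κ (fun g ↦ (PlainRep.mackeySubgroup H κ.1 g).emb.comp κ)
    (fun g ↦ Emb.comp_apply _ _) (fun g ↦ coe_mackeyEmb H κ g) X
  rw [← Category.comp_id m, ← Category.comp_id m', ← key, Preadditive.comp_sum,
    Preadditive.comp_sum]
  refine Finset.sum_congr rfl fun q _ ↦ ?_
  rw [reassoc_of% (cu_naturality (PlainRep.mackeySubgroup H κ.1 q.out) m),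
    reassoc_of% (cu_naturality (PlainRep.mackeySubgroup H κ.1 q.out) m'),
    ← Functor.map_comp_assoc, ← Functor.map_comp_assoc]
  have := h q.out
  rw [part, part] at this
  rw [this]

/-- Each prescribed part is transposed along the adjunction for its Mackey subgroup and extended by
zero. In the sum of the results, orthogonality isolates one term for each double coset. -/
theorem exists_part_eq (μ : ∀ g, (T.res (PlainRep.mackeySubgroup H κ.1 g).emb).obj Z ⟶
      (T.res (mackeyEmb H κ g)).obj X) :
    ∃ m : Z ⟶ (T.res κ).obj ((T.coind H).obj X),
      ∀ q : DoubleCoset.Quotient (H : Set G) (κ.1.range : Set G),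
        part H κ (PlainRep.mackeySubgroup H κ.1 q.out).emb (mackeyEmb H κ q.out) q.out
          (coe_mackeyEmb H κ q.out) m = μ q.out := by
  classical
  have : Finite (DoubleCoset.Quotient (H : Set G) (κ.1.range : Set G)) := Quotient.finite _
  have := Fintype.ofFinite (DoubleCoset.Quotient (H : Set G) (κ.1.range : Set G))
  refine ⟨∑ q : DoubleCoset.Quotient (H : Set G) (κ.1.range : Set G),
    cu (PlainRep.mackeySubgroup H κ.1 q.out) Z ≫
      (T.coind (PlainRep.mackeySubgroup H κ.1 q.out)).map (μ q.out) ≫ sp H κ q.out X, fun q ↦ ?_⟩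
  rw [part, Functor.map_sum, Preadditive.sum_comp, Finset.sum_eq_single q]
  · simp only [Functor.map_comp, Category.assoc]
    rw [sp_ev H κ q.out ((PlainRep.mackeySubgroup H κ.1 q.out).emb.comp κ)
      (Emb.comp_apply _ _) (coe_mackeyEmb H κ q.out), cc_naturality, reassoc_of% cu_cc]
  · intro q' _ hq
    simp only [Functor.map_comp, Category.assoc]
    rw [sp_ev_of_ne H κ q'.out q.out _ ((PlainRep.mackeySubgroup H κ.1 q.out).emb.comp κ)
      (Emb.comp_apply _ _) (coe_mackeyEmb H κ q.out), comp_zero, comp_zero]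
    rintro ⟨h, x, e⟩
    refine hq ?_
    rw [← DoubleCoset.out_eq' H κ.1.range q, ← DoubleCoset.out_eq' H κ.1.range q', DoubleCoset.eq]
    exact ⟨h, h.2, κ.1 x, ⟨x, rfl⟩, e⟩
  · exact fun h ↦ absurd (Finset.mem_univ _) h

end mackey

end RepSystem

namespace RepSystem

variable {k : Type u} [CommRing k] {T : RepSystem.{u, a, b} k}
variable {I J K L M G : Type u} [Group I] [Group J] [Group K] [Group L] [Group M] [Group G]

/-! ### Restriction of morphisms between restrictions -/

/-- Restriction along `j` of a morphism between restrictions. -/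
def rs (j : Emb J K) (α β : Emb K L) (α' β' : Emb J L) (hα : ∀ x, α'.1 x = α.1 (j.1 x))
    (hβ : ∀ x, β'.1 x = β.1 (j.1 x)) {W W' : T.Cat L} (s : (T.res α).obj W ⟶ (T.res β).obj W') :
    (T.res α').obj W ⟶ (T.res β').obj W' :=
  (rc j α α' hα W).inv ≫ (T.res j).map s ≫ (rc j β β' hβ W').hom

section rs

variable (j : Emb J K) (α β : Emb K L) (α' β' : Emb J L) (hα : ∀ x, α'.1 x = α.1 (j.1 x))
  (hβ : ∀ x, β'.1 x = β.1 (j.1 x)) {W W' W'' : T.Cat L}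

theorem map_comp_rc (s : (T.res α).obj W ⟶ (T.res β).obj W') :
    (T.res j).map s ≫ (rc j β β' hβ W').hom = (rc j α α' hα W).hom ≫ rs j α β α' β' hα hβ s := by
  rw [rs, Iso.hom_inv_id_assoc]

theorem rs_comp (γ : Emb K L) (γ' : Emb J L) (hγ : ∀ x, γ'.1 x = γ.1 (j.1 x))
    (s : (T.res α).obj W ⟶ (T.res β).obj W') (t : (T.res β).obj W' ⟶ (T.res γ).obj W'') :
    rs j α γ α' γ' hα hγ (s ≫ t) = rs j α β α' β' hα hβ s ≫ rs j β γ β' γ' hβ hγ t := by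
  simp [rs]

theorem rs_map (f : W ⟶ W') : rs j α α α' α' hα hα ((T.res α).map f) = (T.res α').map f := by
  rw [rs, rc_naturality, Iso.inv_hom_id_assoc]

theorem rs_tw (l : L) (h : ∀ x, β.1 x = l * α.1 x * l⁻¹) (h' : ∀ x, β'.1 x = l * α'.1 x * l⁻¹) :
    rs j α β α' β' hα hβ (tw α β l h W).hom = (tw α' β' l h' W).hom := by
  rw [rs, rc_tw j α β α' β' l hα hβ h h', Iso.inv_hom_id_assoc]

theorem rs_rs (i : Emb I J) (ij : Emb I K) (α'' β'' : Emb I L) (hij : ∀ x, ij.1 x = j.1 (i.1 x))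
    (hα' : ∀ x, α''.1 x = α'.1 (i.1 x)) (hβ' : ∀ x, β''.1 x = β'.1 (i.1 x))
    (hα'' : ∀ x, α''.1 x = α.1 (ij.1 x)) (hβ'' : ∀ x, β''.1 x = β.1 (ij.1 x))
    (s : (T.res α).obj W ⟶ (T.res β).obj W') :
    rs i α' β' α'' β'' hα' hβ' (rs j α β α' β' hα hβ s) = rs ij α β α'' β'' hα'' hβ'' s := by
  rw [← cancel_epi (rc i α' α'' hα' W).hom, ← cancel_epi ((T.res i).map (rc j α α' hα W).hom),
    ← map_comp_rc i α' β' α'' β'' hα' hβ', ← Functor.map_comp_assoc, ← map_comp_rc j α β α' β',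
    reassoc_of% (rc_assoc i j α ij α' α'' hij hα hα' hα''), ← map_comp_rc ij α β α'' β'',
    Functor.map_comp_assoc, rc_assoc i j β ij β' β'' hij hβ hβ' hβ'',
    reassoc_of% (rc_naturality i j ij hij s)]

theorem rs_self (j : Emb K K) (hj : ∀ x, j.1 x = x) (hα : ∀ x, α.1 x = α.1 (j.1 x))
    (hβ : ∀ x, β.1 x = β.1 (j.1 x)) (s : (T.res α).obj W ⟶ (T.res β).obj W') :
    rs j α β α β hα hβ s = s := by
  rw [← cancel_epi (rc j α α hα W).hom, ← map_comp_rc, rc_eq_ri j α hα hj, rc_eq_ri j β hβ hj,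
    ri_naturality]

end rs

/-! ### The action of `g` on a restricted object -/

section act

variable (H : Subgroup G)

/-- The action of `g` between restrictions of a restriction to `H`. -/
def act (α β : Emb J H) (g : G) (h : ∀ x, (β.comp H.emb).1 x = g * (α.comp H.emb).1 x * g⁻¹)
    (V : T.Cat G) : (T.res α).obj ((T.res H.emb).obj V) ⟶ (T.res β).obj ((T.res H.emb).obj V) :=
  (rc α H.emb (α.comp H.emb) (Emb.comp_apply _ _) V).hom ≫
    (tw (α.comp H.emb) (β.comp H.emb) g h V).hom ≫
    (rc β H.emb (β.comp H.emb) (Emb.comp_apply _ _) V).inv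

theorem rs_act (j : Emb J K) (α β : Emb K H) (α' β' : Emb J H) (hα : ∀ x, α'.1 x = α.1 (j.1 x))
    (hβ : ∀ x, β'.1 x = β.1 (j.1 x)) (g : G)
    (h : ∀ x, (β.comp H.emb).1 x = g * (α.comp H.emb).1 x * g⁻¹)
    (h' : ∀ x, (β'.comp H.emb).1 x = g * (α'.comp H.emb).1 x * g⁻¹) (V : T.Cat G) :
    rs j α β α' β' hα hβ (act H α β g h V) = act H α' β' g h' V := by
  have e₁ : ∀ x, (α'.comp H.emb).1 x = (α.comp H.emb).1 (j.1 x) := fun x ↦ by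
    rw [Emb.comp_apply, Emb.comp_apply, hα]
  have e₂ : ∀ x, (β'.comp H.emb).1 x = (β.comp H.emb).1 (j.1 x) := fun x ↦ by
    rw [Emb.comp_apply, Emb.comp_apply, hβ]
  rw [← cancel_epi (rc j α α' hα _).hom, ← map_comp_rc,
    ← cancel_mono (rc β' H.emb (β'.comp H.emb) (Emb.comp_apply _ _) V).hom]
  simp only [act, Category.assoc, Iso.inv_hom_id, Category.comp_id, Functor.map_comp]
  rw [← rc_assoc j β H.emb β' (β.comp H.emb) (β'.comp H.emb) hβ (Emb.comp_apply _ _) e₂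
    (Emb.comp_apply _ _), ← Functor.map_comp_assoc _ (Iso.inv _), Iso.inv_hom_id,
    CategoryTheory.Functor.map_id,
    Category.id_comp, rc_tw j _ _ _ _ g e₁ e₂ h h',
    reassoc_of% (rc_assoc j α H.emb α' (α.comp H.emb) (α'.comp H.emb) hα (Emb.comp_apply _ _) e₁
      (Emb.comp_apply _ _))]

theorem act_naturality (α β : Emb J H) (g : G)
    (h : ∀ x, (β.comp H.emb).1 x = g * (α.comp H.emb).1 x * g⁻¹) {V V' : T.Cat G} (f : V ⟶ V') :
    (T.res α).map ((T.res H.emb).map f) ≫ act H α β g h V' =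
      act H α β g h V ≫ (T.res β).map ((T.res H.emb).map f) := by
  rw [← cancel_mono (rc β H.emb (β.comp H.emb) (Emb.comp_apply _ _) V').hom]
  simp only [act, Category.assoc, Iso.inv_hom_id, Category.comp_id]
  rw [rc_naturality, Iso.inv_hom_id_assoc, ← tw_naturality, reassoc_of% (rc_naturality α H.emb)]

variable [Finite G]

/-- The canonical coaction of a restricted object thus encodes exactly the actions `τ_g`. -/
theorem part_cu (α β : Emb J H) (g : G)
    (h : ∀ x, (β.comp H.emb).1 x = g * (α.comp H.emb).1 x * g⁻¹)
    (h' : ∀ x, (β.1 x : G) = g * (α.comp H.emb).1 x * g⁻¹) (V : T.Cat G) :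
    part H H.emb α β g h' ((T.res H.emb).map (cu H V)) = act H α β g h V := by
  have := part_comp_cu H H.emb α β g h' (𝟙 ((T.res H.emb).obj V)) (β.comp H.emb)
    (Emb.comp_apply _ _) h
  rw [Category.id_comp, CategoryTheory.Functor.map_id, Category.id_comp] at this
  rw [← cancel_mono (rc β H.emb (β.comp H.emb) (Emb.comp_apply _ _) V).hom, this, act]
  simp

end act

end RepSystem

namespace RepSystem

variable {k : Type u} [CommRing k] {T : RepSystem.{u, a, b} k}
variable {I J K G : Type u} [Group I] [Group J] [Group K] [Group G] (H : Subgroup G)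

/-! ### Comonadic descent -/

section comonadic

variable [Finite G]

/-- By naturality of the unit, `f` is recovered from its restriction as `cu ≫ Coind (Res f) ≫ av`.
-/
theorem res_map_injective (c : k) (hc : c * H.index = 1) {V V' : T.Cat G} (f f' : V ⟶ V')
    (h : (T.res H.emb).map f = (T.res H.emb).map f') : f = f' := by
  rw [← Category.comp_id f, ← Category.comp_id f', ← cu_av H c hc, reassoc_of% (cu_naturality H f),
    reassoc_of% (cu_naturality H f'), h]

/-- The preimage is given by the same formula with `f` in place of `Res f`. The hypothesis is
compatibility of `f` with the canonical coactions; it moves `f` in front of the unit, which `av`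
then cancels. -/
theorem exists_res_map_eq (c : k) (hc : c * H.index = 1) {V V' : T.Cat G}
    (f : (T.res H.emb).obj V ⟶ (T.res H.emb).obj V')
    (hf : (T.res H.emb).map (cu H V) ≫ (T.res H.emb).map ((T.coind H).map f) =
      f ≫ (T.res H.emb).map (cu H V')) : ∃ f₀ : V ⟶ V', (T.res H.emb).map f₀ = f := by
  refine ⟨cu H V ≫ (T.coind H).map f ≫ av H c V', ?_⟩
  rw [Functor.map_comp, Functor.map_comp, reassoc_of% hf, ← Functor.map_comp, cu_av H c hc,
    CategoryTheory.Functor.map_id, Category.comp_id]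

/-- The object `V` should be the equalizer of `Coind s` and the unit at `Coind W`. The retraction
`av` of the unit turns this equalizer into the image of the idempotent `e`, so a splitting of `e`
constructs `V`. Coassociativity and naturality of `av` show that `e` equalizes the pair, and then
that `e` is idempotent. -/
theorem exists_descent (c : k) (hc : c * H.index = 1) {W : T.Cat H}
    (s : W ⟶ (T.res H.emb).obj ((T.coind H).obj W))
    (h₁ : s ≫ cc H W = 𝟙 W)
    (h₂ : s ≫ (T.res H.emb).map (cu H ((T.coind H).obj W)) =
      s ≫ (T.res H.emb).map ((T.coind H).map s)) :
    ∃ (V : T.Cat G) (i : V ⟶ (T.coind H).obj W) (f : (T.res H.emb).obj V ≅ W),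
      f.hom ≫ s = (T.res H.emb).map i ∧ cu H V ≫ (T.coind H).map f.hom = i := by
  let e : (T.coind H).obj W ⟶ (T.coind H).obj W := (T.coind H).map s ≫ av H c _
  have e_def : e = (T.coind H).map s ≫ av H c _ := rfl
  have key : (T.coind H).map (s ≫ (T.res H.emb).map ((T.coind H).map s)) ≫ av H c _ =
      e ≫ (T.coind H).map s := by
    rw [Functor.map_comp, Category.assoc, av_naturality, e_def, Category.assoc]
  have key' : (T.coind H).map (s ≫ (T.res H.emb).map (cu H ((T.coind H).obj W))) ≫ av H c _ =
      e ≫ cu H _ := by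
    rw [Functor.map_comp, Category.assoc, av_naturality, e_def, Category.assoc]
  have hes : e ≫ (T.coind H).map s = e ≫ cu H _ := by rw [← key, ← key', h₂]
  have he : e ≫ e = e := by
    rw [e_def, ← Category.assoc, ← e_def, hes, Category.assoc, cu_av H c hc, Category.comp_id]
  obtain ⟨V, i, q, hiq, hqi⟩ := T.exists_splitting e he
  have hi : i ≫ (T.coind H).map s = i ≫ cu H _ := by
    have : i = i ≫ e := by rw [← hqi, reassoc_of% hiq]
    calc i ≫ (T.coind H).map s = i ≫ e ≫ (T.coind H).map s := by rw [← Category.assoc, ← this]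
      _ = i ≫ cu H _ := by rw [hes, ← Category.assoc, ← this]
  -- The coaction lands in the summand cut out by `e`, so its composite with the projection can
  -- serve as the inverse of `f`.
  have hse : s ≫ (T.res H.emb).map e = s := by
    rw [e_def, Functor.map_comp, ← reassoc_of% h₂, ← Functor.map_comp, cu_av H c hc,
      CategoryTheory.Functor.map_id, Category.comp_id]
  have hfs : ((T.res H.emb).map i ≫ cc H W) ≫ s = (T.res H.emb).map i := by
    rw [Category.assoc, ← cc_naturality, ← Functor.map_comp_assoc, hi, Functor.map_comp_assoc,
      cu_cc, Category.comp_id]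
  refine ⟨V, i, ⟨(T.res H.emb).map i ≫ cc H W, s ≫ (T.res H.emb).map q, ?_, ?_⟩, hfs, ?_⟩
  · rw [← Category.assoc, hfs, ← Functor.map_comp, hiq, CategoryTheory.Functor.map_id]
  · rw [Category.assoc, ← Functor.map_comp_assoc, hqi, reassoc_of% hse, h₁]
  · rw [Functor.map_comp, ← reassoc_of% (cu_naturality H i), cu_cc', Category.comp_id]

end comonadic

/-! ### Descent data -/

/-- The inclusion `H[g] → H`. -/
abbrev inclEmb (g : G) : Emb (inter1 H g) H :=
  ⟨Subgroup.inclusion (inf_le_right : inter1 H g ≤ H), Subgroup.inclusion_injective _⟩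

/-- The homomorphism `H[g] → H`, `x ↦ g x g⁻¹`. -/
abbrev conjEmb (g : G) : Emb (inter1 H g) H :=
  ⟨conjHom g (inter1 H g) H (inter1_conj H g), conjHom_injective _ _ _ _⟩

variable {H} in
/-- The factorization through `H[g]` of a homomorphism to `H`. -/
def toInter (α β : Emb J H) (g : G) (h : ∀ x, (β.1 x : G) = g * (α.comp H.emb).1 x * g⁻¹) :
    Emb J (inter1 H g) :=
  ⟨(H.emb.1.comp α.1).codRestrict _ fun x ↦ ⟨mem_conjBy.2 (by
      have := h x
      rw [Emb.comp_apply] at this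
      exact this ▸ (β.1 x).2), (α.1 x).2⟩,
    fun x y hxy ↦ α.2 (Subtype.ext (congrArg (fun z : inter1 H g ↦ (z : G)) hxy))⟩

variable {H} in
theorem inclEmb_toInter (α β : Emb J H) (g : G)
    (h : ∀ x, (β.1 x : G) = g * (α.comp H.emb).1 x * g⁻¹) (x : J) :
    α.1 x = (inclEmb H g).1 ((toInter α β g h).1 x) := rfl

variable {H} in
theorem conjEmb_toInter (α β : Emb J H) (g : G)
    (h : ∀ x, (β.1 x : G) = g * (α.comp H.emb).1 x * g⁻¹) (x : J) :
    β.1 x = (conjEmb H g).1 ((toInter α β g h).1 x) := Subtype.ext (h x)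

theorem conjEmb_comp (g : G) (x : inter1 H g) :
    ((conjEmb H g).comp H.emb).1 x = g * ((inclEmb H g).comp H.emb).1 x * g⁻¹ := rfl

theorem coe_conjEmb (g : G) (x : inter1 H g) :
    ((conjEmb H g).1 x : G) = g * ((inclEmb H g).comp H.emb).1 x * g⁻¹ := rfl

theorem act_eq (α β : Emb J H) (g : G)
    (h : ∀ x, (β.comp H.emb).1 x = g * (α.comp H.emb).1 x * g⁻¹) (χ χ' : Emb J G)
    (hα : ∀ x, χ.1 x = H.emb.1 (α.1 x)) (hβ : ∀ x, χ'.1 x = H.emb.1 (β.1 x))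
    (hχ : ∀ x, χ'.1 x = g * χ.1 x * g⁻¹) (V : T.Cat G) :
    act H α β g h V = (rc α H.emb χ hα V).hom ≫ (tw χ χ' g hχ V).hom ≫
      (rc β H.emb χ' hβ V).inv := by
  obtain rfl : χ = α.comp H.emb := Subtype.ext (MonoidHom.ext hα)
  obtain rfl : χ' = β.comp H.emb := Subtype.ext (MonoidHom.ext hβ)
  rfl

/-- The inclusion `H[g] → G`. -/
abbrev inclTopEmb (g : G) : Emb (inter1 H g) G :=
  ⟨(inter1 H g).subtype, (inter1 H g).subtype_injective⟩

/-- The homomorphism `H[g] → G`, `x ↦ g x g⁻¹`. -/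
abbrev conjTopEmb (g : G) : Emb (inter1 H g) G :=
  ⟨conjHomTop g (inter1 H g), conjHomTop_injective g (inter1 H g)⟩

theorem inclTopEmb_apply (g : G) (x : inter1 H g) :
    (inclTopEmb H g).1 x = H.emb.1 ((inclEmb H g).1 x) := rfl

theorem conjTopEmb_apply (g : G) (x : inter1 H g) :
    (conjTopEmb H g).1 x = H.emb.1 ((conjEmb H g).1 x) := rfl

theorem conjTopEmb_apply' (g : G) (x : inter1 H g) :
    (conjTopEmb H g).1 x = g * (inclTopEmb H g).1 x * g⁻¹ := rfl

section invariant

variable {V V' : T.Cat G} (f : (T.res H.emb).obj V ⟶ (T.res H.emb).obj V')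

theorem isInvariant_iff : T.toResSystem.IsInvariant H f ↔
    ∀ g : G, (T.res (inclEmb H g)).map f ≫
        act H (inclEmb H g) (conjEmb H g) g (conjEmb_comp H g) V' =
      act H (inclEmb H g) (conjEmb H g) g (conjEmb_comp H g) V ≫ (T.res (conjEmb H g)).map f := by
  refine forall_congr' fun g ↦ ?_
  rw [act_eq H _ _ g _ (inclTopEmb H g) (conjTopEmb H g) (inclTopEmb_apply H g)
    (conjTopEmb_apply H g) (conjTopEmb_apply' H g), act_eq H _ _ g _ (inclTopEmb H g)
    (conjTopEmb H g) (inclTopEmb_apply H g) (conjTopEmb_apply H g) (conjTopEmb_apply' H g)]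
  -- This is `IsInvariant` at `g` with its definitions unfolded; the rest cancels restriction
  -- isomorphisms.
  trans (tw (inclTopEmb H g) (conjTopEmb H g) g (conjTopEmb_apply' H g) V).hom ≫
      (rc (conjEmb H g) H.emb (conjTopEmb H g) (conjTopEmb_apply H g) V).inv ≫
        (T.res (conjEmb H g)).map f ≫
          (rc (conjEmb H g) H.emb (conjTopEmb H g) (conjTopEmb_apply H g) V').hom =
    ((rc (inclEmb H g) H.emb (inclTopEmb H g) (inclTopEmb_apply H g) V).inv ≫
        (T.res (inclEmb H g)).map f ≫
          (rc (inclEmb H g) H.emb (inclTopEmb H g) (inclTopEmb_apply H g) V').hom) ≫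
      (tw (inclTopEmb H g) (conjTopEmb H g) g (conjTopEmb_apply' H g) V').hom
  · rfl
  · rw [← cancel_mono (rc (conjEmb H g) H.emb (conjTopEmb H g) (conjTopEmb_apply H g) V').inv,
      ← cancel_epi (rc (inclEmb H g) H.emb (inclTopEmb H g) (inclTopEmb_apply H g) V).hom]
    simp only [Category.assoc, Iso.hom_inv_id, Iso.hom_inv_id_assoc, Category.comp_id]
    exact eq_comm

end invariant

end RepSystem

namespace RepSystem

variable {k : Type u} [CommRing k] {T : RepSystem.{u, a, b} k}
variable {I J K G : Type u} [Group I] [Group J] [Group K] [Group G] {H : Subgroup G}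

theorem coe_eq_of_comp {α β : Emb J H} {g : G}
    (h : ∀ x, (β.1 x : G) = g * (α.comp H.emb).1 x * g⁻¹) (x : J) :
    (β.comp H.emb).1 x = g * (α.comp H.emb).1 x * g⁻¹ := h x

/-! ### Descent of morphisms -/

/-- The group `H[g]` is universal among groups with two embeddings into `H` that differ by
conjugation by `g`, so the condition there restricts to every such pair. This generality is needed
because Mackey subgroups are subgroups of `H`, not of `G`. -/
theorem map_act_of_isInvariant {V V' : T.Cat G}
    {f : (T.res H.emb).obj V ⟶ (T.res H.emb).obj V'} (hf : T.toResSystem.IsInvariant H f)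
    (α β : Emb J H) (g : G) (h : ∀ x, (β.1 x : G) = g * (α.comp H.emb).1 x * g⁻¹) :
    (T.res α).map f ≫ act H α β g (coe_eq_of_comp h) V' =
      act H α β g (coe_eq_of_comp h) V ≫ (T.res β).map f := by
  have := congrArg (rs (toInter α β g h) (inclEmb H g) (conjEmb H g) α β
    (inclEmb_toInter α β g h) (conjEmb_toInter α β g h)) ((isInvariant_iff H f).1 hf g)
  rwa [rs_comp _ _ (inclEmb H g) _ α _ (inclEmb_toInter α β g h), rs_map,
    rs_comp _ _ (conjEmb H g) _ β _ (conjEmb_toInter α β g h), rs_map,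
    rs_act H _ _ _ _ _ _ _ g _ (coe_eq_of_comp h),
    rs_act H _ _ _ _ _ _ _ g _ (coe_eq_of_comp h)] at this

/-- The parts at `g` of the two composites in `exists_res_map_eq` are the two sides of the
invariance condition. -/
theorem exists_res_map_eq_of_isInvariant [Finite G] (c : k) (hc : c * H.index = 1) {V V' : T.Cat G}
    {f : (T.res H.emb).obj V ⟶ (T.res H.emb).obj V'} (hf : T.toResSystem.IsInvariant H f) :
    ∃ f₀ : V ⟶ V', (T.res H.emb).map f₀ = f :=
  exists_res_map_eq H c hc f (eq_of_part_eq H H.emb _ _ fun g ↦ by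
    rw [part_comp, comp_part, part_cu H _ _ g (coe_eq_of_comp (coe_mackeyEmb H H.emb g)),
      part_cu H _ _ g (coe_eq_of_comp (coe_mackeyEmb H H.emb g))]
    exact (map_act_of_isInvariant hf _ _ g (coe_mackeyEmb H H.emb g)).symm)

theorem isInvariant_res_map {V V' : T.Cat G} (f : V ⟶ V') :
    T.toResSystem.IsInvariant H ((T.res H.emb).map f) :=
  (isInvariant_iff H _).2 fun g ↦ act_naturality H (inclEmb H g) (conjEmb H g) g
      (conjEmb_comp H g) f

theorem morphismsDescend [Finite G] (c : k) (hc : c * H.index = 1) :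
    T.toResSystem.MorphismsDescend H := by
  intro V V'
  refine ⟨fun f _ ↦ isInvariant_res_map f, fun f _ f' _ h ↦ res_map_injective H c hc f f' h,
    fun f hf ↦ ?_⟩
  obtain ⟨f₀, h₀⟩ := exists_res_map_eq_of_isInvariant c hc hf
  exact ⟨f₀, trivial, h₀⟩

/-! ### Descent of objects -/

section objects

variable {W : T.Cat H} (σ : ∀ g : G, (T.res (inclEmb H g)).obj W ⟶ (T.res (conjEmb H g)).obj W)

/-- The restriction of a gluing family. -/
def glue (α β : Emb J H) (g : G) (h : ∀ x, (β.1 x : G) = g * (α.comp H.emb).1 x * g⁻¹) :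
    (T.res α).obj W ⟶ (T.res β).obj W :=
  rs (toInter α β g h) (inclEmb H g) (conjEmb H g) α β
    (inclEmb_toInter α β g h) (conjEmb_toInter α β g h) (σ g)

theorem rs_glue (j : Emb J K) (α β : Emb K H) (α' β' : Emb J H) (hα : ∀ x, α'.1 x = α.1 (j.1 x))
    (hβ : ∀ x, β'.1 x = β.1 (j.1 x)) (g : G)
    (h : ∀ x, (β.1 x : G) = g * (α.comp H.emb).1 x * g⁻¹)
    (h' : ∀ x, (β'.1 x : G) = g * (α'.comp H.emb).1 x * g⁻¹) :
    rs j α β α' β' hα hβ (glue σ α β g h) = glue σ α' β' g h' :=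
  rs_rs (toInter α β g h) (inclEmb H g) (conjEmb H g) α β (inclEmb_toInter α β g h)
    (conjEmb_toInter α β g h) j (toInter α' β' g h') α' β'
    (fun x ↦ Subtype.ext (congrArg (fun y : H ↦ (y : G)) (hα x))) hα hβ
    (inclEmb_toInter α' β' g h') (conjEmb_toInter α' β' g h') (σ g)

theorem glue_self (g : G) : glue σ (inclEmb H g) (conjEmb H g) g (coe_conjEmb H g) = σ g :=
  rs_self _ _ _ (fun _ ↦ rfl) _ _ _

theorem glue_coe (hσ : ∀ x : H, σ x = (tw (inclEmb H x) (conjEmb H x) x (fun _ ↦ rfl) W).hom)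
    (α β : Emb J H) (g : G) (x : H) (hg : g = x)
    (h : ∀ y, (β.1 y : G) = g * (α.comp H.emb).1 y * g⁻¹)
    (h' : ∀ y, β.1 y = x * α.1 y * x⁻¹) :
    glue σ α β g h = (tw α β x h' W).hom := by
  subst hg
  rw [glue, hσ]
  exact rs_tw _ _ _ _ _ _ _ x _ h'

end objects

end RepSystem

namespace RepSystem

variable {k : Type u} [CommRing k] {T : RepSystem.{u, a, b} k}
variable {I J K G : Type u} [Group I] [Group J] [Group K] [Group G] {H : Subgroup G}

/-! ### The cocycle condition along arbitrary embeddings. -/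

section inter2

variable (H) (g₂ g₁ : G)

/-- The inclusion `H[g₂, g₁] → H`. -/
abbrev inclEmb₂ : Emb (inter2 H g₂ g₁) H :=
  ⟨Subgroup.inclusion (inf_le_right : inter2 H g₂ g₁ ≤ H), Subgroup.inclusion_injective _⟩

/-- The homomorphism `H[g₂, g₁] → H`, `x ↦ g₁ x g₁⁻¹`. -/
abbrev conjEmb₂ : Emb (inter2 H g₂ g₁) H :=
  ⟨conjHom g₁ (inter2 H g₂ g₁) H (inter2_conj H g₂ g₁), conjHom_injective _ _ _ _⟩

/-- The homomorphism `H[g₂, g₁] → H`, `x ↦ g₂ g₁ x g₁⁻¹ g₂⁻¹`. -/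
abbrev conjMulEmb₂ : Emb (inter2 H g₂ g₁) H :=
  ⟨conjHom (g₂ * g₁) (inter2 H g₂ g₁) H (inter2_conj_mul H g₂ g₁), conjHom_injective _ _ _ _⟩

theorem coe_conjEmb₂ (x : inter2 H g₂ g₁) :
    ((conjEmb₂ H g₂ g₁).1 x : G) = g₁ * ((inclEmb₂ H g₂ g₁).comp H.emb).1 x * g₁⁻¹ := rfl

theorem coe_conjMulEmb₂ (x : inter2 H g₂ g₁) : ((conjMulEmb₂ H g₂ g₁).1 x : G) =
    (g₂ * g₁) * ((inclEmb₂ H g₂ g₁).comp H.emb).1 x * (g₂ * g₁)⁻¹ := rfl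

theorem coe_conjMulEmb₂' (x : inter2 H g₂ g₁) : ((conjMulEmb₂ H g₂ g₁).1 x : G) =
    g₂ * ((conjEmb₂ H g₂ g₁).comp H.emb).1 x * g₂⁻¹ := by
  rw [coe_conjMulEmb₂, mul_inv_rev]
  change _ = g₂ * (g₁ * (x : G) * g₁⁻¹) * g₂⁻¹
  simp only [mul_assoc]
  rfl

end inter2

section objects

variable {W : T.Cat H} (σ : T.toResSystem.GluingFamily H W)

/-- The morphisms of a gluing family. -/
def glueHom (g : G) : (T.res (inclEmb H g)).obj W ⟶ (T.res (conjEmb H g)).obj W := (σ g).hom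

variable {σ}

theorem glueHom_coe (hσ : T.toResSystem.ExtendsTau σ) (x : H) :
    glueHom σ x = (tw (inclEmb H x) (conjEmb H x) x (fun _ ↦ rfl) W).hom := hσ x

theorem glue_comp_inter2 (hσ : T.toResSystem.IsCocycle σ) (g₁ g₂ : G) :
    glue (glueHom σ) (inclEmb₂ H g₂ g₁) (conjEmb₂ H g₂ g₁) g₁ (coe_conjEmb₂ H g₂ g₁) ≫
      glue (glueHom σ) (conjEmb₂ H g₂ g₁) (conjMulEmb₂ H g₂ g₁) g₂ (coe_conjMulEmb₂' H g₂ g₁) =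
    glue (glueHom σ) (inclEmb₂ H g₂ g₁) (conjMulEmb₂ H g₂ g₁) (g₂ * g₁)
      (coe_conjMulEmb₂ H g₂ g₁) := hσ g₁ g₂

/-- Three embeddings related by `g₁` and `g₂` factor through `H[g₂, g₁]`, so (II) restricts to `J`.
-/
theorem glue_comp (hσ : T.toResSystem.IsCocycle σ) (α β γ : Emb J H) (g₁ g₂ g : G)
    (hg : g = g₂ * g₁) (h₁ : ∀ x, (β.1 x : G) = g₁ * (α.comp H.emb).1 x * g₁⁻¹)
    (h₂ : ∀ x, (γ.1 x : G) = g₂ * (β.comp H.emb).1 x * g₂⁻¹)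
    (h : ∀ x, (γ.1 x : G) = g * (α.comp H.emb).1 x * g⁻¹) :
    glue (glueHom σ) α β g₁ h₁ ≫ glue (glueHom σ) β γ g₂ h₂ = glue (glueHom σ) α γ g h := by
  subst hg
  let l : Emb J (inter2 H g₂ g₁) := ⟨(H.emb.1.comp α.1).codRestrict _ fun x ↦
      ⟨⟨mem_conjBy.2 (h x ▸ (γ.1 x).2), mem_conjBy.2 (h₁ x ▸ (β.1 x).2)⟩, (α.1 x).2⟩,
    fun x y hxy ↦ α.2 (Subtype.ext (congrArg (fun z : inter2 H g₂ g₁ ↦ (z : G)) hxy))⟩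
  have hα : ∀ x, α.1 x = (inclEmb₂ H g₂ g₁).1 (l.1 x) := fun x ↦ rfl
  have hβ : ∀ x, β.1 x = (conjEmb₂ H g₂ g₁).1 (l.1 x) := fun x ↦ Subtype.ext (h₁ x)
  have hγ : ∀ x, γ.1 x = (conjMulEmb₂ H g₂ g₁).1 (l.1 x) := fun x ↦ Subtype.ext (h x)
  rw [← rs_glue (glueHom σ) l _ _ _ _ hα hγ _ (coe_conjMulEmb₂ H g₂ g₁), ← glue_comp_inter2 hσ,
    rs_comp l _ _ _ _ hα hβ, rs_glue (glueHom σ) l _ _ _ _ hα hβ _ (coe_conjEmb₂ H g₂ g₁) h₁,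
    rs_glue (glueHom σ) l _ _ _ _ hβ hγ _ (coe_conjMulEmb₂' H g₂ g₁) h₂]

theorem glue_one (hσ : T.toResSystem.ExtendsTau σ) (α : Emb J H)
    (h : ∀ x, (α.1 x : G) = 1 * (α.comp H.emb).1 x * 1⁻¹) :
    glue (glueHom σ) α α 1 h = 𝟙 _ := by
  rw [glue_coe _ (glueHom_coe hσ) α α 1 1 rfl h (fun y ↦ by simp), tw_one]

end objects

end RepSystem

/-- A conjugate of an injective homomorphism. -/
def Emb.conj {J K : Type u} [Group J] [Group K] (α : Emb J K) (x : K) : Emb J K :=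
  ⟨(MulAut.conj x).toMonoidHom.comp α.1, (MulAut.conj x).injective.comp α.2⟩

theorem Emb.conj_apply {J K : Type u} [Group J] [Group K] (α : Emb J K) (x : K) (z : J) :
    (α.conj x).1 z = x * α.1 z * x⁻¹ := rfl

/-- The identity as an injective homomorphism. -/
def Emb.refl (K : Type u) [Group K] : Emb K K := ⟨MonoidHom.id K, fun _ _ h ↦ h⟩

theorem Emb.refl_apply {K : Type u} [Group K] (x : K) : (Emb.refl K).1 x = x := rfl

/-! ### Gluing families as coactions. -/

namespace RepSystem

variable {k : Type u} [CommRing k] {T : RepSystem.{u, a, b} k}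
variable {I J K G : Type u} [Group I] [Group J] [Group K] [Group G] [Finite G] {H : Subgroup G}

variable {W : T.Cat H} {σ : T.toResSystem.GluingFamily H W}

/-- A morphism into a restricted coinduced object with parts given by a gluing family. -/
def IsCoaction (σ : T.toResSystem.GluingFamily H W)
    (s : W ⟶ (T.res H.emb).obj ((T.coind H).obj W)) : Prop :=
  ∀ (J : Type u) [Group J] (α β : Emb J H) (g : G)
    (h : ∀ x, (β.1 x : G) = g * (α.comp H.emb).1 x * g⁻¹),
    part H H.emb α β g h s = glue (glueHom σ) α β g h

/-- The parts are prescribed as `σ_r` at the representatives `r` of double cosets. For `g = y⁻¹ r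
x⁻¹` with `x, y ∈ H`, the part at `g` is then `τ_{y⁻¹} σ_r τ_{x⁻¹}`; by (I) the outer factors are
values of `σ`, and by (II) the product is `σ_g`. -/
theorem exists_coaction (hI : T.toResSystem.ExtendsTau σ) (hII : T.toResSystem.IsCocycle σ) :
    ∃ s : W ⟶ (T.res H.emb).obj ((T.coind H).obj W), IsCoaction σ s := by
  obtain ⟨s, hs⟩ := exists_part_eq (T := T) (Z := W) (X := W) H H.emb
    (fun g ↦ glue (glueHom σ) _ _ g (coe_mackeyEmb H H.emb g))
  refine ⟨s, fun J _ α β g h ↦ ?_⟩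
  obtain ⟨y, _, hy, ⟨x, rfl⟩, e⟩ := DoubleCoset.mk_out_eq_mul H H.emb.1.range g
  have hs' := hs (DoubleCoset.mk H H.emb.1.range g)
  set r := Quotient.out (DoubleCoset.mk H H.emb.1.range g)
  lift y to H using hy
  have e' : g = ((y⁻¹ : H) : G) * r * H.emb.1 x⁻¹ := by
    rw [e, map_inv, Subgroup.coe_inv]; group
  -- Conjugating `α` by `x⁻¹` and `β` by `y` makes the pair related by `r` instead of `g`, so it
  -- factors through the Mackey subgroup of `r`, where the part is known.
  have h₁ : ∀ z, r * ((α.conj x⁻¹).comp H.emb).1 z * r⁻¹ = ((β.conj y).1 z : G) := fun z ↦ by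
    simp only [Emb.comp_apply, Emb.conj_apply, map_mul, map_inv, inv_inv, Subgroup.coe_mul,
      Subgroup.coe_inv, h, e]
    group
  let θ : Emb J (PlainRep.mackeySubgroup H H.emb.1 r) :=
    ⟨(α.conj x⁻¹).1.codRestrict _ fun z ↦ by
        have := h₁ z
        rw [Emb.comp_apply] at this
        change r * H.emb.1 ((α.conj x⁻¹).1 z) * r⁻¹ ∈ H
        rw [this]
        exact ((β.conj y).1 z).2,
      fun z z' hz ↦ (α.conj x⁻¹).2
        (congrArg (fun z : PlainRep.mackeySubgroup H H.emb.1 r ↦ (z : H)) hz)⟩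
  have hθ : ∀ z, (α.conj x⁻¹).1 z = (PlainRep.mackeySubgroup H H.emb.1 r).emb.1 (θ.1 z) :=
    fun _ ↦ rfl
  have hθ' : ∀ z, (β.conj y).1 z = (mackeyEmb H H.emb r).1 (θ.1 z) :=
    fun z ↦ Subtype.ext (h₁ z).symm
  have h₂ : part H H.emb (α.conj x⁻¹) (β.conj y) r (fun z ↦ (h₁ z).symm) s =
      glue (glueHom σ) (α.conj x⁻¹) (β.conj y) r (fun z ↦ (h₁ z).symm) := by
    rw [← cancel_epi (rc θ _ _ hθ W).hom, ← part_res H H.emb _ _ r (coe_mackeyEmb H H.emb r) θ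
      _ _ hθ hθ', hs',
      map_comp_rc θ _ _ _ _ hθ hθ', rs_glue _ θ _ _ _ _ hθ hθ']
  have h₃ : ∀ z, β.1 z = y⁻¹ * (β.conj y).1 z * y⁻¹⁻¹ := fun z ↦ by
    rw [Emb.conj_apply]; group
  have h₄ : ∀ z, ((α.conj x⁻¹).1 z : G) =
      ((x⁻¹ : H) : G) * (α.comp H.emb).1 z * ((x⁻¹ : H) : G)⁻¹ :=
    fun z ↦ rfl
  have h₅ : ∀ z, (β.1 z : G) =
      ((y⁻¹ : H) : G) * ((β.conj y).comp H.emb).1 z * ((y⁻¹ : H) : G)⁻¹ :=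
    fun z ↦ congrArg Subtype.val (h₃ z)
  have h₆ : ∀ z, (β.1 z : G) = ((y⁻¹ : H) : G) * r * ((α.conj x⁻¹).comp H.emb).1 z *
      (((y⁻¹ : H) : G) * r)⁻¹ := fun z ↦ by
    rw [h₅, Emb.comp_apply _ _ z, show H.emb.1 ((β.conj y).1 z) = _ from (h₁ z).symm]; group
  rw [← tw_part_tw H H.emb α (β.conj y) g (α.conj x⁻¹) β r x⁻¹ y⁻¹ (Emb.conj_apply _ _) h₃
    (fun z ↦ (h₁ z).symm) h e', h₂, ← glue_coe _ (glueHom_coe hI) _ _ _ x⁻¹ rfl h₄,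
    ← glue_coe _ (glueHom_coe hI) _ _ _ y⁻¹ rfl h₅, glue_comp hII _ _ _ _ _ _ rfl _ _ h₆,
    glue_comp hII _ _ _ ((x⁻¹ : H) : G) _ g e' _ _ h]

theorem part_eq (κ : Emb J G) (θ : Emb I J) (β : Emb I H) (g : G)
    (h : ∀ x, (β.1 x : G) = g * (θ.comp κ).1 x * g⁻¹) (χ : Emb I G)
    (hχ : ∀ x, χ.1 x = κ.1 (θ.1 x)) (h' : ∀ x, (β.1 x : G) = g * χ.1 x * g⁻¹)
    {Z : T.Cat J} {X : T.Cat H} (m : Z ⟶ (T.res κ).obj ((T.coind H).obj X)) :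
    part H κ θ β g h m = (T.res θ).map m ≫ (rc θ κ χ hχ _).hom ≫ ev H χ β g h' X := by
  obtain rfl : χ = θ.comp κ := Subtype.ext (MonoidHom.ext hχ)
  rfl

theorem part_comp_rc (β : Emb J H) (θ : Emb I J) (γ : Emb I H) (g : G)
    (h : ∀ x, (γ.1 x : G) = g * (θ.comp (β.comp H.emb)).1 x * g⁻¹)
    (h' : ∀ x, (γ.1 x : G) = g * ((θ.comp β).comp H.emb).1 x * g⁻¹) {Z : T.Cat J} {X : T.Cat H}
    (m : Z ⟶ (T.res β).obj ((T.res H.emb).obj ((T.coind H).obj X))) :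
    part H (β.comp H.emb) θ γ g h
        (m ≫ (rc β H.emb (β.comp H.emb) (Emb.comp_apply _ _) _).hom) =
      (T.res θ).map m ≫ (rc θ β (θ.comp β) (Emb.comp_apply _ _) _).hom ≫
        (rc (θ.comp β) H.emb ((θ.comp β).comp H.emb) (Emb.comp_apply _ _) _).hom ≫
        ev H ((θ.comp β).comp H.emb) γ g h' X := by
  rw [part, Functor.map_comp_assoc, reassoc_of% (rc_assoc θ β H.emb (θ.comp β) (β.comp H.emb)
    (θ.comp (β.comp H.emb)) (Emb.comp_apply _ _) (Emb.comp_apply _ _) (Emb.comp_apply _ _)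
    (Emb.comp_apply (θ.comp β) H.emb))]
  rfl

theorem act_rc_ev (α β γ : Emb J H) (g g' : G)
    (h : ∀ x, (β.comp H.emb).1 x = g * (α.comp H.emb).1 x * g⁻¹)
    (h' : ∀ x, (γ.1 x : G) = g' * (β.comp H.emb).1 x * g'⁻¹)
    (h'' : ∀ x, (γ.1 x : G) = (g' * g) * (α.comp H.emb).1 x * (g' * g)⁻¹) (X : T.Cat H) :
    act H α β g h ((T.coind H).obj X) ≫
        (rc β H.emb (β.comp H.emb) (Emb.comp_apply _ _) _).hom ≫ ev H (β.comp H.emb) γ g' h' X =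
      (rc α H.emb (α.comp H.emb) (Emb.comp_apply _ _) _).hom ≫
        ev H (α.comp H.emb) γ (g' * g) h'' X := by
  rw [act, Category.assoc, Category.assoc, Iso.inv_hom_id_assoc, tw_ev H _ _ _ _ _ _ rfl h h' h'']

section coaction

variable {s : W ⟶ (T.res H.emb).obj ((T.coind H).obj W)}

/-- The counit is evaluation at `1`, and the part of `s` at `1` is `σ_1`, the identity by (I). -/
theorem IsCoaction.counit (hs : IsCoaction σ s) (hI : T.toResSystem.ExtendsTau σ) :
    s ≫ cc H W = 𝟙 W := by
  have h₁ : ∀ x, H.emb.1 x = H.emb.1 ((Emb.refl H).1 x) := fun x ↦ by rw [Emb.refl_apply]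
  have h₂ : ∀ x, ((Emb.refl H).1 x : G) = 1 * H.emb.1 x * 1⁻¹ := fun x ↦ by
    rw [Emb.refl_apply, one_mul, inv_one, mul_one, Subgroup.subtype_apply]
  have h₃ : ∀ x, ((Emb.refl H).1 x : G) = 1 * ((Emb.refl H).comp H.emb).1 x * 1⁻¹ := fun x ↦ by
    rw [Emb.comp_apply, one_mul, inv_one, mul_one, Subgroup.subtype_apply]
  have h₄ := (hs H (Emb.refl H) (Emb.refl H) 1 h₃).trans (glue_one hI (Emb.refl H) h₃)
  rw [part_eq H.emb (Emb.refl H) (Emb.refl H) 1 h₃ H.emb h₁ h₂] at h₄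
  have h₅ := h₄ =≫ (ri (Emb.refl H) Emb.refl_apply W).hom
  rw [Category.assoc, Category.assoc, ev_one H (Emb.refl H) Emb.refl_apply,
    reassoc_of% (ri_naturality (Emb.refl H) Emb.refl_apply), Category.id_comp] at h₅
  rwa [← cancel_epi (ri (Emb.refl H) Emb.refl_apply W).hom, Category.comp_id]

/-- The left side is the part of `s` at `g' g`, that is `σ_{g' g}`; the right side is `σ_g` followed
by the part `σ_{g'}`. Condition (II) equates them. -/
theorem IsCoaction.part_act_comp_rc (hs : IsCoaction σ s) (hII : T.toResSystem.IsCocycle σ)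
    (α β : Emb J H) (g : G) (h₁ : ∀ x, (β.1 x : G) = g * (α.comp H.emb).1 x * g⁻¹) (θ : Emb I J)
    (γ : Emb I H) (g' : G)
    (h₂ : ∀ x, (γ.1 x : G) = g' * (θ.comp (β.comp H.emb)).1 x * g'⁻¹) :
    part H (β.comp H.emb) θ γ g' h₂ (((T.res α).map s ≫
        act H α β g (coe_eq_of_comp h₁) ((T.coind H).obj W)) ≫
          (rc β H.emb (β.comp H.emb) (Emb.comp_apply _ _) _).hom) =
      part H (β.comp H.emb) θ γ g' h₂ ((glue (glueHom σ) α β g h₁ ≫ (T.res β).map s) ≫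
          (rc β H.emb (β.comp H.emb) (Emb.comp_apply _ _) _).hom) := by
  have h₃ : ∀ x, ((θ.comp β).1 x : G) = g * ((θ.comp α).comp H.emb).1 x * g⁻¹ := fun x ↦ h₁ _
  have h₄ : ∀ x, (γ.1 x : G) =
      (g' * g) * ((θ.comp α).comp H.emb).1 x * (g' * g)⁻¹ := fun x ↦ by
    rw [h₂ x, mul_inv_rev]
    change g' * (β.1 (θ.1 x) : G) * g'⁻¹ = _
    rw [h₁]
    simp only [mul_assoc]
    rfl
  have h₅ : ∀ x, (γ.1 x : G) = g' * ((θ.comp β).comp H.emb).1 x * g'⁻¹ := h₂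
  rw [part_comp_rc _ _ _ _ _ h₅, part_comp_rc _ _ _ _ _ h₅, Functor.map_comp_assoc,
    Functor.map_comp_assoc,
    reassoc_of% (map_comp_rc θ _ _ (θ.comp α) (θ.comp β) (Emb.comp_apply _ _) (Emb.comp_apply _ _)),
    reassoc_of% (rc_naturality θ β (θ.comp β) (Emb.comp_apply _ _)),
    reassoc_of% (map_comp_rc θ _ _ (θ.comp α) (θ.comp β) (Emb.comp_apply _ _) (Emb.comp_apply _ _)),
    rs_act H θ α β _ _ _ _ g _ (coe_eq_of_comp h₃), rs_glue _ θ α β _ _ _ _ g _ h₃,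
    act_rc_ev _ _ _ _ _ _ _ h₄, reassoc_of% (rc_naturality θ α (θ.comp α) (Emb.comp_apply _ _))]
  congr 1
  exact (hs _ (θ.comp α) γ (g' * g) h₄).trans ((glue_comp hII _ _ _ g g' _ rfl h₃ h₅ h₄).symm.trans
    (congrArg (_ ≫ ·) (hs _ (θ.comp β) γ g' h₅).symm))

/-- The target involves two coinductions, so parts are taken twice, at `g` for the outer one and at
`g'` for the inner one. Composing with the restriction isomorphism presents the target of the part
at `g` as a single restriction of `Coind W`, to which `eq_of_part_eq` applies again. -/
theorem IsCoaction.coassoc (hs : IsCoaction σ s) (hII : T.toResSystem.IsCocycle σ) :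
    s ≫ (T.res H.emb).map (cu H ((T.coind H).obj W)) =
      s ≫ (T.res H.emb).map ((T.coind H).map s) := by
  refine eq_of_part_eq H H.emb _ _ fun g ↦ ?_
  rw [comp_part, part_cu H _ _ g (coe_eq_of_comp (coe_mackeyEmb H H.emb g)), part_comp, hs,
    ← cancel_mono (rc (mackeyEmb H H.emb g) H.emb ((mackeyEmb H H.emb g).comp H.emb)
      (Emb.comp_apply _ _) _).hom]
  exact eq_of_part_eq H ((mackeyEmb H H.emb g).comp H.emb) _ _ fun g' ↦
    hs.part_act_comp_rc hII _ _ g (coe_mackeyEmb H H.emb g) _ _ g' _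

end coaction

end RepSystem

/-! ### Existence and uniqueness of the glued object. -/

namespace RepSystem

variable {k : Type u} [CommRing k] {T : RepSystem.{u, a, b} k}
variable {G : Type u} [Group G] {H : Subgroup G}
variable {W : T.Cat H} {σ : T.toResSystem.GluingFamily H W}

theorem isExtension_iff {V : T.Cat G} (f : (T.res H.emb).obj V ≅ W) :
    T.toResSystem.IsExtension σ V f ↔ ∀ g : G,
      act H (inclEmb H g) (conjEmb H g) g (conjEmb_comp H g) V ≫ (T.res (conjEmb H g)).map f.hom =
        (T.res (inclEmb H g)).map f.hom ≫ glueHom σ g := by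
  refine forall_congr' fun g ↦ ?_
  rw [act_eq H _ _ g _ (inclTopEmb H g) (conjTopEmb H g) (inclTopEmb_apply H g)
    (conjTopEmb_apply H g) (conjTopEmb_apply' H g)]
  trans (tw (inclTopEmb H g) (conjTopEmb H g) g (conjTopEmb_apply' H g) V).hom ≫
      (rc (conjEmb H g) H.emb (conjTopEmb H g) (conjTopEmb_apply H g) V).inv ≫
        (T.res (conjEmb H g)).map f.hom =
    ((rc (inclEmb H g) H.emb (inclTopEmb H g) (inclTopEmb_apply H g) V).inv ≫
        (T.res (inclEmb H g)).map f.hom) ≫ glueHom σ g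
  · rfl
  · rw [← cancel_epi (rc (inclEmb H g) H.emb (inclTopEmb H g) (inclTopEmb_apply H g) V).hom]
    simp only [Category.assoc, Iso.hom_inv_id_assoc]

/-- Through `f` and `f'` both actions correspond to the same family `σ`, so a morphism over `W`
intertwines them. -/
theorem isInvariant_of_comp_eq {V V' : T.Cat G} {f : (T.res H.emb).obj V ≅ W}
    {f' : (T.res H.emb).obj V' ≅ W} (hf : T.toResSystem.IsExtension σ V f)
    (hf' : T.toResSystem.IsExtension σ V' f')
    {φ : (T.res H.emb).obj V ⟶ (T.res H.emb).obj V'} (hφ : φ ≫ f'.hom = f.hom) :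
    T.toResSystem.IsInvariant H φ := by
  refine (isInvariant_iff H _).2 fun g ↦ ?_
  rw [← cancel_mono ((T.res (conjEmb H g)).map f'.hom), Category.assoc,
    (isExtension_iff f').1 hf' g, ← Functor.map_comp_assoc, hφ, Category.assoc,
    ← Functor.map_comp, hφ, (isExtension_iff f).1 hf g]

variable [Finite G]

/-- The isomorphism from `exists_descent` carries the canonical coaction of `Res V` to `s`. Taking
parts at `g` yields its compatibility with `σ_g`. -/
theorem exists_isExtension (c : k) (hc : c * H.index = 1) (hI : T.toResSystem.ExtendsTau σ)
    (hII : T.toResSystem.IsCocycle σ) :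
    ∃ (V : T.Cat G) (f : (T.res H.emb).obj V ≅ W), T.toResSystem.IsExtension σ V f := by
  obtain ⟨s, hs⟩ := exists_coaction hI hII
  obtain ⟨V, i, f, hfs, hi⟩ := exists_descent H c hc s (hs.counit hI) (hs.coassoc hII)
  refine ⟨V, f, (isExtension_iff f).2 fun g ↦ ?_⟩
  rw [← glue_self (glueHom σ) g, ← hs, ← comp_part, hfs,
    ← part_cu H _ _ g (conjEmb_comp H g) (coe_conjEmb H g), ← part_comp, ← Functor.map_comp, hi]

/-- Over `W` the restriction of `e` is forced to be `f.hom ≫ f'.inv`. This is invariant, hence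
descends, as does its inverse; faithfulness of restriction gives the inverse laws and uniqueness. -/
theorem existsUnique_iso (c : k) (hc : c * H.index = 1) {V V' : T.Cat G}
    {f : (T.res H.emb).obj V ≅ W} {f' : (T.res H.emb).obj V' ≅ W}
    (hf : T.toResSystem.IsExtension σ V f) (hf' : T.toResSystem.IsExtension σ V' f') :
    ∃! e : V ≅ V', (T.res H.emb).map e.hom ≫ f'.hom = f.hom := by
  obtain ⟨e, he⟩ := exists_res_map_eq_of_isInvariant c hc
    (isInvariant_of_comp_eq hf hf' (φ := f.hom ≫ f'.inv) (by simp))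
  obtain ⟨e', he'⟩ := exists_res_map_eq_of_isInvariant c hc
    (isInvariant_of_comp_eq hf' hf (φ := f'.hom ≫ f.inv) (by simp))
  refine ⟨⟨e, e', res_map_injective H c hc _ _ ?_, res_map_injective H c hc _ _ ?_⟩, ?_,
    fun e₁ h₁ ↦ Iso.ext (res_map_injective H c hc _ _ ?_)⟩
  · simp [he, he']
  · simp [he, he']
  · simp [he]
  · simp [he, ← h₁]

theorem objectsDescend (c : k) (hc : c * H.index = 1) : T.toResSystem.ObjectsDescend H :=
  fun _ _ hI hII ↦ ⟨exists_isExtension c hc hI hII,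
    fun _ _ _ _ h₁ h₂ ↦ existsUnique_iso c hc h₁ h₂⟩

end RepSystem

/-! ### Invertibility of the index and conclusion. -/

theorem exists_mul_index_eq_one {p : ℕ} [Fact p.Prime] {n : ℕ} (hn : n.Coprime p) (k : Type u)
    [CommRing k] [Algebra (ZLocAt p) k] : ∃ c : k, c * n = 1 := by
  have h : IsUnit (algebraMap ℤ (ZLocAt p) n) := by
    refine IsLocalization.map_units (ZLocAt p)
      (⟨(n : ℤ), ?_⟩ : (Ideal.span {(p : ℤ)}).primeCompl)
    rw [Ideal.mem_primeCompl_iff, Ideal.mem_span_singleton, Int.natCast_dvd_natCast]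
    intro h
    exact (Fact.out : p.Prime).one_lt.ne' (Nat.dvd_one.1 (hn ▸ Nat.dvd_gcd h dvd_rfl))
  obtain ⟨c, hc⟩ := (h.map (algebraMap (ZLocAt p) k)).exists_left_inv
  exact ⟨c, by simpa using hc⟩

end

theorem mainTheorem1 (p : ℕ) [Fact p.Prime] (G : Type u) [Group G] [Finite G]
    (H : Subgroup G) (hH : H.index.Coprime p) :
    (∀ (k : Type u) [CommRing k] [IsLocalRing k] [Algebra (ZLocAt p) k],
      ((plainSystem k).MorphismsDescend H ∧ (plainSystem k).ObjectsDescend H) ∧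
      ((derivedSystem k).MorphismsDescend H ∧ (derivedSystem k).ObjectsDescend H)) ∧
    (∀ (k : Type u) [Field k] [Algebra (ZLocAt p) k],
      (stableSystem k).MorphismsDescend H ∧ (stableSystem k).ObjectsDescend H) := by
  refine ⟨fun k _ _ _ ↦ ?_, fun k _ _ ↦ ?_⟩
  · obtain ⟨c, hc⟩ := exists_mul_index_eq_one hH k
    rw [← plainRepSystem_toResSystem, ← derivedRepSystem_toResSystem]
    exact ⟨⟨RepSystem.morphismsDescend c hc, RepSystem.objectsDescend c hc⟩,
      ⟨RepSystem.morphismsDescend c hc, RepSystem.objectsDescend c hc⟩⟩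
  · obtain ⟨c, hc⟩ := exists_mul_index_eq_one hH k
    rw [← stableRepSystem_toResSystem]
    exact ⟨RepSystem.morphismsDescend c hc, RepSystem.objectsDescend c hc⟩
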